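/- All decision problems are languages over $\{0,1\}$; a language $A$ is identified with its characteristic function, $A(x)\in\{0,1\}$. "Polynomial time" for classical computations means polynomial time on a deterministic multi-tape Turing machine, and $A\in\mathrm{NP}$ means that there are a polynomial-time predicate $R$ and a polynomial $p$ with $x\in A \iff \exists w,\ |w|\le p(|x|)\wedge R(x,w)$. For a language $A$ and $m\ge 0$, let $\mathrm{P}_{\|}^{A[m]}$ be the class of languages $L$ decidable in polynomial time with at most $m$ non-adaptive queries to $A$: there are a polynomial-time function that maps each $x$ to a list $(q_1,\dots,q_r)$ of strings with $r\le m$, and a polynomial-time predicate $D$ such that $x\in L\iff D\bigl(x,(A(q_1),\dots,A(q_r))\bigr)$. Let $\mathrm{P}_{\|}^{\mathrm{NP}[m]}=\bigcup_{A\in\mathrm{NP}}\mathrm{P}_{\|}^{A[m]}$. A quantum oracle Turing machine is a multi-tape quantum Turing machine with algebraic transition amplitudes, a special query tape, and a pre-query and a post-query state; with every oracle $A$ its time evolution on superpositions of configurations is unitary. A configuration in the pre-query state whose query tape holds $|i\rangle|b\rangle$ (a string $i$ followed by a bit $b$) passes in one step to the post-query state with query tape $|i\rangle|A(i)\oplus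 b\rangle$ and is otherwise unchanged. The machine halts at time $T$ if at time $T$ all configurations in the superposition are in the final state and at no earlier time any of them is; a designated bit is then measured, and the machine accepts if it is $1$. For $k\ge 0$, let $\mathrm{EQP}^{A[k]}$ be the class of languages $L$ for which there is such a machine that, with oracle $A$, on every input $x$ halts at a time bounded by a polynomial in $|x|$, makes at most $k$ (possibly adaptive) queries on every computation path, and accepts with probability $1$ if $x\in L$ and with probability $0$ if $x\notin L$. Let $\mathrm{EQP}^{\mathrm{NP}[k]}=\bigcup_{A\in\mathrm{NP}}\mathrm{EQP}^{A[k]}$. **Theorem.** For every integer $k\ge 0$, $$\mathrm{P}_{\|}^{\mathrm{NP}[2^{k+1}-2]}\subseteq \mathrm{EQP}^{\mathrm{NP}[k]}.$$ -/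

import Mathlib

noncomputable section

namespace BoundedQueries

/-! ### Classical polynomial time, NP, and non-adaptive queries -/

/-- `f` is computable in polynomial time by a deterministic multi-stack Turing machine all of whose
stack alphabets are finite (Mathlib's `FinTM2` itself only asks this of the input stack). -/
def PolyTime {α β αΓ βΓ : Type} (ea : α → List αΓ) (eb : β → List βΓ) (f : α → β) : Prop :=
  ∃ h : Turing.TM2ComputableInPolyTime ea eb f, ∀ k, Finite (h.tm.Γ k)

/-- The pair `(x, y)` written as `x # y`, with `none` as the separator. -/
def encPair (p : List Bool × List Bool) : List (Option Bool) :=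
  p.1.map some ++ none :: p.2.map some

/-- The list `w₁, …, wₘ` written as `w₁ # w₂ # … wₘ #`, with `none` as the terminator. -/
def encList (l : List (List Bool)) : List (Option Bool) :=
  l.flatMap fun w => w.map some ++ [none]

/-- The class NP, by polynomial-time verifiers with polynomially long certificates. -/
def NP : Set (Language Bool) :=
  {A | ∃ (R : List Bool × List Bool → Bool) (p : Polynomial ℕ),
    PolyTime encPair (fun b => [b]) R ∧
    ∀ x, x ∈ A ↔ ∃ w : List Bool, w.length ≤ p.eval x.length ∧ R (x, w) = true}

open Classical in
/-- The value `A(x) ∈ {0, 1}` of the characteristic function of `A`. -/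
def chi (A : Language Bool) (x : List Bool) : Bool := decide (x ∈ A)

/-- The class `P_||^{A[m]}`: on input `x` the list `queries x` of at most `m` strings is produced
in polynomial time without consulting the oracle, and the decision is then made in polynomial time
from `x` and the list of the oracle's answers. -/
def PPar (A : Language Bool) (m : ℕ) : Set (Language Bool) :=
  {L | ∃ (queries : List Bool → List (List Bool)) (decision : List Bool × List Bool → Bool),
    PolyTime id encList queries ∧
    PolyTime encPair (fun b => [b]) decision ∧
    (∀ x, (queries x).length ≤ m) ∧
    ∀ x, x ∈ L ↔ decision (x, (queries x).map (chi A)) = true}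

/-- The class `P_||^{NP[m]}`. -/
def PParNP (m : ℕ) : Set (Language Bool) := {L | ∃ A ∈ NP, L ∈ PPar A m}

/-! ### Quantum oracle Turing machines -/

/-- A multi-tape quantum oracle Turing machine (no unitarity imposed yet, see `WellFormed`).
The tapes are two-way infinite; in one step the machine reads the symbols under all heads and, with
the amplitude given by `δ`, changes its state, rewrites these symbols and moves each head by
`-1`, `0` or `1`. The values of `δ` at the pre-query state are not used. -/
structure QOTM where
  /-- states -/
  Q : Type
  /-- tapes -/
  K : Type
  /-- tape symbols -/
  Γ : Type
  [finQ : Fintype Q]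
  [decQ : DecidableEq Q]
  [finK : Fintype K]
  [decK : DecidableEq K]
  [finΓ : Fintype Γ]
  [decΓ : DecidableEq Γ]
  /-- the blank `sym none` and the two bits among the tape symbols -/
  sym : Option Bool ↪ Γ
  start : Q
  final : Q
  preQuery : Q
  postQuery : Q
  pre_ne_post : preQuery ≠ postQuery
  inputTape : K
  queryTape : K
  outputTape : K
  input_ne_query : inputTape ≠ queryTape
  /-- transition amplitudes -/
  δ : Q → (K → Γ) → Q × (K → Γ) × (K → SignType) → ℂ

namespace QOTM

variable (M : QOTM)

instance : Fintype M.Q := M.finQ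
instance : DecidableEq M.Q := M.decQ
instance : Fintype M.K := M.finK
instance : DecidableEq M.K := M.decK
instance : Fintype M.Γ := M.finΓ
instance : DecidableEq M.Γ := M.decΓ

/-- Classical configurations, the basis states of the machine. -/
@[ext]
structure Cfg where
  state : M.Q
  head : M.K → ℤ
  tape : M.K → ℤ → M.Γ

/-- Superpositions of configurations. -/
abbrev Superposition : Type := M.Cfg →₀ ℂ

/-- The tape with the word `w` in the cells `0, …, |w| - 1` and blanks everywhere else. -/
def wordTape (w : List Bool) : ℤ → M.Γ :=
  fun z => M.sym (if z < 0 then none else w[z.toNat]?)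

/-- Initial configuration: `x` on the input tape, all other tapes blank, all heads on cell `0`. -/
def init (x : List Bool) : M.Cfg where
  state := M.start
  head := fun _ => 0
  tape := fun k => M.wordTape (if k = M.inputTape then x else [])

/-- The configuration that results from changing to state `a.1`, writing the symbols `a.2.1` under
the heads and then moving the heads by `a.2.2`. -/
def act (c : M.Cfg) (a : M.Q × (M.K → M.Γ) × (M.K → SignType)) : M.Cfg where
  state := a.1
  head := fun k => c.head k + (a.2.2 k : ℤ)
  tape := fun k => Function.update (c.tape k) (c.head k) (a.2.1 k)

open Classical in
/-- The oracle call on the query tape, `|i⟩|b⟩ ↦ |i⟩|A(i) ⊕ b⟩`. A tape that does not hold a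
nonempty bit string is left unchanged; since `sym` is injective, `i` and `b` are unique. -/
def oracleTape (A : Language Bool) (t : ℤ → M.Γ) : ℤ → M.Γ :=
  if h : ∃ p : List Bool × Bool, t = M.wordTape (p.1 ++ [p.2]) then
    M.wordTape (h.choose.1 ++ [xor (chi A h.choose.1) h.choose.2])
  else t

/-- The result of an oracle call: the post-query state is entered and only the query tape changes. -/
def oracleCfg (A : Language Bool) (c : M.Cfg) : M.Cfg where
  state := M.postQuery
  head := c.head
  tape := Function.update c.tape M.queryTape (M.oracleTape A (c.tape M.queryTape))

/-- The superposition obtained in one step from the basis state `c`, with oracle `A`. -/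
def stepVec (A : Language Bool) (c : M.Cfg) : M.Superposition :=
  if c.state = M.preQuery then Finsupp.single (M.oracleCfg A c) 1
  else ∑ a : M.Q × (M.K → M.Γ) × (M.K → SignType),
    Finsupp.single (M.act c a) (M.δ c.state (fun k => c.tape k (c.head k)) a)

/-- The time-evolution operator of the machine with oracle `A`. -/
def evolve (A : Language Bool) : Module.End ℂ M.Superposition :=
  Finsupp.linearCombination ℂ (M.stepVec A)

/-- The squared norm of a superposition. -/
def normSq (ψ : M.Superposition) : ℝ := ψ.sum fun _ a => ‖a‖ ^ 2

/-- The time evolution is unitary, whatever the oracle is. -/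
def WellFormed : Prop :=
  ∀ A : Language Bool,
    (∀ ψ, M.normSq (M.evolve A ψ) = M.normSq ψ) ∧ Function.Surjective (M.evolve A)

/-- All transition amplitudes are algebraic numbers. -/
def AlgebraicAmplitudes : Prop := ∀ q s a, IsAlgebraic ℚ (M.δ q s a)

/-- The superposition after `t` steps on input `x` with oracle `A`. -/
def run (A : Language Bool) (x : List Bool) (t : ℕ) : M.Superposition :=
  (M.evolve A ^ t) (Finsupp.single (M.init x) 1)

/-- On input `x` with oracle `A` the machine halts after exactly `T` steps: at time `T` the
superposition consists of configurations in the final state only, and at no earlier time does it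
contain such a configuration. -/
def HaltsAt (A : Language Bool) (x : List Bool) (T : ℕ) : Prop :=
  (∀ c ∈ (M.run A x T).support, c.state = M.final) ∧
    ∀ t < T, ∀ c ∈ (M.run A x t).support, c.state ≠ M.final

/-- On every computation path of `T` steps on input `x` (a sequence of configurations, each reached
from the one before with nonzero amplitude) the oracle is called at most `k` times. -/
def QueriesAtMost (A : Language Bool) (x : List Bool) (T k : ℕ) : Prop :=
  ∀ γ : ℕ → M.Cfg, γ 0 = M.init x → (∀ t < T, M.stepVec A (γ t) (γ (t + 1)) ≠ 0) →
    ((Finset.range T).filter fun t => (γ t).state = M.preQuery).card ≤ k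

/-- The probability that a measurement of `ψ` finds the designated bit, which is cell `0` of the
output tape, to be `1`. -/
def acceptProb (ψ : M.Superposition) : ℝ :=
  ψ.sum fun c a => if c.tape M.outputTape 0 = M.sym (some true) then ‖a‖ ^ 2 else 0

end QOTM

/-- The class `EQP^{A[k]}`: languages decided with acceptance probability `1` or `0` by a quantum
oracle Turing machine that halts in polynomial time and makes at most `k` queries to `A`. -/
def EQP (A : Language Bool) (k : ℕ) : Set (Language Bool) :=
  {L | ∃ M : QOTM, M.WellFormed ∧ M.AlgebraicAmplitudes ∧
    ∃ p : Polynomial ℕ, ∀ x : List Bool, ∃ T ≤ p.eval x.length,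
      M.HaltsAt A x T ∧ M.QueriesAtMost A x T k ∧
      (x ∈ L → M.acceptProb (M.run A x T) = 1) ∧
      (x ∉ L → M.acceptProb (M.run A x T) = 0)}

/-- The class `EQP^{NP[k]}`. -/
def EQPNP (k : ℕ) : Set (Language Bool) := {L | ∃ A ∈ NP, L ∈ EQP A k}

end BoundedQueries

end

/-! Fix an input `x` and let `m = 2 ^ (k + 1) - 2`. The decision is a Boolean function `D` on
`{0,1}^m`, to be evaluated at the vector `v` of true oracle answers. Let `mindChanges D v` be the
largest number of changes of value of `D` along a chain of vectors that ends in `v`. Then `D v` is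
`D ⊥` xor the parity of this number (`eq_xor_mindChanges`), and the number lies between `0` and `m`.
It is monotone in `v`, so "at least `t` mind changes" is an NP question: a certificate proves some
of the answers to be `true`, which gives a vector below `v`, and a sufficient number of changes at
that vector is sufficient at `v` (`exists_oracle`). Thus it remains to find the parity of a number
`n ≤ 2 ^ (k + 1) - 2` with `k` exact quantum queries to the threshold oracle `n ≥ t`.

Deutsch's algorithm tells with one query and no error whether two oracle answers agree. Suppose that
`s` is the current offset, that `0 ≤ n - s ≤ 2e - 2`, and that `e` is an even power of two. Compare
the answers for the thresholds `s + 1` and `s + e`. If they differ, then `0 ≤ n - (s + 1) ≤ e - 2`,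
and passing to `s + 1` flips the parity. If they agree, then either `n = s`, or `n ≥ s + e` and `0 ≤
n - (s + e) ≤ e - 2`. In both cases passing to `s + e` leaves the parity of the truncated difference
unchanged. So a range of `2e - 2` shrinks to `e - 2` per query, and `k` queries bring `2 ^ (k + 1) -
2` down to `0` (`xorNot_searchBits`). The bits found so far are part of the query word, so the
oracle itself works out the thresholds.

The quantum machine first runs a classical program that writes the query lists, the truth table of
`D` and the bit `D ⊥` on the query tape, with a history tape for reversibility. It then performs `k`
rounds of Deutsch's algorithm at the end of that word and scans the resulting bits for their parity
(`deutsch`, `Halts.machine_correct`). Unitarity follows because a step is a product of a partial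
oracle involution, a permutation of local configurations, Hadamard transformations of one cell and
head movements that depend only on the state entered (`Presentation.evolve_eq`).

The classical side needs closure properties of polynomial time. Machines in the sense of `TM2` are
translated into flow charts over stacks, which compose easily, and back (`polyTime_iff_fragPoly`).
Since `k` is constant, `D` has boundedly many arguments, so mind changes are never computed by an
algorithm: they are a finite table in the control of the verifier. -/

noncomputable section

namespace BoundedQueries

open Function

/-! ### Flow charts over finitely many stacks -/

section Frag

variable {K : Type} {Γ : K → Type} {X Y Z : Type}

/-- The contents of all stacks. -/
abbrev Store (Γ : K → Type) : Type := ∀ k, List (Γ k)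

/-- One instruction of a stack machine; `Z` is the type of continuations. -/
inductive Instr (Γ : K → Type) (Z : Type)
  | jump (z : Z)
  | push (k : K) (a : Γ k) (z : Z)
  | peek (k : K) (f : Option (Γ k) → Z)
  | pop (k : K) (f : Option (Γ k) → Z)

namespace Instr

/-- Change of continuations. -/
def map (φ : Y → Z) : Instr Γ Y → Instr Γ Z
  | jump z => jump (φ z)
  | push k a z => push k a (φ z)
  | peek k f => peek k (φ ∘ f)
  | pop k f => pop k (φ ∘ f)

/-- Execution of an instruction. -/
def exec [DecidableEq K] : Instr Γ Z → Store Γ → Z × Store Γ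
  | jump z, s => (z, s)
  | push k a z, s => (z, update s k (a :: s k))
  | peek k f, s => (f (s k).head?, s)
  | pop k f, s => (f (s k).head?, update s k (s k).tail)

theorem exec_map [DecidableEq K] (φ : Y → Z) (i : Instr Γ Y) (s : Store Γ) :
    (i.map φ).exec s = (φ (i.exec s).1, (i.exec s).2) := by
  cases i <;> rfl

theorem length_exec_le [DecidableEq K] (i : Instr Γ Z) (s : Store Γ) (k : K) :
    ((i.exec s).2 k).length ≤ (s k).length + 1 := by
  cases i with
  | jump z => simp [exec]
  | push k' a z =>
    by_cases h : k = k'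
    · subst h; simp [exec]
    · simp [exec, h]
  | peek k' f => simp [exec]
  | pop k' f =>
    by_cases h : k = k'
    · subst h; simp [exec]; omega
    · simp [exec, h]

/-- Reindexing of the stacks. -/
def lift {K₁ : Type} (ι : K₁ → K) : Instr (fun k => Γ (ι k)) Z → Instr Γ Z
  | jump z => jump z
  | push k a z => push (ι k) a z
  | peek k f => peek (ι k) f
  | pop k f => pop (ι k) f

end Instr

/-- A flow chart with entries `X` and exits `Y`. -/
structure Frag (Γ : K → Type) (X Y : Type) where
  Q : Type
  fin : Finite Q
  prog : Q → Instr Γ (Q ⊕ Y)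
  entry : X → Q ⊕ Y

namespace Frag

variable [DecidableEq K]

/-- One step; the exits are fixed. -/
def step (F : Frag Γ X Y) : (F.Q ⊕ Y) × Store Γ → (F.Q ⊕ Y) × Store Γ
  | (.inl q, s) => (F.prog q).exec s
  | (.inr y, s) => (.inr y, s)

/-- From the point `z` with store `s` the exit `y` is reached with store `s₁` within `t` steps. -/
def RunsFrom (F : Frag Γ X Y) (z : F.Q ⊕ Y) (s : Store Γ) (y : Y) (s₁ : Store Γ) (t : ℕ) : Prop :=
  F.step^[t] (z, s) = (.inr y, s₁)

/-- From the entry `x` with store `s` the exit `y` is reached with store `s'` within `t` steps. -/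
def Runs (F : Frag Γ X Y) (x : X) (s : Store Γ) (y : Y) (s' : Store Γ) (t : ℕ) : Prop :=
  F.RunsFrom (F.entry x) s y s' t

theorem iterate_step_exit (F : Frag Γ X Y) (y : Y) (s : Store Γ) (t : ℕ) :
    F.step^[t] (.inr y, s) = (.inr y, s) :=
  iterate_fixed rfl t

theorem RunsFrom.mono {F : Frag Γ X Y} {z : F.Q ⊕ Y} {s s' : Store Γ} {y : Y} {t t' : ℕ}
    (h : F.RunsFrom z s y s' t) (ht : t ≤ t') : F.RunsFrom z s y s' t' := by
  obtain ⟨d, rfl⟩ := Nat.exists_eq_add_of_le ht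
  rw [RunsFrom, Nat.add_comm, iterate_add_apply, h, iterate_step_exit]

theorem Runs.mono {F : Frag Γ X Y} {x : X} {s s' : Store Γ} {y : Y} {t t' : ℕ}
    (h : F.Runs x s y s' t) (ht : t ≤ t') : F.Runs x s y s' t' :=
  RunsFrom.mono h ht

theorem runsFrom_exit (F : Frag Γ X Y) (y : Y) (s : Store Γ) : F.RunsFrom (.inr y) s y s 0 := rfl

theorem runsFrom_succ {F : Frag Γ X Y} {q : F.Q} {s s' : Store Γ} {y : Y} {t : ℕ}
    (h : F.RunsFrom ((F.prog q).exec s).1 ((F.prog q).exec s).2 y s' t) :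
    F.RunsFrom (.inl q) s y s' (t + 1) := h

/-- A step pushes at most one symbol. Hence a time bound is also a bound on the output, which keeps
time bounds polynomial under composition. -/
theorem RunsFrom.length_le {F : Frag Γ X Y} {z : F.Q ⊕ Y} {s s' : Store Γ} {y : Y} {t : ℕ}
    (h : F.RunsFrom z s y s' t) (k : K) : (s' k).length ≤ (s k).length + t := by
  induction t generalizing z s with
  | zero => cases h; simp
  | succ t ih =>
    have := ih (z := (F.step (z, s)).1) (s := (F.step (z, s)).2) h
    have h2 : ((F.step (z, s)).2 k).length ≤ (s k).length + 1 := by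
      cases z with
      | inl q => exact Instr.length_exec_le _ _ _
      | inr y => simp [step]
    omega

/-- Transfer of runs along a simulation. -/
theorem RunsFrom.sim {K' : Type} [DecidableEq K'] {Γ' : K' → Type} {X' Y' : Type}
    {F : Frag Γ X Y} {G : Frag Γ' X' Y'} (φ : F.Q ⊕ Y → G.Q ⊕ Y')
    (r : Store Γ → Store Γ' → Prop)
    (hstep : ∀ q s u, r s u → ∃ u', G.step (φ (.inl q), u) = (φ (F.step (.inl q, s)).1, u') ∧
      r (F.step (.inl q, s)).2 u')
    {z : F.Q ⊕ Y} {s s' : Store Γ} {y : Y} {t : ℕ} (h : F.RunsFrom z s y s' t)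
    {u : Store Γ'} (hu : r s u) :
    ∃ u', r s' u' ∧ ∀ t' y' u'', G.RunsFrom (φ (.inr y)) u' y' u'' t' →
      G.RunsFrom (φ z) u y' u'' (t + t') := by
  induction t generalizing z s u with
  | zero =>
    cases h
    exact ⟨u, hu, fun t' y' u'' h => h.mono (by omega)⟩
  | succ t ih =>
    cases z with
    | inr y₀ =>
      have h' : F.step^[t + 1] (.inr y₀, s) = (.inr y, s') := h
      rw [iterate_step_exit] at h'
      cases h'
      exact ⟨u, hu, fun t' y' u'' h => h.mono (by omega)⟩
    | inl q =>
      obtain ⟨u₁, h₁, h₂⟩ := hstep q s u hu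
      obtain ⟨u', h₃, h₄⟩ := ih (z := (F.step (.inl q, s)).1) h h₂
      refine ⟨u', h₃, fun t' y' u'' h₅ => ?_⟩
      have := h₄ t' y' u'' h₅
      rw [RunsFrom, show t + 1 + t' = (t + t') + 1 by omega, iterate_succ_apply, h₁]
      exact this

/-- The form in which a chart is used as a part of a larger one: `φ` redirects the exits, and the
run of the larger chart from the redirected exit is appended. -/
theorem RunsFrom.sim_eq {X' Y' : Type}
    {F : Frag Γ X Y} {G : Frag Γ X' Y'} (φ : F.Q ⊕ Y → G.Q ⊕ Y') (ψ : F.Q → G.Q)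
    (hψ : ∀ q, φ (.inl q) = .inl (ψ q)) (hprog : ∀ q, G.prog (ψ q) = (F.prog q).map φ)
    {z : F.Q ⊕ Y} {s s' : Store Γ} {y : Y} {t : ℕ} (h : F.RunsFrom z s y s' t)
    {t' : ℕ} {y' : Y'} {s'' : Store Γ} (h' : G.RunsFrom (φ (.inr y)) s' y' s'' t') :
    G.RunsFrom (φ z) s y' s'' (t + t') := by
  obtain ⟨u', rfl, hh⟩ := h.sim φ (fun s u => s = u) (by
    rintro q s _ rfl
    refine ⟨_, ?_, rfl⟩
    rw [hψ]
    simp only [step]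
    rw [hprog, Instr.exec_map]) rfl
  have := hh _ _ _ h'
  exact this

/-- A pure change of the finite memory. -/
def ret (f : X → Y) : Frag Γ X Y where
  Q := Empty
  fin := inferInstance
  prog := Empty.elim
  entry x := .inr (f x)

theorem ret_runs (f : X → Y) (x : X) (s : Store Γ) : (ret (Γ := Γ) f).Runs x s (f x) s 0 := rfl

/-- Push a symbol that depends on the memory, or none at all. -/
def pushOpt [Finite X] (k : K) (f : X → Option (Γ k)) : Frag Γ X X where
  Q := X
  fin := inferInstance
  prog x := match f x with
    | some a => .push k a (.inr x)
    | none => .jump (.inr x)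
  entry := .inl

theorem pushOpt_runs [Finite X] (k : K) (f : X → Option (Γ k)) (x : X) (s : Store Γ) :
    (pushOpt k f).Runs x s x (update s k ((f x).toList ++ s k)) 1 := by
  change ((pushOpt k f).prog x).exec s = _
  simp only [pushOpt]
  cases f x <;> simp [Instr.exec]

/-- Pop a symbol into the memory. -/
def popF [Finite X] (k : K) : Frag Γ X (X × Option (Γ k)) where
  Q := X
  fin := inferInstance
  prog x := .pop k fun o => .inr (x, o)
  entry := .inl

theorem popF_runs [Finite X] (k : K) (x : X) (s : Store Γ) :
    (popF (X := X) k).Runs x s (x, (s k).head?) (update s k (s k).tail) 1 := rfl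

/-- Sequential composition. -/
def seq (F : Frag Γ X Y) (G : Frag Γ Y Z) : Frag Γ X Z where
  Q := F.Q ⊕ G.Q
  fin := by have := F.fin; have := G.fin; infer_instance
  prog
    | .inl q => (F.prog q).map
        (Sum.elim (fun q => .inl (.inl q)) fun y => Sum.map .inr id (G.entry y))
    | .inr q => (G.prog q).map (Sum.map .inr id)
  entry x := Sum.elim (fun q => .inl (.inl q)) (fun y => Sum.map .inr id (G.entry y)) (F.entry x)

theorem seq_runs {F : Frag Γ X Y} {G : Frag Γ Y Z} {x : X} {y : Y} {z : Z} {s s' s'' : Store Γ}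
    {t t' : ℕ} (hF : F.Runs x s y s' t) (hG : G.Runs y s' z s'' t') :
    (F.seq G).Runs x s z s'' (t + t') := by
  have h₂ : (F.seq G).RunsFrom (Sum.map .inr id (G.entry y)) s' z s'' (t' + 0) :=
    RunsFrom.sim_eq (F := G) (G := F.seq G) (Sum.map .inr id) .inr (fun _ => rfl) (fun _ => rfl) hG
      (runsFrom_exit (F.seq G) z s'')
  exact RunsFrom.sim_eq (F := F) (G := F.seq G)
    (Sum.elim (fun q => .inl (.inl q)) fun y => Sum.map .inr id (G.entry y)) .inl
    (fun _ => rfl) (fun _ => rfl) hF h₂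

/-- Pop symbols from stack `k` until it is empty and treat each of them by `body`. -/
def forEach [Finite X] (k : K) (body : Frag Γ (X × Γ k) X) : Frag Γ X X where
  Q := X ⊕ body.Q
  fin := by have := body.fin; infer_instance
  prog
    | .inl x => .pop k fun
      | none => .inr x
      | some a => Sum.elim (fun q => .inl (.inr q)) (fun x => .inl (.inl x)) (body.entry (x, a))
    | .inr q => (body.prog q).map
        (Sum.elim (fun q => .inl (.inr q)) fun x => .inl (.inl x))
  entry x := .inl (.inl x)

theorem forEach_nil [Finite X] {k : K} (body : Frag Γ (X × Γ k) X) (x : X) {s : Store Γ}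
    (h : s k = []) : (forEach k body).Runs x s x s 1 := by
  have e : update s k [] = s := by rw [← h, update_eq_self]
  refine runsFrom_succ (t := 0) ?_
  simp only [forEach, Instr.exec, h, List.tail_nil, e]
  rfl

theorem forEach_cons [Finite X] {k : K} {body : Frag Γ (X × Γ k) X} {x x' y : X}
    {s s' s'' : Store Γ} {a : Γ k} {l : List (Γ k)} {t t' : ℕ} (h : s k = a :: l)
    (hb : body.Runs (x, a) (update s k l) x' s' t) (hr : (forEach k body).Runs x' s' y s'' t') :
    (forEach k body).Runs x s y s'' (t + t' + 1) := by
  refine runsFrom_succ ?_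
  simp only [forEach, Instr.exec, h]
  exact RunsFrom.sim_eq (F := body) (G := forEach k body)
    (Sum.elim (fun q => .inl (.inr q)) fun x => .inl (.inl x)) .inr
    (fun _ => rfl) (fun _ => rfl) hb hr

/-- Reindexing of the stacks. -/
def lift {K₁ : Type} (ι : K₁ → K) (F : Frag (fun k => Γ (ι k)) X Y) : Frag Γ X Y where
  Q := F.Q
  fin := F.fin
  prog q := (F.prog q).lift ι
  entry := F.entry

theorem lift_runs {K₁ : Type} [DecidableEq K₁] {ι : K₁ → K} (hι : Injective ι)
    {F : Frag (fun k => Γ (ι k)) X Y} {x : X} {y : Y} {s₁ s₁' : Store fun k => Γ (ι k)}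
    {t : ℕ} (h : F.Runs x s₁ y s₁' t) {s s' : Store Γ} (hs : ∀ k, s (ι k) = s₁ k)
    (hs' : ∀ k, s' (ι k) = s₁' k) (hs'' : ∀ k, k ∉ Set.range ι → s' k = s k) :
    (F.lift ι).Runs x s y s' t := by
  obtain ⟨u, ⟨hu, hu'⟩, hh⟩ := RunsFrom.sim (F := F) (G := F.lift ι) id
    (fun (v : Store fun k => Γ (ι k)) u => (∀ k, u (ι k) = v k) ∧ ∀ k, k ∉ Set.range ι → u k = s k) (by
      rintro q v u ⟨h₁, h₂⟩
      simp only [step, lift, id]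
      have key : ∀ (k : K₁) (l : List (Γ (ι k))), (∀ k', update u (ι k) l (ι k') =
          update v k l k') ∧ ∀ k', k' ∉ Set.range ι → update u (ι k) l k' = s k' := by
        intro k l
        refine ⟨fun k' => ?_, fun k' hk' => ?_⟩
        · by_cases e : k' = k
          · subst e; simp
          · rw [update_of_ne e, update_of_ne (hι.ne e), h₁]
        · rw [update_of_ne (by rintro rfl; exact hk' ⟨k, rfl⟩), h₂ _ hk']
      cases F.prog q with
      | jump z => exact ⟨u, rfl, h₁, h₂⟩
      | push k a z =>
        refine ⟨_, rfl, ?_⟩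
        simp only [Instr.exec]
        rw [h₁]
        exact key _ _
      | peek k f => exact ⟨u, by simp only [Instr.lift, Instr.exec, h₁], h₁, h₂⟩
      | pop k f =>
        refine ⟨_, by simp only [Instr.lift, Instr.exec, h₁]; rfl, ?_⟩
        exact key _ _) h (u := s) ⟨hs, fun _ _ => rfl⟩
  have : u = s' := by
    funext k
    by_cases hk : k ∈ Set.range ι
    · obtain ⟨k, rfl⟩ := hk
      rw [hu, hs']
    · rw [hu' _ hk, hs'' _ hk]
  subst this
  exact hh 0 y u (runsFrom_exit _ _ _)

end Frag

end Frag

/-! ### Flow charts and `TM2` machines -/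

/-- The store with `l` on stack `k` and all other stacks empty. -/
def Store.single {K : Type} [DecidableEq K] {Γ : K → Type} (k : K) (l : List (Γ k)) : Store Γ :=
  update (fun _ => []) k l

/-- Polynomial-time computability of `a ↦ g a`, with input `ea a`, by a flow chart. -/
def FragPoly {α αΓ βΓ : Type} (ea : α → List αΓ) (g : α → List βΓ) : Prop :=
  ∃ (K : Type) (_ : DecidableEq K) (_ : Finite K) (Γ : K → Type) (_ : ∀ k, Finite (Γ k))
    (k₀ k₁ : K) (e₀ : Γ k₀ ≃ αΓ) (e₁ : Γ k₁ ≃ βΓ) (F : Frag Γ Unit Unit) (p : Polynomial ℕ),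
    ∀ a, F.Runs () (.single k₀ ((ea a).map e₀.symm)) () (.single k₁ ((g a).map e₁.symm))
      (p.eval (ea a).length)

section OfTM2

open Turing Turing.TM2

theorem initList_stk (tm : FinTM2) (l : List (tm.Γ tm.k₀)) :
    (initList tm l).stk = Store.single tm.k₀ l := by
  funext k
  by_cases h : k = tm.k₀
  · subst h; simp [initList, Store.single]
  · simp [initList, Store.single, h]

theorem haltList_stk (tm : FinTM2) (l : List (tm.Γ tm.k₁)) :
    (haltList tm l).stk = Store.single tm.k₁ l := by
  funext k
  by_cases h : k = tm.k₁
  · subst h; simp [haltList, Store.single]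
  · simp [haltList, Store.single, h]

variable (tm : FinTM2)

/-- The statements that occur in the program of `tm`. -/
abbrev SubStmt : Type :=
  {q : Stmt tm.Γ tm.Λ tm.σ // some q ∈ stmts tm.m (@Finset.univ _ tm.ΛFin)}

instance : Finite (SubStmt tm) :=
  Finite.of_injective
    (fun q : SubStmt tm => (⟨some q.1, q.2⟩ : {x // x ∈ stmts tm.m (@Finset.univ _ tm.ΛFin)}))
    fun q q' h => by simpa [Subtype.ext_iff] using h

theorem main_mem_stmts (l : tm.Λ) : some (tm.m l) ∈ stmts tm.m (@Finset.univ _ tm.ΛFin) := by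
  have := tm.ΛFin
  simp only [stmts, Finset.mem_insertNone, Finset.mem_biUnion, Option.mem_def, Option.some.injEq,
    forall_eq']
  exact ⟨l, @Finset.mem_univ _ tm.ΛFin l, stmts₁_self⟩

/-- The next instruction when the statement `q` is being executed. -/
def stmtInstr : (q : SubStmt tm) → tm.σ → Instr tm.Γ ((SubStmt tm × tm.σ) ⊕ Unit)
  | ⟨.push k f q, h⟩, v =>
    .push k (f v) (.inl (⟨q, stmts_trans (by simp [stmts₁, stmts₁_self]) h⟩, v))
  | ⟨.peek k f q, h⟩, v =>
    .peek k fun o => .inl (⟨q, stmts_trans (by simp [stmts₁, stmts₁_self]) h⟩, f v o)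
  | ⟨.pop k f q, h⟩, v =>
    .pop k fun o => .inl (⟨q, stmts_trans (by simp [stmts₁, stmts₁_self]) h⟩, f v o)
  | ⟨.load f q, h⟩, v =>
    .jump (.inl (⟨q, stmts_trans (by simp [stmts₁, stmts₁_self]) h⟩, f v))
  | ⟨.branch f q₁ q₂, h⟩, v =>
    .jump (bif f v then .inl (⟨q₁, stmts_trans (by simp [stmts₁, stmts₁_self]) h⟩, v)
      else .inl (⟨q₂, stmts_trans (by simp [stmts₁, stmts₁_self]) h⟩, v))
  | ⟨.goto f, _⟩, v => .jump (.inl (⟨tm.m (f v), main_mem_stmts tm _⟩, v))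
  | ⟨.halt, _⟩, _ => .jump (.inr ())

/-- The flow chart of a `TM2` machine. -/
def fragOfTM2 : Frag tm.Γ Unit Unit where
  Q := SubStmt tm × tm.σ
  fin := by have := tm.σFin; infer_instance
  prog q := stmtInstr tm q.1 q.2
  entry _ := .inl (⟨tm.m tm.main, main_mem_stmts tm _⟩, tm.initialState)

/-- The number of instructions in a statement. -/
def stmtSize {K : Type} {Γ : K → Type} {Λ σ : Type} : Stmt Γ Λ σ → ℕ
  | .push _ _ q => stmtSize q + 1
  | .peek _ _ q => stmtSize q + 1
  | .pop _ _ q => stmtSize q + 1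
  | .load _ q => stmtSize q + 1
  | .branch _ q₁ q₂ => stmtSize q₁ + stmtSize q₂ + 1
  | .goto _ => 1
  | .halt => 1

/-- The point of the flow chart that belongs to a label. -/
def labelPoint (l : Option tm.Λ) (v : tm.σ) : (fragOfTM2 tm).Q ⊕ Unit :=
  match l with
  | some l => .inl (⟨tm.m l, main_mem_stmts tm l⟩, v)
  | none => .inr ()

/-- One step of a `TM2` machine executes a whole statement, while the flow chart needs a step for
each instruction. The size of the statement bounds their number; for a branch both sides are
counted, which is crude but enough. -/
theorem runsFrom_stmt {q : Stmt tm.Γ tm.Λ tm.σ}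
    (hq : some q ∈ stmts tm.m (@Finset.univ _ tm.ΛFin)) (v : tm.σ) (s s' : Store tm.Γ) (t : ℕ)
    (h : (fragOfTM2 tm).RunsFrom (labelPoint tm (stepAux q v s).l (stepAux q v s).var)
      (stepAux q v s).stk () s' t) :
    (fragOfTM2 tm).RunsFrom (.inl (⟨q, hq⟩, v)) s () s' (t + stmtSize q) := by
  induction q generalizing v s with
  | push k f q ih => exact Frag.runsFrom_succ (t := t + stmtSize q) (ih _ _ _ h)
  | peek k f q ih => exact Frag.runsFrom_succ (t := t + stmtSize q) (ih _ _ _ h)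
  | pop k f q ih => exact Frag.runsFrom_succ (t := t + stmtSize q) (ih _ _ _ h)
  | load f q ih => exact Frag.runsFrom_succ (t := t + stmtSize q) (ih _ _ _ h)
  | branch f q₁ q₂ ih₁ ih₂ =>
    refine Frag.runsFrom_succ (t := t + (stmtSize q₁ + stmtSize q₂)) ?_
    simp only [fragOfTM2, stmtInstr, Instr.exec]
    cases e : f v with
    | true =>
      simp only [stepAux, e, cond_true] at h
      exact (ih₁ (stmts_trans (by simp [stmts₁, stmts₁_self]) hq) _ _ h).mono (by omega)
    | false =>
      simp only [stepAux, e, cond_false] at h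
      exact (ih₂ (stmts_trans (by simp [stmts₁, stmts₁_self]) hq) _ _ h).mono (by omega)
  | goto f => exact Frag.runsFrom_succ (t := t) h
  | halt => exact Frag.runsFrom_succ (t := t) h

theorem iterate_bind_none {σ : Type*} (f : σ → Option σ) (n : ℕ) :
    (flip Option.bind f)^[n] none = none :=
  iterate_fixed rfl n

theorem runsFrom_of_evals {C : ℕ} (hC : ∀ l, stmtSize (tm.m l) ≤ C) (n : ℕ)
    (c c' : Cfg tm.Γ tm.Λ tm.σ) (hc' : c'.l = none)
    (h : (flip Option.bind (TM2.step tm.m))^[n] (some c) = some c') :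
    (fragOfTM2 tm).RunsFrom (labelPoint tm c.l c.var) c.stk () c'.stk (n * C) := by
  induction n generalizing c with
  | zero =>
    cases h
    rw [hc']
    exact Frag.RunsFrom.mono (Frag.runsFrom_exit _ _ _) (by omega)
  | succ n ih =>
    rw [iterate_succ_apply] at h
    obtain ⟨l, v, s⟩ := c
    cases l with
    | none =>
      change (flip Option.bind (TM2.step tm.m))^[n] none = _ at h
      rw [iterate_bind_none] at h
      cases h
    | some l =>
      refine (runsFrom_stmt tm (main_mem_stmts tm l) v s c'.stk (n * C) (ih _ h)).mono ?_
      have := hC l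
      rw [Nat.succ_mul]; omega

end OfTM2

section ToTM2

open Turing Turing.TM2

variable {K : Type} [DecidableEq K] {Γ : K → Type}

/-- The `TM2` statement that executes an instruction. -/
def Instr.toStmt {Z : Type} : Instr Γ Z → Stmt Γ Z Z
  | .jump z => .goto fun _ => z
  | .push k a z => .push k (fun _ => a) (.goto fun _ => z)
  | .peek k f => .peek k (fun _ o => f o) (.goto id)
  | .pop k f => .pop k (fun _ o => f o) (.goto id)

/-- The internal memory is used only to carry the continuation chosen by a `peek` or `pop` to the
subsequent `goto`, so its value afterwards does not matter. -/
theorem Instr.stepAux_toStmt {Z : Type} (i : Instr Γ Z) (v : Z) (s : Store Γ) :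
    ∃ v', stepAux i.toStmt v s = ⟨some (i.exec s).1, v', (i.exec s).2⟩ := by
  cases i <;> exact ⟨_, rfl⟩

/-- The program of the `TM2` machine of a flow chart. -/
def Frag.toStmt (F : Frag Γ Unit Unit) : F.Q ⊕ Unit → Stmt Γ (F.Q ⊕ Unit) (F.Q ⊕ Unit)
  | .inl q => (F.prog q).toStmt
  | .inr _ => .load (fun _ => F.entry ()) .halt

/-- The additional step is the one that halts. There the memory is reset to `F.entry ()`, because an
output configuration of a `TM2` machine must have the initial internal state. -/
theorem Frag.RunsFrom.evals {F : Frag Γ Unit Unit} {z : F.Q ⊕ Unit} {s s' : Store Γ} {t : ℕ}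
    (h : F.RunsFrom z s () s' t) (v : F.Q ⊕ Unit) :
    ∃ n ≤ t + 1, (flip Option.bind (TM2.step F.toStmt))^[n] (some ⟨some z, v, s⟩) =
      some ⟨none, F.entry (), s'⟩ := by
  induction t generalizing z s v with
  | zero =>
    cases h
    exact ⟨1, le_rfl, rfl⟩
  | succ t ih =>
    cases z with
    | inr u =>
      have h' : F.step^[t + 1] (.inr u, s) = (.inr (), s') := h
      rw [Frag.iterate_step_exit] at h'
      cases h'
      exact ⟨1, by omega, rfl⟩
    | inl q =>
      obtain ⟨v', hv'⟩ := Instr.stepAux_toStmt (F.prog q) v s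
      obtain ⟨n, hn, hh⟩ := ih (z := ((F.prog q).exec s).1) (s := ((F.prog q).exec s).2) h v'
      refine ⟨n + 1, by omega, ?_⟩
      rw [iterate_succ_apply, ← hh]
      congr 1
      change some (stepAux (F.prog q).toStmt v s) = _
      rw [hv']

end ToTM2

theorem PolyTime.fragPoly {α β αΓ βΓ : Type} {ea : α → List αΓ} {eb : β → List βΓ} {f : α → β}
    (h : PolyTime ea eb f) : FragPoly ea (fun a => eb (f a)) := by
  obtain ⟨h, hfin⟩ := h
  have := h.tm.ΛFin
  have := h.tm.kFin
  obtain ⟨C, hC⟩ := (Set.finite_range fun l => stmtSize (h.tm.m l)).bddAbove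
  refine ⟨h.tm.K, inferInstance, inferInstance, h.tm.Γ, hfin, h.tm.k₀, h.tm.k₁, h.inputAlphabet,
    h.outputAlphabet, fragOfTM2 h.tm, h.time * .C C, fun a => ?_⟩
  obtain ⟨⟨n, hn⟩, hle⟩ := h.outputsFun a
  have := runsFrom_of_evals h.tm (C := C) (fun l => hC ⟨l, rfl⟩) n _ _ rfl hn
  rw [initList_stk, haltList_stk] at this
  refine Frag.RunsFrom.mono this ?_
  simp only [Polynomial.eval_mul, Polynomial.eval_C]
  exact Nat.mul_le_mul_right _ hle

theorem FragPoly.polyTime {α β αΓ βΓ : Type} {ea : α → List αΓ} {eb : β → List βΓ} {f : α → β}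
    (h : FragPoly ea fun a => eb (f a)) : PolyTime ea eb f := by
  obtain ⟨K, _, _, Γ, hΓ, k₀, k₁, e₀, e₁, F, p, h⟩ := h
  have := F.fin
  have := Fintype.ofFinite K
  have := Fintype.ofFinite F.Q
  have := Fintype.ofFinite (Γ k₀)
  let tm : Turing.FinTM2 :=
    { K := K, k₀ := k₀, k₁ := k₁, Γ := Γ, Λ := F.Q ⊕ Unit, main := F.entry (),
      σ := F.Q ⊕ Unit, initialState := F.entry (), m := F.toStmt }
  have key : ∀ a, Nonempty (Turing.TM2OutputsInTime tm ((ea a).map e₀.symm)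
      (some ((eb (f a)).map e₁.symm)) ((p + 1).eval (ea a).length)) := by
    intro a
    obtain ⟨n, hn, hh⟩ := Frag.RunsFrom.evals (h a) (F.entry ())
    refine ⟨⟨⟨n, ?_⟩, by simpa using hn⟩⟩
    have h₁ : (⟨some (F.entry ()), F.entry (), Store.single k₀ ((ea a).map e₀.symm)⟩ : tm.Cfg) =
        Turing.initList tm ((ea a).map e₀.symm) := by
      rw [← initList_stk tm]; rfl
    have h₂ : (⟨none, F.entry (), Store.single k₁ ((eb (f a)).map e₁.symm)⟩ : tm.Cfg) =
        Turing.haltList tm ((eb (f a)).map e₁.symm) := by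
      rw [← haltList_stk tm]; rfl
    rw [← h₁, Option.map_some, ← h₂]
    exact hh
  exact ⟨{ tm := tm, inputAlphabet := e₀, outputAlphabet := e₁, time := p + 1,
           outputsFun := fun a => (key a).some }, hΓ⟩

theorem polyTime_iff_fragPoly {α β αΓ βΓ : Type} {ea : α → List αΓ} {eb : β → List βΓ}
    {f : α → β} : PolyTime ea eb f ↔ FragPoly ea fun a => eb (f a) :=
  ⟨PolyTime.fragPoly, FragPoly.polyTime⟩

/-! ### Composition and concatenation of polynomial-time functions -/

theorem eval_mono_nat (p : Polynomial ℕ) {a b : ℕ} (h : a ≤ b) : p.eval a ≤ p.eval b := by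
  rw [Polynomial.eval_eq_sum_range, Polynomial.eval_eq_sum_range]
  gcongr

theorem fragPoly_of {α K : Type} [DecidableEq K] [Finite K] {Γ : K → Type} [∀ k, Finite (Γ k)]
    {k₀ k₁ : K} {ea : α → List (Γ k₀)} {g : α → List (Γ k₁)} (F : Frag Γ Unit Unit)
    (p : Polynomial ℕ)
    (h : ∀ a, F.Runs () (.single k₀ (ea a)) () (.single k₁ (g a)) (p.eval (ea a).length)) :
    FragPoly ea g :=
  ⟨K, inferInstance, inferInstance, Γ, inferInstance, k₀, k₁, .refl _, .refl _, F, p,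
    fun a => by simpa using h a⟩

section Moves

variable {K : Type} [DecidableEq K] {Γ : K → Type}

theorem Store.single_nil (k : K) : (Store.single k [] : Store Γ) = fun _ => [] :=
  update_eq_self _ _

theorem Store.update_single (k : K) (l l' : List (Γ k)) :
    update (Store.single k l) k l' = Store.single k l' :=
  update_idem _ _ _

theorem Store.single_self (k : K) (l : List (Γ k)) : (Store.single k l : Store Γ) k = l :=
  update_self _ _ _

theorem Store.single_of_ne {k k' : K} (h : k' ≠ k) (l : List (Γ k)) :
    (Store.single k l : Store Γ) k' = [] :=
  update_of_ne h _ _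

namespace Frag

/-- Move the content of stack `k` to stack `k'`. -/
def move {k k' : K} (e : Γ k → Γ k') [Finite (Γ k)] : Frag Γ Unit Unit :=
  forEach k ((pushOpt k' fun p => some (e p.2)).seq (ret fun _ => ()))

theorem move_runs {k k' : K} (hk : k ≠ k') (e : Γ k → Γ k') [Finite (Γ k)] (s : Store Γ) :
    (move e).Runs () s () (update (update s k []) k' ((s k).reverse.map e ++ s k'))
      (2 * (s k).length + 1) := by
  generalize hl : s k = l
  induction l generalizing s with
  | nil =>
    have : update (update s k []) k' (([] : List (Γ k)).reverse.map e ++ s k') = s := by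
      simp only [List.reverse_nil, List.map_nil, List.nil_append]
      rw [update_eq_iff.2 ⟨(update_of_ne hk.symm _ _).symm, fun _ _ => rfl⟩, ← hl, update_eq_self]
    rw [this]
    exact (forEach_nil _ _ hl).mono (by omega)
  | cons a l ih =>
    have h₁ : update (update s k l) k' (e a :: s k') k = l := by
      rw [update_of_ne hk, update_self]
    have h₂ := forEach_cons hl (seq_runs (pushOpt_runs k' (fun p : Unit × Γ k => some (e p.2))
      ((), a) (update s k l)) (ret_runs (fun _ => ()) _ _)) (x' := ())
      (by rw [update_of_ne hk.symm]; exact ih _ h₁)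
    refine Eq.mp ?_ (h₂.mono (t' := 2 * (a :: l).length + 1) (by simp; omega))
    unfold move
    congr 1
    rw [update_comm hk.symm, update_idem, update_idem]
    simp

theorem move_runs_of {k k' : K} (hk : k ≠ k') (e : Γ k → Γ k') [Finite (Γ k)] {s s' : Store Γ}
    {l : List (Γ k)} (hl : s k = l)
    (hs' : update (update s k []) k' (l.reverse.map e ++ s k') = s') :
    (move e).Runs () s () s' (2 * l.length + 1) := by
  subst hl hs'
  exact move_runs hk e s

theorem move_runs_single {k k' : K} (hk : k ≠ k') (e : Γ k → Γ k') [Finite (Γ k)]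
    {l : List (Γ k)} {l' : List (Γ k')} (hl : l.reverse.map e = l') {n : ℕ} (hn : l.length = n) :
    (move e).Runs () (.single k l) () (.single k' l') (2 * n + 1) := by
  subst hl hn
  refine move_runs_of hk e (Store.single_self _ _) ?_
  rw [Store.update_single, Store.single_nil, Store.single_of_ne hk.symm, List.append_nil]
  rfl

theorem lift_runs_single {X Y : Type} {K₁ : Type} [DecidableEq K₁] {ι : K₁ → K}
    (hι : Injective ι) {F : Frag (fun k => Γ (ι k)) X Y} {x : X} {y : Y} {k k' : K₁}
    {l : List (Γ (ι k))} {l' : List (Γ (ι k'))} {t : ℕ}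
    (h : F.Runs x (Store.single (Γ := fun k => Γ (ι k)) k l) y (Store.single k' l') t) :
    (F.lift ι).Runs x (.single (ι k) l) y (.single (ι k') l') t := by
  have key : ∀ (k : K₁) (l : List (Γ (ι k))) (j : K₁), (Store.single (ι k) l : Store Γ) (ι j) =
      Store.single (Γ := fun k => Γ (ι k)) k l j := by
    intro k l j
    by_cases h : j = k
    · subst h; rw [Store.single_self, Store.single_self]
    · rw [Store.single_of_ne h, Store.single_of_ne (hι.ne h)]
  refine lift_runs hι h (key k l) (key k' l') fun j hj => ?_
  rw [Store.single_of_ne (by rintro rfl; exact hj ⟨_, rfl⟩),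
    Store.single_of_ne (by rintro rfl; exact hj ⟨_, rfl⟩)]

end Frag

end Moves

/-- The two charts work on disjoint sets of stacks. The intermediate result is moved through an
auxiliary stack, since one move reverses a word and two restore it. -/
theorem FragPoly.comp {α β αΓ βΓ γΓ : Type} {ea : α → List αΓ} {eb : β → List βΓ}
    {f : α → β} {g : β → List γΓ} (hf : FragPoly ea fun a => eb (f a)) (hg : FragPoly eb g) :
    FragPoly ea fun a => g (f a) := by
  obtain ⟨K₁, _, _, Γ₁, _, k₁, l₁, d₁, e₁, F₁, p₁, h₁⟩ := hf
  obtain ⟨K₂, _, _, Γ₂, _, k₂, l₂, d₂, e₂, F₂, p₂, h₂⟩ := hg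
  have hβ : Finite βΓ := Finite.of_equiv _ e₁
  let Γ : K₁ ⊕ K₂ ⊕ Unit → Type := Sum.elim Γ₁ (Sum.elim Γ₂ fun _ => βΓ)
  have : ∀ k, Finite (Γ k) := by
    rintro (k | k | k)
    · exact inferInstanceAs (Finite (Γ₁ k))
    · exact inferInstanceAs (Finite (Γ₂ k))
    · exact hβ
  let G₁ : Frag Γ Unit Unit := Frag.lift (Γ := Γ) Sum.inl F₁
  let G₂ : Frag Γ Unit Unit := Frag.lift (Γ := Γ) (fun k => .inr (.inl k)) F₂
  let m₁ : Frag Γ Unit Unit := Frag.move (Γ := Γ) (k := .inl l₁) (k' := .inr (.inr ())) e₁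
  let m₂ : Frag Γ Unit Unit :=
    Frag.move (Γ := Γ) (k := .inr (.inr ())) (k' := .inr (.inl k₂)) d₂.symm
  refine ⟨K₁ ⊕ K₂ ⊕ Unit, inferInstance, inferInstance, Γ, this, .inl k₁, .inr (.inl l₂), d₁, e₂,
    G₁.seq (m₁.seq (m₂.seq G₂)), p₁ + (4 * (.X + p₁) + 2 + p₂.comp (.X + p₁)), fun a => ?_⟩
  have r₁ : G₁.Runs () (.single (.inl k₁) ((ea a).map d₁.symm)) ()
      (.single (.inl l₁) ((eb (f a)).map e₁.symm)) (p₁.eval (ea a).length) :=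
    Frag.lift_runs_single (Γ := Γ) Sum.inl_injective (h₁ a)
  have r₂ : m₁.Runs () (.single (.inl l₁) ((eb (f a)).map e₁.symm)) ()
      (.single (.inr (.inr ())) (eb (f a)).reverse) (2 * (eb (f a)).length + 1) :=
    Frag.move_runs_single (Γ := Γ) (k := .inl l₁) (k' := .inr (.inr ())) (by simp) e₁
      (show ((eb (f a)).map e₁.symm).reverse.map e₁ = _ by
        rw [← List.map_reverse, List.map_map, Equiv.self_comp_symm, List.map_id])
      (List.length_map e₁.symm)
  have r₃ : m₂.Runs () (.single (.inr (.inr ())) (eb (f a)).reverse) ()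
      (.single (.inr (.inl k₂)) ((eb (f a)).map d₂.symm)) (2 * (eb (f a)).length + 1) :=
    Frag.move_runs_single (Γ := Γ) (k := .inr (.inr ())) (k' := .inr (.inl k₂)) (by simp) d₂.symm
      (show (eb (f a)).reverse.reverse.map d₂.symm = _ by
        rw [List.reverse_reverse]; rfl)
      List.length_reverse
  have r₄ : G₂.Runs () (.single (.inr (.inl k₂)) ((eb (f a)).map d₂.symm)) ()
      (.single (.inr (.inl l₂)) ((g (f a)).map e₂.symm)) (p₂.eval (eb (f a)).length) :=
    Frag.lift_runs_single (Γ := Γ) (Sum.inr_injective.comp Sum.inl_injective) (h₂ (f a))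
  refine (Frag.seq_runs r₁ (Frag.seq_runs r₂ (Frag.seq_runs r₃ r₄))).mono ?_
  -- The running time of the second chart is measured in the length of the intermediate word, which
  -- the time of the first chart bounds.
  have hlen : (eb (f a)).length ≤ (ea a).length + p₁.eval (ea a).length := by
    have := (h₁ a).length_le l₁
    rw [Store.single_self, List.length_map] at this
    refine this.trans (Nat.add_le_add_right ?_ _)
    by_cases h : l₁ = k₁
    · subst h; rw [Store.single_self, List.length_map]
    · rw [Store.single_of_ne h]; simp
  have := eval_mono_nat p₂ hlen
  simp only [Polynomial.eval_add, Polynomial.eval_mul, Polynomial.eval_X, Polynomial.eval_comp,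
    Polynomial.eval_ofNat]
  omega

section Append

variable {K₁ K₂ : Type} [DecidableEq K₁] [DecidableEq K₂] (Γ₁ : K₁ → Type) (Γ₂ : K₂ → Type)
  (α β : Type)

/-- The stack alphabets of the concatenation machine. -/
def AppendΓ : K₁ ⊕ K₂ ⊕ Bool ⊕ Bool → Type :=
  Sum.elim Γ₁ (Sum.elim Γ₂ (Sum.elim (fun _ => α) fun _ => β))

instance [h₁ : ∀ k, Finite (Γ₁ k)] [h₂ : ∀ k, Finite (Γ₂ k)] [h₃ : Finite α] [h₄ : Finite β] :
    ∀ k, Finite (AppendΓ Γ₁ Γ₂ α β k)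
  | .inl k => h₁ k
  | .inr (.inl k) => h₂ k
  | .inr (.inr (.inl _)) => h₃
  | .inr (.inr (.inr _)) => h₄

variable {Γ₁ Γ₂ α β}

/-- The stores of the concatenation machine. -/
def appendStore (s₁ : Store Γ₁) (s₂ : Store Γ₂) (a b : List α) (c d : List β) :
    Store (AppendΓ Γ₁ Γ₂ α β)
  | .inl k => s₁ k
  | .inr (.inl k) => s₂ k
  | .inr (.inr (.inl x)) => bif x then b else a
  | .inr (.inr (.inr x)) => bif x then d else c

variable (s₁ : Store Γ₁) (s₂ : Store Γ₂) (a b : List α) (c d : List β)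

theorem update_appendStore_left (k : K₁) (l : List (Γ₁ k)) :
    update (appendStore s₁ s₂ a b c d) (.inl k) l =
      appendStore (update s₁ k l) s₂ a b c d := by
  funext j
  rcases j with j | j | j | j
  · by_cases h : j = k
    · subst h; exact (update_self _ _ _).trans (update_self _ _ s₁).symm
    · exact (update_of_ne (by simpa using h) _ _).trans (update_of_ne h _ s₁).symm
  all_goals exact update_of_ne (by simp) _ _

theorem update_appendStore_right (k : K₂) (l : List (Γ₂ k)) :
    update (appendStore s₁ s₂ a b c d) (.inr (.inl k)) l =
      appendStore s₁ (update s₂ k l) a b c d := by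
  funext j
  rcases j with j | j | j | j
  · exact update_of_ne (by simp) _ _
  · by_cases h : j = k
    · subst h; exact (update_self _ _ _).trans (update_self _ _ s₂).symm
    · exact (update_of_ne (by simpa using h) _ _).trans (update_of_ne h _ s₂).symm
  all_goals exact update_of_ne (by simp) _ _

theorem update_appendStore_in (x : Bool) (l : List α) :
    update (appendStore s₁ s₂ a b c d) (.inr (.inr (.inl x))) l =
      appendStore s₁ s₂ (bif x then a else l) (bif x then l else b) c d := by
  funext j
  rcases j with j | j | j | j
  · exact update_of_ne (by simp) _ _
  · exact update_of_ne (by simp) _ _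
  · cases x <;> cases j <;>
      first | exact update_self _ _ _ | exact update_of_ne (by simp) _ _
  · exact update_of_ne (by simp) _ _

theorem update_appendStore_out (x : Bool) (l : List β) :
    update (appendStore s₁ s₂ a b c d) (.inr (.inr (.inr x))) l =
      appendStore s₁ s₂ a b (bif x then c else l) (bif x then l else d) := by
  funext j
  rcases j with j | j | j | j
  · exact update_of_ne (by simp) _ _
  · exact update_of_ne (by simp) _ _
  · exact update_of_ne (by simp) _ _
  · cases x <;> cases j <;>
      first | exact update_self _ _ _ | exact update_of_ne (by simp) _ _

theorem appendStore_in (a : List α) :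
    appendStore (Γ₁ := Γ₁) (Γ₂ := Γ₂) (β := β) (fun _ => []) (fun _ => []) a [] [] [] =
      Store.single (.inr (.inr (.inl false))) a := by
  refine (update_appendStore_in (Γ₁ := Γ₁) (Γ₂ := Γ₂) (α := α) (β := β) (fun _ => [])
      (fun _ => []) [] [] [] [] false a).symm.trans ?_
  unfold Store.single
  congr 1
  funext j
  rcases j with j | j | (_ | _) | (_ | _) <;> rfl

theorem appendStore_out (d : List β) :
    appendStore (Γ₁ := Γ₁) (Γ₂ := Γ₂) (α := α) (fun _ => []) (fun _ => []) [] [] [] d =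
      Store.single (.inr (.inr (.inr true))) d := by
  refine (update_appendStore_out (Γ₁ := Γ₁) (Γ₂ := Γ₂) (α := α) (β := β) (fun _ => [])
      (fun _ => []) [] [] [] [] true d).symm.trans ?_
  unfold Store.single
  congr 1
  funext j
  rcases j with j | j | (_ | _) | (_ | _) <;> rfl

namespace Frag

variable [∀ k, Finite (Γ₁ k)] [∀ k, Finite (Γ₂ k)] [Finite α] [Finite β]

theorem move_in_runs :
    (move (Γ := AppendΓ Γ₁ Γ₂ α β) (k := .inr (.inr (.inl false)))
      (k' := .inr (.inr (.inl true))) id).Runs () (appendStore s₁ s₂ a b c d) ()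
      (appendStore s₁ s₂ [] (a.reverse ++ b) c d) (2 * a.length + 1) := by
  refine move_runs_of (Γ := AppendΓ Γ₁ Γ₂ α β) (k := .inr (.inr (.inl false)))
    (k' := .inr (.inr (.inl true))) (by simp) id (l := a) rfl ?_
  refine (congrArg (update · _ _) (update_appendStore_in ..)).trans
    ((update_appendStore_in ..).trans ?_)
  change appendStore s₁ s₂ [] (a.reverse.map id ++ b) c d = _
  rw [List.map_id]

theorem move_out_runs :
    (move (Γ := AppendΓ Γ₁ Γ₂ α β) (k := .inr (.inr (.inr false)))
      (k' := .inr (.inr (.inr true))) id).Runs () (appendStore s₁ s₂ a b c d) ()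
      (appendStore s₁ s₂ a b [] (c.reverse ++ d)) (2 * c.length + 1) := by
  refine move_runs_of (Γ := AppendΓ Γ₁ Γ₂ α β) (k := .inr (.inr (.inr false)))
    (k' := .inr (.inr (.inr true))) (by simp) id (l := c) rfl ?_
  refine (congrArg (update · _ _) (update_appendStore_out ..)).trans
    ((update_appendStore_out ..).trans ?_)
  change appendStore s₁ s₂ a b [] (c.reverse.map id ++ d) = _
  rw [List.map_id]

theorem move_left_runs (k : K₁) (e : Γ₁ k → β) :
    (move (Γ := AppendΓ Γ₁ Γ₂ α β) (k := .inl k)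
      (k' := .inr (.inr (.inr false))) e).Runs () (appendStore s₁ s₂ a b c d) ()
      (appendStore (update s₁ k []) s₂ a b ((s₁ k).reverse.map e ++ c) d)
      (2 * (s₁ k).length + 1) := by
  refine move_runs_of (Γ := AppendΓ Γ₁ Γ₂ α β) (k := .inl k)
    (k' := .inr (.inr (.inr false))) (by simp) e (l := s₁ k) rfl ?_
  exact (congrArg (update · _ _) (update_appendStore_left ..)).trans (update_appendStore_out ..)

theorem move_right_runs (k : K₂) (e : Γ₂ k → β) :
    (move (Γ := AppendΓ Γ₁ Γ₂ α β) (k := .inr (.inl k))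
      (k' := .inr (.inr (.inr false))) e).Runs () (appendStore s₁ s₂ a b c d) ()
      (appendStore s₁ (update s₂ k []) a b ((s₂ k).reverse.map e ++ c) d)
      (2 * (s₂ k).length + 1) := by
  refine move_runs_of (Γ := AppendΓ Γ₁ Γ₂ α β) (k := .inr (.inl k))
    (k' := .inr (.inr (.inr false))) (by simp) e (l := s₂ k) rfl ?_
  exact (congrArg (update · _ _) (update_appendStore_right ..)).trans (update_appendStore_out ..)

/-- Move the content of stack `k` to two other stacks. -/
def moveTwo {K : Type} [DecidableEq K] {Γ : K → Type} {k k' k'' : K} (e : Γ k → Γ k')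
    (e' : Γ k → Γ k'') [Finite (Γ k)] : Frag Γ Unit Unit :=
  forEach k ((pushOpt k' fun p => some (e p.2)).seq
    ((pushOpt k'' fun p => some (e' p.2)).seq (ret fun _ => ())))

theorem moveTwo_runs (k₁ : K₁) (k₂ : K₂) (e : α → Γ₁ k₁) (e' : α → Γ₂ k₂) :
    (moveTwo (Γ := AppendΓ Γ₁ Γ₂ α β) (k := .inr (.inr (.inl true))) (k' := .inl k₁)
      (k'' := .inr (.inl k₂)) e e').Runs () (appendStore s₁ s₂ a b c d) ()
      (appendStore (update s₁ k₁ (b.reverse.map e ++ s₁ k₁))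
        (update s₂ k₂ (b.reverse.map e' ++ s₂ k₂)) a [] c d)
      (3 * b.length + 1) := by
  induction b generalizing s₁ s₂ with
  | nil =>
    simp only [List.reverse_nil, List.map_nil, List.nil_append, update_eq_self]
    exact (forEach_nil _ _ rfl).mono (by omega)
  | cons x b ih =>
    have h := ih (update s₁ k₁ (e x :: s₁ k₁)) (update s₂ k₂ (e' x :: s₂ k₂))
    refine (forEach_cons (K := K₁ ⊕ K₂ ⊕ Bool ⊕ Bool)
      (Γ := AppendΓ Γ₁ Γ₂ α β) (k := .inr (.inr (.inl true))) (l := (b : List α)) (x' := ())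
      (a := (x : AppendΓ Γ₁ Γ₂ α β (.inr (.inr (.inl true)))))
      (s' := appendStore (update s₁ k₁ (e x :: s₁ k₁)) (update s₂ k₂ (e' x :: s₂ k₂)) a b c d)
      (t := 2) (t' := 3 * b.length + 1) rfl ?_ ?_).mono (by simp; omega)
    · have h₁ := pushOpt_runs (Γ := AppendΓ Γ₁ Γ₂ α β) (.inl k₁)
        (fun p : Unit × α => some (e p.2)) ((), x) (appendStore s₁ s₂ a b c d)
      have h₂ := pushOpt_runs (Γ := AppendΓ Γ₁ Γ₂ α β) (.inr (.inl k₂))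
        (fun p : Unit × α => some (e' p.2)) ((), x)
        (appendStore (update s₁ k₁ (e x :: s₁ k₁)) s₂ a b c d)
      erw [update_appendStore_left] at h₁
      erw [update_appendStore_right] at h₂
      erw [update_appendStore_in]
      exact seq_runs h₁ (seq_runs h₂ (ret_runs (fun _ => ()) _ _))
    · simpa [moveTwo] using h

end Frag

end Append

theorem Frag.Runs.length_le_single {K : Type} [DecidableEq K] {Γ : K → Type} {X Y : Type}
    {F : Frag Γ X Y} {x : X} {y : Y} {k k' : K} {l : List (Γ k)} {l' : List (Γ k')} {t : ℕ}
    (h : F.Runs x (.single k l) y (.single k' l') t) : l'.length ≤ l.length + t := by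
  have := h.length_le k'
  rw [Store.single_self] at this
  refine this.trans (Nat.add_le_add_right ?_ _)
  by_cases h : k' = k
  · subst h; rw [Store.single_self]
  · rw [Store.single_of_ne h]; simp

/-- The input is duplicated and both charts are run on their own stacks. The word `g a` is
transferred to the output stack before `f a`, because what is moved last lies on top. -/
theorem FragPoly.append {α αΓ βΓ : Type} {ea : α → List αΓ} {f g : α → List βΓ}
    (hf : FragPoly ea f) (hg : FragPoly ea g) : FragPoly ea fun a => f a ++ g a := by
  obtain ⟨K₁, _, _, Γ₁, _, k₁, l₁, d₁, e₁, F₁, p₁, h₁⟩ := hf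
  obtain ⟨K₂, _, _, Γ₂, _, k₂, l₂, d₂, e₂, F₂, p₂, h₂⟩ := hg
  have hα : Finite αΓ := Finite.of_equiv _ d₁
  have hβ : Finite βΓ := Finite.of_equiv _ e₁
  let Γ := AppendΓ Γ₁ Γ₂ αΓ βΓ
  let m₀ : Frag Γ Unit Unit := Frag.move (Γ := AppendΓ Γ₁ Γ₂ αΓ βΓ)
    (k := .inr (.inr (.inl false))) (k' := .inr (.inr (.inl true))) id
  let m₁ : Frag Γ Unit Unit := Frag.moveTwo (Γ := AppendΓ Γ₁ Γ₂ αΓ βΓ)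
    (k := .inr (.inr (.inl true))) (k' := .inl k₁) (k'' := .inr (.inl k₂)) d₁.symm d₂.symm
  let G₁ : Frag Γ Unit Unit := Frag.lift (Γ := Γ) Sum.inl F₁
  let G₂ : Frag Γ Unit Unit := Frag.lift (Γ := Γ) (fun k => .inr (.inl k)) F₂
  let m₂ : Frag Γ Unit Unit := Frag.move (Γ := AppendΓ Γ₁ Γ₂ αΓ βΓ) (k := .inr (.inl l₂))
    (k' := .inr (.inr (.inr false))) e₂
  let m₃ : Frag Γ Unit Unit := Frag.move (Γ := AppendΓ Γ₁ Γ₂ αΓ βΓ) (k := .inl l₁)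
    (k' := .inr (.inr (.inr false))) e₁
  let m₄ : Frag Γ Unit Unit := Frag.move (Γ := AppendΓ Γ₁ Γ₂ αΓ βΓ)
    (k := .inr (.inr (.inr false))) (k' := .inr (.inr (.inr true))) id
  refine fragPoly_of (Γ := AppendΓ Γ₁ Γ₂ αΓ βΓ) (k₀ := .inr (.inr (.inl false)))
    (k₁ := .inr (.inr (.inr true)))
    (m₀.seq (m₁.seq (G₁.seq (G₂.seq (m₂.seq (m₄.seq (m₃.seq m₄)))))))
    (5 * .X + 6 + 5 * p₁ + 5 * p₂ + 8 * .X) fun a => ?_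
  have r₀ := Frag.move_in_runs (Γ₁ := Γ₁) (Γ₂ := Γ₂) (β := βΓ) (fun _ => []) (fun _ => []) (ea a)
    [] [] []
  rw [List.append_nil] at r₀
  have r₁ := Frag.moveTwo_runs (Γ₁ := Γ₁) (Γ₂ := Γ₂) (β := βΓ) (fun _ => []) (fun _ => []) []
    (ea a).reverse [] [] k₁ k₂ d₁.symm d₂.symm
  rw [List.reverse_reverse, List.append_nil, List.append_nil] at r₁
  have r₂ : G₁.Runs () (appendStore (.single k₁ ((ea a).map d₁.symm))
      (.single k₂ ((ea a).map d₂.symm)) [] [] [] []) ()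
      (appendStore (.single l₁ ((f a).map e₁.symm)) (.single k₂ ((ea a).map d₂.symm)) [] [] [] [])
      (p₁.eval (ea a).length) := by
    refine Frag.lift_runs (Γ := Γ) Sum.inl_injective (h₁ a) (fun _ => rfl) (fun _ => rfl) ?_
    rintro (k | k | k | k) hk
    · exact absurd ⟨k, rfl⟩ hk
    all_goals rfl
  have r₃ : G₂.Runs () (appendStore (.single l₁ ((f a).map e₁.symm))
      (.single k₂ ((ea a).map d₂.symm)) [] [] [] []) ()
      (appendStore (.single l₁ ((f a).map e₁.symm)) (.single l₂ ((g a).map e₂.symm)) [] [] [] [])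
      (p₂.eval (ea a).length) := by
    refine Frag.lift_runs (Γ := Γ) (Sum.inr_injective.comp Sum.inl_injective) (h₂ a)
      (fun _ => rfl) (fun _ => rfl) ?_
    rintro (k | k | k | k) hk
    · rfl
    · exact absurd ⟨k, rfl⟩ hk
    all_goals rfl
  have r₄ := Frag.move_right_runs (α := αΓ) (β := βΓ) (.single l₁ ((f a).map e₁.symm))
    (.single l₂ ((g a).map e₂.symm)) [] [] [] [] l₂ e₂
  rw [Store.update_single, Store.single_nil, Store.single_self, ← List.map_reverse, List.map_map,
    Equiv.self_comp_symm, List.map_id, List.append_nil, List.length_map] at r₄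
  have r₅ := Frag.move_out_runs (Γ₂ := Γ₂) (α := αΓ) (.single l₁ ((f a).map e₁.symm))
    (fun _ => []) [] [] (g a).reverse []
  rw [List.append_nil, List.reverse_reverse, List.length_reverse] at r₅
  have r₆ := Frag.move_left_runs (Γ₂ := Γ₂) (α := αΓ) (.single l₁ ((f a).map e₁.symm))
    (fun _ => []) [] [] [] (g a) l₁ e₁
  rw [Store.update_single, Store.single_nil, Store.single_self, ← List.map_reverse, List.map_map,
    Equiv.self_comp_symm, List.map_id, List.append_nil, List.length_map] at r₆
  have r₇ := Frag.move_out_runs (Γ₁ := Γ₁) (Γ₂ := Γ₂) (α := αΓ) (fun _ => [])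
    (fun _ => []) [] [] (f a).reverse (g a)
  rw [List.reverse_reverse, List.length_reverse] at r₇
  have key := Frag.seq_runs r₀ (Frag.seq_runs r₁ (Frag.seq_runs r₂ (Frag.seq_runs r₃
    (Frag.seq_runs r₄ (Frag.seq_runs r₅ (Frag.seq_runs r₆ r₇))))))
  rw [appendStore_in, appendStore_out] at key
  have l₁' := (h₁ a).length_le_single
  have l₂' := (h₂ a).length_le_single
  simp only [List.length_map] at l₁' l₂'
  refine key.mono ?_
  change _ ≤ (5 * .X + 6 + 5 * p₁ + 5 * p₂ + 8 * .X : Polynomial ℕ).eval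
    (List.length (α := αΓ) (ea a))
  simp only [Polynomial.eval_add, Polynomial.eval_mul, Polynomial.eval_X,
    Polynomial.eval_ofNat, List.length_reverse]
  omega

/-! ### Finite-state transducers -/

namespace Frag

variable {K : Type} [DecidableEq K] {Γ : K → Type} {X : Type} [Finite X]

/-- Push the first `n` symbols of a list that depends on the memory. -/
def pushTake (k : K) (f : X → List (Γ k)) : ℕ → Frag Γ X X
  | 0 => ret id
  | n + 1 => (pushTake k f n).seq (pushOpt k fun x => (f x)[n]?)

theorem pushTake_runs (k : K) (f : X → List (Γ k)) (n : ℕ) (x : X) (s : Store Γ) :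
    (pushTake k f n).Runs x s x (update s k (((f x).take n).reverse ++ s k)) n := by
  induction n with
  | zero =>
    simp only [List.take_zero, List.reverse_nil, List.nil_append, update_eq_self]
    exact ret_runs id x s
  | succ n ih =>
    have := seq_runs ih (pushOpt_runs k (fun x => (f x)[n]?) x _)
    rwa [update_self, update_idem, ← List.append_assoc, show (f x)[n]?.toList ++
      (List.take n (f x)).reverse = (List.take (n + 1) (f x)).reverse by
        rw [List.take_add_one, List.reverse_append]; cases (f x)[n]? <;> simp] at this

end Frag

/-- A finite-state machine that reads a word from left to right and emits a list of symbols for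
each letter and one more list at the end. -/
structure Transducer (α β : Type) where
  S : Type
  fin : Finite S
  init : S
  step : S → α → S × List β
  last : S → List β

namespace Transducer

variable {α β : Type} (T : Transducer α β)

/-- The output from state `s` on. -/
def runFrom : T.S → List α → List β
  | s, [] => T.last s
  | s, a :: l => (T.step s a).2 ++ runFrom (T.step s a).1 l

/-- The function computed by a transducer. -/
def run (l : List α) : List β := T.runFrom T.init l

theorem length_runFrom_le {L : ℕ} (h₁ : ∀ s a, (T.step s a).2.length ≤ L)
    (h₂ : ∀ s, (T.last s).length ≤ L) (s : T.S) (l : List α) :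
    (T.runFrom s l).length ≤ L * (l.length + 1) := by
  induction l generalizing s with
  | nil => simpa [runFrom] using h₂ s
  | cons a l ih =>
    have := ih (T.step s a).1
    have := h₁ s a
    simp only [runFrom, List.length_append, List.length_cons]
    rw [Nat.mul_succ]
    omega

/-- There are finitely many states and letters, so all emitted words have length at most some `L`
and can be pushed by straight-line code. Pushing leaves the output in reverse order, and a final
move repairs this. -/
theorem fragPoly [Finite α] [Finite β] : FragPoly (id : List α → List α) T.run := by
  have := T.fin
  obtain ⟨L, h₁, h₂⟩ : ∃ L, (∀ s a, (T.step s a).2.length ≤ L) ∧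
      ∀ s, (T.last s).length ≤ L := by
    obtain ⟨L₁, h₁⟩ := (Set.finite_range fun p : T.S × α => (T.step p.1 p.2).2.length).bddAbove
    obtain ⟨L₂, h₂⟩ := (Set.finite_range fun s : T.S => (T.last s).length).bddAbove
    exact ⟨max L₁ L₂, fun s a => (h₁ ⟨(s, a), rfl⟩).trans (le_max_left _ _),
      fun s => (h₂ ⟨s, rfl⟩).trans (le_max_right _ _)⟩
  let Γ := AppendΓ (Empty.elim : Empty → Type) (Empty.elim : Empty → Type) α β
  have : ∀ k, Finite ((Empty.elim : Empty → Type) k) := fun k => k.elim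
  let kα : Empty ⊕ Empty ⊕ Bool ⊕ Bool := .inr (.inr (.inl false))
  let kβ : Empty ⊕ Empty ⊕ Bool ⊕ Bool := .inr (.inr (.inr false))
  let S₀ : Store (Empty.elim : Empty → Type) := fun _ => []
  let body : Frag Γ (T.S × Γ kα) T.S :=
    (Frag.pushTake (Γ := Γ) (X := T.S × α) kβ (fun p => (T.step p.1 p.2).2) L).seq
      (.ret fun p => (T.step p.1 p.2).1)
  have hloop : ∀ (l : List α) (s : T.S) (c : List β),
      ((Frag.forEach (Γ := Γ) kα body).seq ((Frag.pushTake (Γ := Γ) kβ T.last L).seq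
        (.ret fun _ => ()))).Runs s (appendStore S₀ S₀ l [] c []) ()
        (appendStore S₀ S₀ [] [] ((T.runFrom s l).reverse ++ c) []) ((L + 1) * (l.length + 1)) := by
    intro l s c
    -- The loop produces the output except for its final word `T.last s'`. As that word is a suffix,
    -- the rest is described by cutting off its length.
    have h₀ : ∃ s', (Frag.forEach (Γ := Γ) kα body).Runs s (appendStore S₀ S₀ l [] c []) s'
        (appendStore S₀ S₀ [] []
          (((T.runFrom s l).take ((T.runFrom s l).length - (T.last s').length)).reverse ++ c) [])
        ((L + 1) * l.length + 1) ∧ T.last s' <:+ T.runFrom s l := by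
      induction l generalizing s c with
      | nil =>
        refine ⟨s, ?_, List.suffix_refl _⟩
        simp only [runFrom, Nat.sub_self, List.take_zero, List.reverse_nil, List.nil_append]
        exact (Frag.forEach_nil (Γ := Γ) (k := kα) body s rfl).mono (by omega)
      | cons a l ih =>
        obtain ⟨s', hs', hsuf⟩ := ih (T.step s a).1 ((T.step s a).2.reverse ++ c)
        refine ⟨s', ?_, hsuf.trans (List.suffix_append _ _)⟩
        have hp := Frag.pushTake_runs (Γ := Γ) (X := T.S × α) kβ
          (fun p => (T.step p.1 p.2).2) L (s, a) (appendStore S₀ S₀ l [] c [])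
        have hp' := Frag.seq_runs hp (Frag.ret_runs (fun p => (T.step p.1 p.2).1) (s, a) _)
        have e : update (appendStore S₀ S₀ l [] c []) kβ
            (((T.step s a).2.take L).reverse ++ c) =
            appendStore S₀ S₀ l [] ((T.step s a).2.reverse ++ c) [] := by
          rw [List.take_of_length_le (h₁ s a)]
          exact update_appendStore_out ..
        have e' : update (appendStore S₀ S₀ (a :: l) [] c []) kα l =
            appendStore S₀ S₀ l [] c [] := update_appendStore_in ..
        have hp'' : body.Runs (s, a) (appendStore S₀ S₀ l [] c []) (T.step s a).1
            (appendStore S₀ S₀ l [] ((T.step s a).2.reverse ++ c) []) (L + 0) := e ▸ hp'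
        have := Frag.forEach_cons (Γ := Γ) (k := kα) (body := body) (l := (l : List α)) (a := a)
          (s := appendStore S₀ S₀ (a :: l) [] c []) rfl (e' ▸ hp'') hs'
        refine Eq.mp ?_ (this.mono (t' := (L + 1) * (a :: l).length + 1) ?_)
        · congr 2
          have hle := hsuf.length_le
          rw [runFrom, List.length_append, Nat.add_sub_assoc hle, List.take_length_add_append,
            List.reverse_append, List.append_assoc]
        · simp only [List.length_cons]; rw [Nat.mul_succ]; omega
    obtain ⟨s', hs', hsuf⟩ := h₀
    have hp := Frag.pushTake_runs (Γ := Γ) (X := T.S) kβ T.last L s'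
      (appendStore S₀ S₀ [] [] (((T.runFrom s l).take ((T.runFrom s l).length -
        (T.last s').length)).reverse ++ c) [])
    have e : update (appendStore S₀ S₀ [] [] (((T.runFrom s l).take ((T.runFrom s l).length -
        (T.last s').length)).reverse ++ c) []) kβ (((T.last s').take L).reverse ++
        (((T.runFrom s l).take ((T.runFrom s l).length - (T.last s').length)).reverse ++ c)) =
        (appendStore S₀ S₀ [] [] ((T.runFrom s l).reverse ++ c) [] : Store Γ) := by
      rw [List.take_of_length_le (h₂ s'), ← List.append_assoc, ← List.reverse_append]
      have : (T.runFrom s l).take ((T.runFrom s l).length - (T.last s').length) ++ T.last s' =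
          T.runFrom s l := by
        obtain ⟨u, hu⟩ := hsuf
        rw [← hu]; simp
      rw [this]
      exact update_appendStore_out ..
    have hp' : (Frag.pushTake (Γ := Γ) kβ T.last L).Runs s' _ s'
      (appendStore S₀ S₀ [] [] ((T.runFrom s l).reverse ++ c) []) L := e ▸ hp
    refine (Frag.seq_runs hs' (Frag.seq_runs hp' (Frag.ret_runs _ _ _))).mono ?_
    rw [Nat.mul_succ]; omega
  refine fragPoly_of (Γ := Γ) (k₀ := kα) (k₁ := .inr (.inr (.inr true)))
    ((Frag.ret fun _ => T.init).seq (((Frag.forEach (Γ := Γ) kα body).seq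
      ((Frag.pushTake (Γ := Γ) kβ T.last L).seq (.ret fun _ => ()))).seq
      (Frag.move (Γ := Γ) (k := kβ) (k' := .inr (.inr (.inr true))) id)))
    (.C (3 * L + 1) * (.X + 1) + 1) fun l => ?_
  have r₁ := hloop l T.init []
  rw [List.append_nil] at r₁
  have r₂ := Frag.move_out_runs (α := α) S₀ S₀ [] [] (T.runFrom T.init l).reverse []
  rw [List.append_nil, List.reverse_reverse, List.length_reverse] at r₂
  have r₃ := Frag.seq_runs (Frag.ret_runs (fun _ : Unit => T.init) () _) (Frag.seq_runs r₁ r₂)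
  rw [appendStore_in, appendStore_out] at r₃
  refine r₃.mono ?_
  change _ ≤ (.C (3 * L + 1) * (.X + 1) + 1 : Polynomial ℕ).eval (List.length (α := α) l)
  have := T.length_runFrom_le h₁ h₂ T.init l
  simp only [Polynomial.eval_add, Polynomial.eval_mul, Polynomial.eval_X, Polynomial.eval_C,
    Polynomial.eval_one]
  nlinarith

end Transducer

/-! ### Machines on pairs of words: multiplication of lengths and truncation -/

section Pair

/-- The stack alphabets of machines whose input is a pair of words. -/
def PairΓ : Unit ⊕ Fin 4 → Type := Sum.elim (fun _ => Option Bool) fun _ => Bool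

instance : ∀ k, Finite (PairΓ k)
  | .inl _ => inferInstanceAs (Finite (Option Bool))
  | .inr _ => inferInstanceAs (Finite Bool)

/-- The stores of machines whose input is a pair of words. -/
def pairStore (i : List (Option Bool)) (a b c d : List Bool) : Store PairΓ
  | .inl _ => i
  | .inr 0 => a
  | .inr 1 => b
  | .inr 2 => c
  | .inr 3 => d

variable (i : List (Option Bool)) (a b c d : List Bool)

theorem update_pairStore_in (l : List (Option Bool)) :
    update (pairStore i a b c d) (.inl ()) l = pairStore l a b c d := by
  funext j
  rcases j with j | j
  · exact update_self _ _ _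
  · fin_cases j <;> exact update_of_ne (by simp) _ _

theorem update_pairStore_zero (l : List Bool) :
    update (pairStore i a b c d) (.inr 0) l = pairStore i l b c d := by
  funext j
  rcases j with j | j
  · exact update_of_ne (by simp) _ _
  · fin_cases j <;> first | exact update_self _ _ _ | exact update_of_ne (by simp) _ _

theorem update_pairStore_one (l : List Bool) :
    update (pairStore i a b c d) (.inr 1) l = pairStore i a l c d := by
  funext j
  rcases j with j | j
  · exact update_of_ne (by simp) _ _
  · fin_cases j <;> first | exact update_self _ _ _ | exact update_of_ne (by simp) _ _

theorem update_pairStore_two (l : List Bool) :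
    update (pairStore i a b c d) (.inr 2) l = pairStore i a b l d := by
  funext j
  rcases j with j | j
  · exact update_of_ne (by simp) _ _
  · fin_cases j <;> first | exact update_self _ _ _ | exact update_of_ne (by simp) _ _

theorem update_pairStore_three (l : List Bool) :
    update (pairStore i a b c d) (.inr 3) l = pairStore i a b c l := by
  funext j
  rcases j with j | j
  · exact update_of_ne (by simp) _ _
  · fin_cases j <;> first | exact update_self _ _ _ | exact update_of_ne (by simp) _ _

theorem pairStore_nil : pairStore [] [] [] [] [] = fun _ => [] := by
  funext j
  rcases j with j | j
  · rfl
  · fin_cases j <;> rfl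

namespace Frag

/-- Distribute the two input words over the stacks `0` and `1`. -/
def splitPair : Frag PairΓ Unit Unit :=
  (ret fun _ => false).seq ((forEach (X := Bool) (.inl ())
    ((pushOpt (X := Bool × Option Bool) (.inr 0)
        fun p => if p.1 then none else p.2).seq
      ((pushOpt (.inr 1) fun p => if p.1 then p.2 else none).seq
        (ret fun p => p.1 || p.2.isNone)))).seq (ret fun _ => ()))

theorem splitPair_runs (u v : List Bool) :
    splitPair.Runs () (pairStore (encPair (u, v)) [] [] [] []) ()
      (pairStore [] u.reverse v.reverse [] []) (3 * (u.length + v.length + 1) + 1) := by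
  let body : Frag PairΓ (Bool × Option Bool) Bool :=
    (pushOpt (X := Bool × Option Bool) (.inr 0)
        fun p => if p.1 then none else p.2).seq
      ((pushOpt (.inr 1) fun p => if p.1 then p.2 else none).seq
        (ret fun p => p.1 || p.2.isNone))
  have hbody : ∀ (m : Bool) (o : Option Bool) (i : List (Option Bool)) (a b : List Bool),
      body.Runs (m, o) (pairStore i a b [] []) (m || o.isNone)
        (pairStore i ((if m then none else o).toList ++ a) ((if m then o else none).toList ++ b)
          [] []) 2 := by
    intro m o i a b
    have h₁ := pushOpt_runs (Γ := PairΓ) (.inr 0)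
      (fun p : Bool × Option Bool => if p.1 then none else p.2) (m, o) (pairStore i a b [] [])
    erw [update_pairStore_zero] at h₁
    have h₂ := pushOpt_runs (Γ := PairΓ) (.inr 1)
      (fun p : Bool × Option Bool => if p.1 then p.2 else none) (m, o)
      (pairStore i ((if m then none else o).toList ++ a) b [] [])
    erw [update_pairStore_one] at h₂
    exact seq_runs h₁ (seq_runs h₂ (ret_runs _ _ _))
  have hsnd : ∀ (v a b : List Bool), (forEach (X := Bool) (.inl ()) body).Runs true
      (pairStore (v.map some) a b [] []) true (pairStore [] a (v.reverse ++ b) [] [])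
      (3 * v.length + 1) := by
    intro v
    induction v with
    | nil => exact fun a b => forEach_nil _ _ rfl
    | cons x v ih =>
      intro a b
      have h := hbody true (some x) (v.map some) a b
      rw [← update_pairStore_in (some x :: v.map some)] at h
      have := forEach_cons (k := .inl ()) (s := pairStore (some x :: v.map some) a b [] []) rfl h
        (ih a (x :: b))
      refine Eq.mp ?_ (this.mono (t' := 3 * (x :: v).length + 1) (by simp; omega))
      simp
  have hfst : ∀ (u a b : List Bool), (forEach (X := Bool) (.inl ()) body).Runs false
      (pairStore (encPair (u, v)) a b [] []) true
      (pairStore [] (u.reverse ++ a) (v.reverse ++ b) [] [])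
      (3 * (u.length + v.length + 1) + 1) := by
    intro u
    induction u with
    | nil =>
      intro a b
      have h := hbody false none (v.map some) a b
      rw [← update_pairStore_in (none :: v.map some)] at h
      have := forEach_cons (k := .inl ()) (s := pairStore (none :: v.map some) a b [] []) rfl h
        (hsnd v a b)
      exact this.mono (by simp; omega)
    | cons x u ih =>
      intro a b
      have h := hbody false (some x) (encPair (u, v)) a b
      rw [← update_pairStore_in (some x :: encPair (u, v))] at h
      have := forEach_cons (k := .inl ()) (s := pairStore (some x :: encPair (u, v)) a b [] [])
        rfl h (ih (x :: a) b)
      refine Eq.mp ?_ (this.mono (t' := 3 * ((x :: u).length + v.length + 1) + 1)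
        (by simp; omega))
      simp [encPair]
  have := hfst u [] []
  rw [List.append_nil, List.append_nil] at this
  exact (seq_runs (ret_runs (fun _ => false) () _) (seq_runs this (ret_runs _ _ _))).mono
    (by omega)

/-- Empty a stack. -/
def clear {K : Type} [DecidableEq K] {Γ : K → Type} (k : K) [Finite (Γ k)] : Frag Γ Unit Unit :=
  forEach (X := Unit) k (ret fun _ => ())

theorem clear_runs {K : Type} [DecidableEq K] {Γ : K → Type} (k : K) [Finite (Γ k)]
    (s : Store Γ) : (clear k).Runs () s () (update s k []) ((s k).length + 1) := by
  generalize hl : s k = l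
  induction l generalizing s with
  | nil =>
    rw [← hl, update_eq_self]
    exact (forEach_nil (X := Unit) (ret fun _ => ()) () hl).mono (by omega)
  | cons a l ih =>
    have h := ih (update s k l) (update_self _ _ _)
    rw [update_idem] at h
    exact (forEach_cons (X := Unit) hl (ret_runs (fun _ => ()) _ _) h).mono (by simp)

/-- Write as many symbols on stack `3` as there are pairs of symbols on the stacks `0`, `1`. -/
def mulPair : Frag PairΓ Unit Unit :=
  splitPair.seq ((forEach (.inr 1) ((ret fun _ => ()).seq
    ((move (Γ := PairΓ) (k := .inr 0) (k' := .inr 2) id).seq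
      (forEach (.inr 2) ((pushOpt (.inr 0) fun p => some p.2).seq
        ((pushOpt (.inr 3) fun _ => some true).seq (ret fun _ => ()))))))).seq (clear (.inr 0)))

theorem mulPair_runs (u v : List Bool) :
    mulPair.Runs () (pairStore (encPair (u, v)) [] [] [] []) ()
      (pairStore [] [] [] [] (List.replicate (u.length * v.length) true))
      (3 * (u.length + v.length + 1) + v.length * (5 * u.length + 3) + u.length + 3) := by
  let inner : Frag PairΓ Unit Unit := forEach (.inr 2) ((pushOpt (.inr 0) fun p => some p.2).seq
    ((pushOpt (.inr 3) fun _ => some true).seq (ret fun _ => ())))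
  have hinner : ∀ c a b d : List Bool, inner.Runs () (pairStore [] a b c d) ()
      (pairStore [] (c.reverse ++ a) b [] (List.replicate c.length true ++ d))
      (3 * c.length + 1) := by
    intro c
    induction c with
    | nil => exact fun a b d => forEach_nil _ _ rfl
    | cons x c ih =>
      intro a b d
      have h₁ := pushOpt_runs (Γ := PairΓ) (.inr 0)
        (fun p : Unit × Bool => some p.2) ((), x) (pairStore [] a b c d)
      erw [update_pairStore_zero] at h₁
      have h₂ := pushOpt_runs (Γ := PairΓ) (.inr 3)
        (fun p : Unit × Bool => some true) ((), x) (pairStore [] (x :: a) b c d)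
      erw [update_pairStore_three] at h₂
      have h := seq_runs h₁ (seq_runs h₂ (ret_runs (fun _ => ()) _ _))
      rw [← update_pairStore_two [] a b (x :: c) d] at h
      have := forEach_cons (Γ := PairΓ) (k := .inr 2) (s := pairStore [] a b (x :: c) d)
        (l := (c : List Bool)) (a := (x : Bool)) rfl h (ih (x :: a) b (true :: d))
      refine Eq.mp ?_ (this.mono (t' := 3 * (x :: c).length + 1) (by simp; omega))
      simp only [List.length_cons, List.replicate_succ', List.reverse_cons, List.append_assoc,
        List.singleton_append]
      rfl
  let body : Frag PairΓ (Unit × Bool) Unit := (ret fun _ => ()).seq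
    ((move (Γ := PairΓ) (k := .inr 0) (k' := .inr 2) id).seq inner)
  have hbody : ∀ (x : Bool) (a b d : List Bool), body.Runs ((), x) (pairStore [] a b [] d) ()
      (pairStore [] a b [] (List.replicate a.length true ++ d)) (5 * a.length + 2) := by
    intro x a b d
    have h₁ : (move (Γ := PairΓ) (k := .inr 0) (k' := .inr 2) id).Runs () (pairStore [] a b [] d)
        () (pairStore [] [] b a.reverse d) (2 * a.length + 1) := by
      refine move_runs_of (Γ := PairΓ) (k := .inr 0) (k' := .inr 2) (by simp) id (l := a) rfl ?_
      refine (congrArg (update · _ _) (update_pairStore_zero ..)).trans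
        ((update_pairStore_two ..).trans ?_)
      change pairStore [] [] b (a.reverse.map id ++ ([] : List Bool)) d = _
      rw [List.map_id, List.append_nil]
    have h₂ := hinner a.reverse [] b d
    rw [List.reverse_reverse, List.append_nil, List.length_reverse] at h₂
    exact (seq_runs (ret_runs (fun _ => ()) ((), x) _) (seq_runs h₁ h₂)).mono (by omega)
  have hloop : ∀ b a d : List Bool, (forEach (Γ := PairΓ) (.inr 1) body).Runs ()
      (pairStore [] a b [] d) ()
      (pairStore [] a [] [] (List.replicate (a.length * b.length) true ++ d))
      (b.length * (5 * a.length + 3) + 1) := by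
    intro b
    induction b with
    | nil => exact fun a d => (forEach_nil _ _ rfl).mono (by omega)
    | cons x b ih =>
      intro a d
      have h := hbody x a b d
      rw [← update_pairStore_one [] a (x :: b) [] d] at h
      have := forEach_cons (Γ := PairΓ) (k := .inr 1) (s := pairStore [] a (x :: b) [] d)
        (l := (b : List Bool)) (a := (x : Bool)) rfl h (ih a (List.replicate a.length true ++ d))
      refine Eq.mp ?_ (this.mono (t' := (x :: b).length * (5 * a.length + 3) + 1) ?_)
      · rw [← List.append_assoc, List.replicate_append_replicate,
          show a.length * (x :: b).length = a.length * b.length + a.length from Nat.mul_succ _ _]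
      · rw [show (x :: b).length * (5 * a.length + 3) = b.length * (5 * a.length + 3) +
          (5 * a.length + 3) from Nat.succ_mul _ _]
        omega
  have h₁ := hloop v.reverse u.reverse []
  rw [List.append_nil, List.length_reverse, List.length_reverse] at h₁
  have h₂ := clear_runs (Γ := PairΓ) (.inr 0)
    (pairStore [] u.reverse [] [] (List.replicate (u.length * v.length) true))
  erw [update_pairStore_zero] at h₂
  refine (seq_runs (splitPair_runs u v) (seq_runs h₁ h₂)).mono ?_
  change _ + (_ + (List.length (α := Bool) u.reverse + 1)) ≤ _
  rw [List.length_reverse]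
  omega

/-- Write on stack `1` the second word, cut to the length of the first. -/
def takePair : Frag PairΓ Unit Unit :=
  splitPair.seq ((move (Γ := PairΓ) (k := .inr 1) (k' := .inr 2) id).seq
    ((forEach (.inr 0) ((popF (X := Unit × Bool) (.inr 2)).seq
      ((pushOpt (.inr 3) fun p => p.2).seq (ret fun _ => ())))).seq
      ((clear (.inr 2)).seq (move (Γ := PairΓ) (k := .inr 3) (k' := .inr 1) id))))

theorem takePair_runs (u v : List Bool) :
    takePair.Runs () (pairStore (encPair (u, v)) [] [] [] []) ()
      (pairStore [] [] (v.take u.length) [] []) (20 * (u.length + v.length + 1)) := by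
  let body : Frag PairΓ (Unit × Bool) Unit := (popF (X := Unit × Bool) (.inr 2)).seq
      ((pushOpt (.inr 3) fun p => p.2).seq (ret fun _ => ()))
  have hbody : ∀ (x : Bool) (a c d : List Bool), body.Runs ((), x) (pairStore [] a [] c d) ()
      (pairStore [] a [] c.tail (c.head?.toList ++ d)) 2 := by
    intro x a c d
    have h₁ := popF_runs (Γ := PairΓ) (X := Unit × Bool) (.inr 2) ((), x) (pairStore [] a [] c d)
    erw [update_pairStore_two] at h₁
    have h₂ := pushOpt_runs (Γ := PairΓ) (.inr 3)
        (fun p : (Unit × Bool) × Option Bool => p.2) (((), x), c.head?)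
        (pairStore [] a [] c.tail d)
    erw [update_pairStore_three] at h₂
    exact seq_runs h₁ (seq_runs h₂ (ret_runs (fun _ => ()) _ _))
  have hloop : ∀ a c d : List Bool, (forEach (Γ := PairΓ) (.inr 0) body).Runs ()
      (pairStore [] a [] c d) ()
      (pairStore [] [] [] (c.drop a.length) ((c.take a.length).reverse ++ d))
      (3 * a.length + 1) := by
    intro a
    induction a with
    | nil => exact fun c d => (forEach_nil _ _ rfl).mono (by omega)
    | cons x a ih =>
      intro c d
      have h := hbody x a c d
      rw [← update_pairStore_zero [] (x :: a) [] c d] at h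
      have := forEach_cons (Γ := PairΓ) (k := .inr 0) (s := pairStore [] (x :: a) [] c d)
        (l := (a : List Bool)) (a := (x : Bool)) rfl h (ih c.tail (c.head?.toList ++ d))
      refine Eq.mp ?_ (this.mono (t' := 3 * (x :: a).length + 1) (by simp; omega))
      cases c <;> simp
  have h₁ : (move (Γ := PairΓ) (k := .inr 1) (k' := .inr 2) id).Runs ()
      (pairStore [] u.reverse v.reverse [] []) () (pairStore [] u.reverse [] v [])
      (2 * v.length + 1) := by
    rw [← List.length_reverse]
    refine move_runs_of (Γ := PairΓ) (k := .inr 1) (k' := .inr 2) (by simp) id (l := v.reverse)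
      rfl ?_
    refine (congrArg (update · _ _) (update_pairStore_one ..)).trans
      ((update_pairStore_two ..).trans ?_)
    change pairStore [] u.reverse [] (v.reverse.reverse.map id ++ ([] : List Bool)) [] = _
    rw [List.map_id, List.append_nil, List.reverse_reverse]
  have h₂ := hloop u.reverse v []
  rw [List.length_reverse, List.append_nil] at h₂
  have h₃ := clear_runs (Γ := PairΓ) (.inr 2)
    (pairStore [] [] [] (v.drop u.length) (v.take u.length).reverse)
  erw [update_pairStore_two] at h₃
  have h₄ : (move (Γ := PairΓ) (k := .inr 3) (k' := .inr 1) id).Runs ()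
      (pairStore [] [] [] [] (v.take u.length).reverse) () (pairStore [] [] (v.take u.length) [] [])
      (2 * (v.take u.length).length + 1) := by
    rw [← List.length_reverse (as := v.take u.length)]
    refine move_runs_of (Γ := PairΓ) (k := .inr 3) (k' := .inr 1) (by simp) id
      (s := pairStore [] [] [] [] (v.take u.length).reverse)
      (l := (v.take u.length).reverse) rfl ?_
    refine (congrArg (update · _ _) (update_pairStore_three ..)).trans
      ((update_pairStore_one ..).trans ?_)
    change pairStore [] [] ((v.take u.length).reverse.reverse.map id ++ ([] : List Bool)) [] [] = _
    rw [List.map_id, List.append_nil, List.reverse_reverse]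
  refine (seq_runs (splitPair_runs u v) (seq_runs h₁ (seq_runs h₂ (seq_runs h₃ h₄)))).mono ?_
  change _ + (_ + (_ + ((List.length (α := Bool) (v.drop u.length) + 1) + _))) ≤ _
  rw [List.length_drop, List.length_take]
  omega

end Frag

end Pair

theorem length_encPair (p : List Bool × List Bool) :
    (encPair p).length = p.1.length + p.2.length + 1 := by
  simp [encPair]; omega

theorem pairStore_input (i : List (Option Bool)) :
    pairStore i [] [] [] [] = Store.single (.inl ()) i := by
  rw [← update_pairStore_in [], pairStore_nil]
  rfl

/-- Multiplication in unary, from which `1^{p(|x|)}` is built for every polynomial `p`. -/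
theorem fragPoly_mul :
    FragPoly encPair fun p => List.replicate (p.1.length * p.2.length) true := by
  refine fragPoly_of (Γ := PairΓ) (k₀ := .inl ()) (k₁ := .inr 3) Frag.mulPair
    (5 * .X ^ 2 + 20 * .X) fun p => ?_
  have h := Frag.mulPair_runs p.1 p.2
  rw [pairStore_input, ← update_pairStore_three [] [] [] [] [], pairStore_nil] at h
  refine h.mono ?_
  change _ ≤ (5 * .X ^ 2 + 20 * .X : Polynomial ℕ).eval (List.length (α := Option Bool) (encPair p))
  simp only [Polynomial.eval_add, Polynomial.eval_mul, Polynomial.eval_X, Polynomial.eval_pow,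
    Polynomial.eval_ofNat, length_encPair]
  nlinarith

/-- Serves twice: to cut certificates to the length `p(|x|)` and to cut answer vectors to the number
of queries. -/
theorem fragPoly_take : FragPoly encPair fun p => p.2.take p.1.length := by
  refine fragPoly_of (Γ := PairΓ) (k₀ := .inl ()) (k₁ := .inr 1) Frag.takePair
    (20 * .X) fun p => ?_
  have h := Frag.takePair_runs p.1 p.2
  rw [pairStore_input, ← update_pairStore_one [] [] [] [] [], pairStore_nil] at h
  refine h.mono ?_
  change _ ≤ (20 * .X : Polynomial ℕ).eval (List.length (α := Option Bool) (encPair p))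
  simp only [Polynomial.eval_mul, Polynomial.eval_X, Polynomial.eval_ofNat, length_encPair]
  exact le_rfl

/-! ### Some polynomial-time functions -/

section Basic

variable {α αΓ βΓ γΓ : Type} {ea : α → List αΓ}

theorem FragPoly.of_id {g : List αΓ → List βΓ} (h : FragPoly id g) (ea : α → List αΓ) :
    FragPoly ea fun a => g (ea a) := by
  obtain ⟨K, _, _, Γ, _, k₀, k₁, e₀, e₁, F, p, h⟩ := h
  exact ⟨K, inferInstance, inferInstance, Γ, inferInstance, k₀, k₁, e₀, e₁, F, p,
    fun a => h (ea a)⟩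

theorem FragPoly.transduce [Finite βΓ] [Finite γΓ] {f : α → List βΓ} (hf : FragPoly ea f)
    (T : Transducer βΓ γΓ) : FragPoly ea fun a => T.run (f a) :=
  FragPoly.comp (eb := id) (f := f) hf T.fragPoly

/-- The transducer that replaces each letter by a word. -/
def Transducer.flatMap (e : βΓ → List γΓ) : Transducer βΓ γΓ where
  S := Unit
  fin := inferInstance
  init := ()
  step _ a := ((), e a)
  last _ := []

theorem Transducer.run_flatMap (e : βΓ → List γΓ) (l : List βΓ) :
    (Transducer.flatMap e).run l = l.flatMap e := by
  induction l with
  | nil => rfl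
  | cons a l ih => exact congrArg (e a ++ ·) ih

theorem FragPoly.flatMap [Finite βΓ] [Finite γΓ] {f : α → List βΓ} (hf : FragPoly ea f)
    (e : βΓ → List γΓ) : FragPoly ea fun a => (f a).flatMap e := by
  simpa only [Transducer.run_flatMap] using hf.transduce (Transducer.flatMap e)

theorem FragPoly.map [Finite βΓ] [Finite γΓ] {f : α → List βΓ} (hf : FragPoly ea f)
    (e : βΓ → γΓ) : FragPoly ea fun a => (f a).map e := by
  simpa only [← List.map_eq_flatMap] using hf.flatMap fun b => [e b]

theorem fragPoly_enc [Finite αΓ] (ea : α → List αΓ) : FragPoly ea ea := by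
  have := FragPoly.of_id (Transducer.flatMap fun a : αΓ => [a]).fragPoly ea
  simpa only [Transducer.run_flatMap, List.flatMap_singleton'] using this

/-- The transducer that emits a fixed word at the end. -/
def Transducer.const (βΓ : Type) (w : List γΓ) : Transducer βΓ γΓ where
  S := Unit
  fin := inferInstance
  init := ()
  step _ _ := ((), [])
  last _ := w

theorem Transducer.run_const (w : List γΓ) (l : List βΓ) :
    (Transducer.const βΓ w).run l = w := by
  induction l with
  | nil => rfl
  | cons a l ih => exact ih

theorem fragPoly_const [Finite αΓ] [Finite βΓ] (ea : α → List αΓ) (w : List βΓ) :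
    FragPoly ea fun _ => w := by
  simpa only [Transducer.run_const] using (fragPoly_enc ea).transduce (Transducer.const αΓ w)

theorem FragPoly.pair [Finite αΓ] {f g : α → List Bool} (hf : FragPoly ea f)
    (hg : FragPoly ea g) : FragPoly ea fun a => encPair (f a, g a) := by
  have := (hf.map some).append ((fragPoly_const ea [none]).append (hg.map some))
  simpa [encPair] using this

theorem FragPoly.comp_pair [Finite αΓ] {f g : α → List Bool} (hf : FragPoly ea f)
    (hg : FragPoly ea g) {h : List Bool × List Bool → List βΓ} (hh : FragPoly encPair h) :
    FragPoly ea fun a => h (f a, g a) :=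
  FragPoly.comp (eb := encPair) (f := fun a => (f a, g a)) (hf.pair hg) hh

theorem FragPoly.flatMap_list {ι : Type} [Finite αΓ] [Finite βΓ] (L : List ι)
    {f : ι → α → List βΓ} (hf : ∀ i, FragPoly ea (f i)) :
    FragPoly ea fun a => L.flatMap fun i => f i a := by
  induction L with
  | nil => exact fragPoly_const ea []
  | cons i L ih => simpa only [List.flatMap_cons] using (hf i).append ih

end Basic

/-- The word before the first separator. -/
def firstWord : List (Option Bool) → List Bool
  | some b :: l => b :: firstWord l
  | _ => []

/-- What follows the first separator. -/
def dropWord : List (Option Bool) → List (Option Bool)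
  | some _ :: l => dropWord l
  | none :: l => l
  | [] => []

theorem firstWord_append (u : List Bool) (l : List (Option Bool)) :
    firstWord (u.map some ++ none :: l) = u := by
  induction u with
  | nil => rfl
  | cons a u ih => exact congrArg (a :: ·) ih

theorem dropWord_append (u : List Bool) (l : List (Option Bool)) :
    dropWord (u.map some ++ none :: l) = l := by
  induction u with
  | nil => rfl
  | cons a u ih => exact ih

theorem length_firstWord_le (l : List (Option Bool)) : (firstWord l).length ≤ l.length := by
  induction l with
  | nil => simp [firstWord]
  | cons o l ih => cases o <;> simp [firstWord, ih]

theorem length_dropWord_le (l : List (Option Bool)) : (dropWord l).length ≤ l.length := by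
  induction l with
  | nil => simp [dropWord]
  | cons o l ih => cases o <;> simp [dropWord]; omega

/-- The transducer for `firstWord`; the state tells whether the separator has been read. -/
def firstWordT : Transducer (Option Bool) Bool where
  S := Bool
  fin := inferInstance
  init := false
  step s o := (s || o.isNone, if s then [] else o.toList)
  last _ := []

theorem run_firstWordT (l : List (Option Bool)) : firstWordT.run l = firstWord l := by
  have h : ∀ l, firstWordT.runFrom true l = [] := by
    intro l
    induction l with
    | nil => rfl
    | cons o l ih => exact ih
  change firstWordT.runFrom false l = _
  induction l with
  | nil => rfl
  | cons o l ih =>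
    cases o with
    | none => exact h l
    | some b => exact congrArg (b :: ·) ih

/-- The transducer for `dropWord`; the state tells whether the separator has been read. -/
def dropWordT : Transducer (Option Bool) (Option Bool) where
  S := Bool
  fin := inferInstance
  init := false
  step s o := (s || o.isNone, if s then [o] else [])
  last _ := []

theorem run_dropWordT (l : List (Option Bool)) : dropWordT.run l = dropWord l := by
  have h : ∀ l, dropWordT.runFrom true l = l := by
    intro l
    induction l with
    | nil => rfl
    | cons o l ih => exact congrArg (o :: ·) ih
  change dropWordT.runFrom false l = _
  induction l with
  | nil => rfl
  | cons o l ih =>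
    cases o with
    | none => exact h l
    | some b => exact ih

theorem FragPoly.firstWord {α αΓ : Type} {ea : α → List αΓ} {f : α → List (Option Bool)}
    (hf : FragPoly ea f) : FragPoly ea fun a => firstWord (f a) := by
  simpa only [run_firstWordT] using hf.transduce firstWordT

theorem FragPoly.dropWord {α αΓ : Type} {ea : α → List αΓ} {f : α → List (Option Bool)}
    (hf : FragPoly ea f) : FragPoly ea fun a => dropWord (f a) := by
  simpa only [run_dropWordT] using hf.transduce dropWordT

theorem fragPoly_fst : FragPoly encPair Prod.fst := by
  have := (fragPoly_enc encPair).firstWord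
  simpa only [encPair, firstWord_append] using this

theorem fragPoly_snd : FragPoly encPair Prod.snd := by
  have := (fragPoly_enc encPair).dropWord.flatMap Option.toList
  have h : ∀ l : List Bool, (l.map some).flatMap Option.toList = l := by
    intro l
    induction l with
    | nil => rfl
    | cons a l ih => exact congrArg (a :: ·) ih
  simpa only [encPair, dropWord_append, h] using this

/-- The `i`-th word of an encoded list of words. -/
def nthWord (i : ℕ) (l : List (Option Bool)) : List Bool := firstWord (dropWord^[i] l)

/-- Beyond the end of the list the empty word is read, so queries that are missing can be treated as
queries of `[]`. -/
theorem nthWord_encList (i : ℕ) (ws : List (List Bool)) :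
    nthWord i (encList ws) = ws.getD i [] := by
  induction i generalizing ws with
  | zero =>
    cases ws with
    | nil => rfl
    | cons w ws =>
      have := firstWord_append w (encList ws)
      simpa [nthWord, encList] using this
  | succ i ih =>
    cases ws with
    | nil => exact (ih []).trans (by simp)
    | cons w ws =>
      have := dropWord_append w (encList ws)
      rw [nthWord, iterate_succ_apply,
        show dropWord (encList (w :: ws)) = encList ws by simpa [encList] using this]
      exact (ih ws).trans (by simp)

theorem length_nthWord_le (i : ℕ) (l : List (Option Bool)) : (nthWord i l).length ≤ l.length := by
  refine (length_firstWord_le _).trans ?_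
  induction i with
  | zero => rfl
  | succ i ih => rw [iterate_succ_apply']; exact (length_dropWord_le _).trans ih

theorem FragPoly.nthWord {α αΓ : Type} {ea : α → List αΓ} {f : α → List (Option Bool)}
    (hf : FragPoly ea f) (i : ℕ) : FragPoly ea fun a => nthWord i (f a) := by
  have : FragPoly ea fun a => BoundedQueries.dropWord^[i] (f a) := by
    induction i with
    | zero => exact hf
    | succ i ih => simpa only [iterate_succ_apply'] using ih.dropWord
  exact this.firstWord

/-- The code of a letter by two bits. -/
def letterCode : Option Bool → List Bool
  | some b => [true, b]
  | none => [false, true]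

/-- A self-delimiting code of words over `Option Bool`. -/
def wordCode (l : List (Option Bool)) : List Bool := l.flatMap letterCode ++ [false, false]

/-- The word whose code is read. -/
def decodeWord : List Bool → List (Option Bool)
  | true :: b :: l => some b :: decodeWord l
  | false :: true :: l => none :: decodeWord l
  | _ => []

/-- What follows the code of a word. -/
def decodeRest : List Bool → List Bool
  | true :: _ :: l => decodeRest l
  | false :: true :: l => decodeRest l
  | false :: false :: l => l
  | _ => []

/-- No letter has the code `00`, so this pair of bits marks the end and anything may follow. -/
theorem decodeWord_wordCode (l : List (Option Bool)) (r : List Bool) :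
    decodeWord (wordCode l ++ r) = l := by
  induction l with
  | nil => rfl
  | cons o l ih =>
    cases o with
    | none => exact congrArg (none :: ·) ih
    | some b => exact congrArg (some b :: ·) ih

theorem decodeRest_wordCode (l : List (Option Bool)) (r : List Bool) :
    decodeRest (wordCode l ++ r) = r := by
  induction l with
  | nil => rfl
  | cons o l ih =>
    cases o with
    | none => exact ih
    | some b => exact ih

theorem length_decodeWord_le (l : List Bool) : (decodeWord l).length ≤ l.length := by
  fun_induction decodeWord l <;> simp <;> omega

theorem length_wordCode (l : List (Option Bool)) : (wordCode l).length = 2 * l.length + 2 := by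
  induction l with
  | nil => rfl
  | cons o l ih =>
    have : (wordCode (o :: l)).length = 2 + (wordCode l).length := by
      cases o <;> simp [wordCode, letterCode] <;> omega
    rw [this, ih, List.length_cons]; omega

/-- The transducer for `decodeWord`: the state is `none` after the end of the code, and otherwise
holds the first half of a letter, if it has been read. -/
def decodeWordT : Transducer Bool (Option Bool) where
  S := Option (Option Bool)
  fin := inferInstance
  init := some none
  step
    | none, _ => (none, [])
    | some none, b => (some (some b), [])
    | some (some true), b => (some none, [some b])
    | some (some false), true => (some none, [none])
    | some (some false), false => (none, [])
  last _ := []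

theorem run_decodeWordT (l : List Bool) : decodeWordT.run l = decodeWord l := by
  have h : ∀ l, decodeWordT.runFrom none l = [] := by
    intro l
    induction l with
    | nil => rfl
    | cons o l ih => exact ih
  change decodeWordT.runFrom (some none) l = _
  fun_induction decodeWord l with
  | case1 b l ih => exact congrArg (some b :: ·) ih
  | case2 l ih => exact congrArg (none :: ·) ih
  | case3 l h₁ h₂ =>
    match l with
    | [] => rfl
    | [true] => rfl
    | [false] => rfl
    | true :: b :: l => exact absurd rfl (h₁ b l)
    | false :: true :: l => exact absurd rfl (h₂ l)
    | false :: false :: l => exact h l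

/-- The transducer for `decodeRest`. -/
def decodeRestT : Transducer Bool Bool where
  S := Option (Option Bool)
  fin := inferInstance
  init := some none
  step
    | none, b => (none, [b])
    | some none, b => (some (some b), [])
    | some (some true), _ => (some none, [])
    | some (some false), true => (some none, [])
    | some (some false), false => (none, [])
  last _ := []

theorem run_decodeRestT (l : List Bool) : decodeRestT.run l = decodeRest l := by
  have h : ∀ l, decodeRestT.runFrom none l = l := by
    intro l
    induction l with
    | nil => rfl
    | cons o l ih => exact congrArg (o :: ·) ih
  change decodeRestT.runFrom (some none) l = _
  fun_induction decodeRest l with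
  | case1 b l ih => exact ih
  | case2 l ih => exact ih
  | case3 l => exact h l
  | case4 l h₁ h₂ h₃ =>
    match l with
    | [] => rfl
    | [true] => rfl
    | [false] => rfl
    | true :: b :: l => exact absurd rfl (h₁ b l)
    | false :: true :: l => exact absurd rfl (h₂ l)
    | false :: false :: l => exact absurd rfl (h₃ l)

theorem take_take_append {α : Type} (n : ℕ) (u l : List α) :
    (u.take n ++ l).take n = (u ++ l).take n := by
  rcases le_total n u.length with h | h
  · rw [List.take_append_of_le_length h, List.take_append_of_le_length (by simpa using h),
      List.take_take, min_self]
  · rw [List.take_of_length_le h]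

/-- The transducer that decides by the first `n` letters. -/
def prefixT (n : ℕ) (h : List Bool → Bool) : Transducer Bool Bool where
  S := {l : List Bool // l.length ≤ n}
  fin := List.finite_length_le Bool n
  init := ⟨[], n.zero_le⟩
  step s b := (⟨(s.1 ++ [b]).take n, by simp⟩, [])
  last s := [h s.1]

/-- The control remembers the whole prefix, so `h` may be an arbitrary function. This spares any
algorithm for mind changes. -/
theorem run_prefixT (n : ℕ) (h : List Bool → Bool) (l : List Bool) :
    (prefixT n h).run l = [h (l.take n)] := by
  have key : ∀ l (s : {l : List Bool // l.length ≤ n}),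
      (prefixT n h).runFrom s l = [h ((s.1 ++ l).take n)] := by
    intro l
    induction l with
    | nil =>
      intro s
      rw [List.append_nil, List.take_of_length_le s.2]
      rfl
    | cons b l ih =>
      intro s
      refine (ih _).trans ?_
      simp only [prefixT]
      rw [take_take_append, List.append_assoc, List.singleton_append]
  exact key l _

/-- `1^{p(|x|)}` is computable in polynomial time. -/
theorem fragPoly_unary (p : Polynomial ℕ) :
    FragPoly id fun x : List Bool => List.replicate (p.eval x.length) true := by
  induction p using Polynomial.induction_on' with
  | add p q hp hq => simpa only [Polynomial.eval_add, List.replicate_add] using hp.append hq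
  | monomial n a =>
    induction n with
    | zero => simpa using fragPoly_const id (List.replicate a true)
    | succ n ih =>
      have := ih.comp_pair (fragPoly_enc id) fragPoly_mul
      simpa [Polynomial.eval_monomial, pow_succ, mul_assoc] using this

/-! ### The oracle and the query word -/

/-- A verifier of an NP language that may be given certificates of any length. -/
theorem exists_verifier {A : Language Bool} (hA : A ∈ NP) :
    ∃ (R : List Bool × List Bool → Bool) (p : Polynomial ℕ), FragPoly encPair (fun a => [R a]) ∧
      (∀ x w, R (x, w) = true → x ∈ A) ∧
      ∀ x ∈ A, ∃ w : List Bool, w.length ≤ p.eval x.length ∧ R (x, w) = true := by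
  obtain ⟨R, p, hR, h⟩ := hA
  -- Truncating the certificate before verification replaces a check of its length: whatever is
  -- accepted yields a genuine short certificate.
  refine ⟨fun a => R (a.1, a.2.take (p.eval a.1.length)), p, ?_, ?_, ?_⟩
  · have h₁ : FragPoly encPair fun a => List.replicate (p.eval a.1.length) true :=
      FragPoly.comp (eb := id) (f := Prod.fst) fragPoly_fst (fragPoly_unary p)
    have h₂ := h₁.comp_pair fragPoly_snd fragPoly_take
    simp only [List.length_replicate] at h₂
    exact fragPoly_fst.comp_pair h₂ hR.fragPoly
  · intro x w hw
    exact (h x).2 ⟨_, by simp, hw⟩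
  · intro x hx
    obtain ⟨w, hw, hw'⟩ := (h x).1 hx
    exact ⟨w, hw, by simpa [List.take_of_length_le hw] using hw'⟩

theorem chi_eq_true {A : Language Bool} {x : List Bool} : chi A x = true ↔ x ∈ A := by
  simp [chi]

/-- A list of words, written as a self-delimiting word. -/
def listCode (qs : List (List Bool)) : List Bool := wordCode (encList qs)

/-- The decision `g`, monotone in the answers to `m` queries to an NP language, is in NP. -/
theorem exists_oracle {A : Language Bool} (hA : A ∈ NP) (m n : ℕ)
    (g : (Fin m → Bool) → List Bool → Bool)
    (hg : ∀ v v' r, v ≤ v' → g v r = true → g v' r = true) :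
    ∃ B ∈ NP, ∀ (qs : List (List Bool)) (r : List Bool), r.length ≤ n →
      chi B (listCode qs ++ r) = g (fun i => chi A (qs.getD i [])) r := by
  obtain ⟨R, p, hR, hsound, hcomplete⟩ := exists_verifier hA
  -- The first `m` bits are the verified answers and the others form `r`. Only `m + n` bits matter,
  -- a constant number, so `h` can be a finite table.
  let h : List Bool → Bool := fun l => g (fun i => l.getD i false) (l.drop m)
  let ans : List Bool × List Bool → List Bool := fun a => (List.range m).flatMap fun i =>
    [R (nthWord i (decodeWord a.1), nthWord i (decodeWord a.2))]
  let V : List Bool × List Bool → Bool := fun a => h ((ans a ++ decodeRest a.1).take (m + n))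
  have hans : ∀ a, ans a = List.ofFn fun i : Fin m =>
      R (nthWord i (decodeWord a.1), nthWord i (decodeWord a.2)) := by
    intro a
    simp only [ans, ← List.map_eq_flatMap]
    apply List.ext_getElem <;> simp
  have hV : FragPoly encPair fun a => [V a] := by
    have hdec : ∀ {f : List Bool × List Bool → List Bool}, FragPoly encPair f →
        FragPoly encPair fun a => decodeWord (f a) := by
      intro f hf
      simpa only [run_decodeWordT] using hf.transduce decodeWordT
    have h₁ : FragPoly encPair ans := FragPoly.flatMap_list _ fun i =>
      ((hdec fragPoly_fst).nthWord i).comp_pair ((hdec fragPoly_snd).nthWord i) hR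
    have h₂ : FragPoly encPair fun a => decodeRest a.1 := by
      simpa only [run_decodeRestT] using fragPoly_fst.transduce decodeRestT
    simpa only [run_prefixT] using (h₁.append h₂).transduce (prefixT (m + n) h)
  -- There are `m` certificates, each with a terminator, hence `m * (p + 1)` letters; `wordCode`
  -- doubles the length and adds two bits.
  let P : Polynomial ℕ := .C (2 * m) * (p + 1) + 2
  refine ⟨{y | ∃ w : List Bool, w.length ≤ P.eval y.length ∧ V (y, w) = true},
    ⟨V, P, polyTime_iff_fragPoly.2 hV, fun x => Iff.rfl⟩, fun qs r hr => ?_⟩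
  have hVval : ∀ w, V (listCode qs ++ r, w) =
      g (fun i => R (qs.getD i [], nthWord i (decodeWord w))) r := by
    intro w
    simp only [V, hans, listCode, decodeWord_wordCode, decodeRest_wordCode, nthWord_encList, h]
    rw [List.take_of_length_le (by simp; omega)]
    congr 1
    · funext i
      rw [List.getD_append _ _ _ _ (by simp)]
      simp
    · rw [List.drop_left' (by simp)]
  rw [Bool.eq_iff_iff]
  refine Iff.trans chi_eq_true ?_
  constructor
  · rintro ⟨w, -, hw⟩
    rw [hVval] at hw
    -- The verified answers lie below the true ones by soundness, and `g` is monotone.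
    refine hg _ _ r (fun i => ?_) hw
    cases e : R (qs.getD i [], nthWord i (decodeWord w)) with
    | false => exact Bool.false_le _
    | true => exact (chi_eq_true.2 (hsound _ _ e)).ge
  · intro hgr
    have : ∀ i : Fin m, ∃ w : List Bool, w.length ≤ p.eval (qs.getD i []).length ∧
        R (qs.getD i [], w) = chi A (qs.getD i []) := by
      intro i
      by_cases hi : qs.getD i [] ∈ A
      · obtain ⟨w, hw, hw'⟩ := hcomplete _ hi
        exact ⟨w, hw, by simp only [chi, hi, decide_true, hw']⟩
      -- For a word outside `A` every certificate is rejected, so the empty one reproduces the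
      -- answer. With these choices the verified answers are exactly the true ones.
      · refine ⟨[], by simp, ?_⟩
        simp only [chi, hi, decide_false]
        by_contra hne
        exact hi (hsound _ _ (by simpa using hne))
    choose w hw hw' using this
    refine ⟨listCode (List.ofFn w), ?_, ?_⟩
    · have hq : ∀ i : Fin m, (w i).length + 1 ≤ p.eval (listCode qs ++ r).length + 1 := by
        intro i
        have h₁ := length_nthWord_le i (decodeWord (listCode qs ++ r))
        have h₂ := length_decodeWord_le (listCode qs ++ r)
        rw [listCode, decodeWord_wordCode, nthWord_encList] at h₁
        rw [listCode, decodeWord_wordCode] at h₂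
        exact Nat.succ_le_succ ((hw i).trans (eval_mono_nat p (h₁.trans h₂)))
      have hsum : (encList (List.ofFn w)).length ≤
          m * (p.eval (listCode qs ++ r).length + 1) := by
        rw [encList, List.length_flatMap, List.map_ofFn, List.sum_ofFn]
        refine (Finset.sum_le_sum fun i _ => ?_).trans (b := ∑ i : Fin m,
          (p.eval (listCode qs ++ r).length + 1)) (by simp)
        simpa using hq i
      rw [listCode, length_wordCode]
      simp only [P, Polynomial.eval_add, Polynomial.eval_mul, Polynomial.eval_C,
        Polynomial.eval_one, Polynomial.eval_ofNat]
      rw [mul_assoc]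
      omega
    · rw [hVval]
      convert hgr using 2
      funext i
      have := decodeWord_wordCode (encList (List.ofFn w)) []
      rw [List.append_nil] at this
      rw [listCode, this, nthWord_encList, ← hw' i]
      congr 2
      simp [List.getD_eq_getElem?_getD]

/-- All bit vectors of length `m`, as lists. -/
def bitVectors (m : ℕ) : List (List Bool) :=
  (Finset.univ : Finset (Fin m → Bool)).toList.map List.ofFn

/-- The values of `decision` at `x` and all vectors of answers. -/
def truthTable (decision : List Bool × List Bool → Bool) (m : ℕ) (x : List Bool) (r : ℕ) :
    List Bool :=
  (bitVectors m).map fun v => decision (x, v.take r)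

/-- This is the word that the classical phase leaves on the query tape. It gives the oracle
everything that depends on `x`, and its last bit, the value of the decision for all answers `false`,
is also read by the final scan. -/
theorem fragPoly_queryWord {queries : List Bool → List (List Bool)}
    {decision : List Bool × List Bool → Bool} (hq : PolyTime id encList queries)
    (hd : PolyTime encPair (fun b => [b]) decision) (m : ℕ) :
    FragPoly id fun x => listCode (queries x) ++ truthTable decision m x (queries x).length ++
      [decision (x, (List.replicate m false).take (queries x).length)] := by
  have hq' : FragPoly id fun x => encList (queries x) := hq.fragPoly
  have h₁ : FragPoly id fun x => listCode (queries x) :=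
    (hq'.flatMap letterCode).append (fragPoly_const id [false, false])
  have h₂ : ∀ v : List Bool, FragPoly id fun x => [decision (x, v.take (queries x).length)] := by
    intro v
    -- Terminators become unary digits, so the number of queries is available as the length of a
    -- word and `fragPoly_take` can cut `v` to it.
    have hcount := hq'.flatMap fun o => if o.isNone then [true] else []
    have hlen : ∀ ws : List (List Bool), ((encList ws).flatMap fun o =>
        if o.isNone then [true] else []).length = ws.length := by
      intro ws
      induction ws with
      | nil => rfl
      | cons w ws ih =>
        have hw : (w.map some).flatMap (fun o : Option Bool => if o.isNone then [true] else []) =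
            [] := by
          simp only [List.flatMap_eq_nil_iff, List.mem_map]
          rintro _ ⟨b, -, rfl⟩
          rfl
        rw [show encList (w :: ws) = w.map some ++ none :: encList ws by simp [encList],
          List.flatMap_append, hw, List.flatMap_cons, List.nil_append, List.length_append, ih]
        simp [add_comm]
    have := hcount.comp_pair (fragPoly_const id v) fragPoly_take
    simp only [hlen] at this
    exact (fragPoly_enc id).comp_pair this hd.fragPoly
  have h₃ : FragPoly id fun x => truthTable decision m x (queries x).length := by
    simpa only [truthTable, List.map_eq_flatMap] using FragPoly.flatMap_list (bitVectors m) h₂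
  exact (h₁.append h₃).append (h₂ _)

/-! ### Mind changes and the search for their parity -/

section MindChanges

variable {m : ℕ} (D : (Fin m → Bool) → Bool)

/-- The number of coordinates that are `true`. -/
def weight (v : Fin m → Bool) : ℕ := (Finset.univ.filter fun i => v i = true).card

theorem weight_lt {u v : Fin m → Bool} (h : u < v) : weight u < weight v := by
  obtain ⟨hle, i, hi⟩ := Pi.lt_def.1 h
  refine Finset.card_lt_card ⟨fun j hj => ?_, fun hs => ?_⟩
  · have := hle j
    simp only [Finset.mem_filter, Finset.mem_univ, true_and] at hj ⊢
    rw [hj] at this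
    exact top_le_iff.1 this
  · rw [Bool.lt_iff] at hi
    have := hs (x := i) (by simp [hi.2])
    simp [hi.1] at this

open Classical in
/-- The largest number of changes of the value of `D` along a chain that ends in `v`. -/
def mindChanges (v : Fin m → Bool) : ℕ :=
  (Finset.univ.filter fun u => u < v).attach.sup fun u =>
    mindChanges u.1 + if D u.1 = D v then 0 else 1
  termination_by weight v
  decreasing_by exact weight_lt (Finset.mem_filter.1 u.2).2

theorem mindChanges_le_of_lt {u v : Fin m → Bool} (h : u < v) :
    mindChanges D u + (if D u = D v then 0 else 1) ≤ mindChanges D v := by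
  rw [mindChanges.eq_def D v]
  classical
  exact Finset.le_sup (f := fun u : {x // x ∈ Finset.univ.filter fun u => u < v} =>
    mindChanges D u.1 + if D u.1 = D v then 0 else 1)
    (Finset.mem_attach _ ⟨u, by simpa using h⟩)

/-- A chain that ends in `u` can be prolonged to any larger `v` without losing changes. This
monotonicity is what puts the threshold questions into NP. -/
theorem mindChanges_mono : Monotone (mindChanges D) := by
  intro u v h
  rcases h.eq_or_lt with rfl | h
  · rfl
  · exact (Nat.le_add_right _ _).trans (mindChanges_le_of_lt D h)

theorem exists_mindChanges_eq {v : Fin m → Bool} (hv : v ≠ ⊥) :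
    ∃ u < v, mindChanges D v = mindChanges D u + if D u = D v then 0 else 1 := by
  classical
  obtain ⟨u, -, hu⟩ := Finset.exists_mem_eq_sup
    (s := (Finset.univ.filter fun u => u < v).attach)
    (by rw [Finset.attach_nonempty_iff]; exact ⟨⊥, by simpa using bot_lt_iff_ne_bot.2 hv⟩)
    (fun u => mindChanges D u.1 + if D u.1 = D v then 0 else 1)
  refine ⟨u.1, (Finset.mem_filter.1 u.2).2, ?_⟩
  rw [mindChanges.eq_def D v, ← hu]

theorem mindChanges_bot : mindChanges D ⊥ = 0 := by
  rw [mindChanges.eq_def]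
  classical
  have : (Finset.univ.filter fun u : Fin m → Bool => u < ⊥) = ∅ := by simp
  rw [← Nat.le_zero, Finset.sup_le_iff]
  rintro ⟨u, hu⟩ -
  simp at hu

/-- Every change requires a strict increase in the chain, hence one more coordinate that is `true`.
-/
theorem mindChanges_le_weight (v : Fin m → Bool) : mindChanges D v ≤ weight v := by
  induction h : weight v using Nat.strong_induction_on generalizing v with
  | _ n ih =>
    subst h
    by_cases hv : v = ⊥
    · rw [hv, mindChanges_bot]; exact Nat.zero_le _
    · obtain ⟨u, hu, h⟩ := exists_mindChanges_eq D hv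
      have h₁ := weight_lt hu
      have h₂ := ih _ h₁ u rfl
      split_ifs at h <;> omega

theorem mindChanges_le (v : Fin m → Bool) : mindChanges D v ≤ m :=
  (mindChanges_le_weight D v).trans ((Finset.card_le_univ _).trans (by simp))

/-- An optimal chain can be peeled from its end: the last step contributes `1` exactly if `D`
changes there, and the part before it is optimal for its own endpoint. The descent stops only at
`⊥`, so the parity of the maximum compares `D v` with `D ⊥`. -/
theorem eq_xor_mindChanges (v : Fin m → Bool) :
    D v = (D ⊥ ^^ (mindChanges D v).bodd) := by
  induction h : weight v using Nat.strong_induction_on generalizing v with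
  | _ n ih =>
    subst h
    by_cases hv : v = ⊥
    · rw [hv, mindChanges_bot]; simp
    · obtain ⟨u, hu, h⟩ := exists_mindChanges_eq D hv
      have h₁ := ih _ (weight_lt hu) u rfl
      rw [h, Nat.bodd_add, ← Bool.xor_assoc, ← h₁]
      split_ifs with h₂
      · simp [h₂]
      · revert h₂; cases D u <;> cases D v <;> simp

end MindChanges

/-- The threshold that belongs to a sequence of search bits when `k` rounds are to be made. -/
def searchPos : ℕ → List Bool → ℕ
  | _, [] => 0
  | k, b :: l => (if b then 2 ^ k else 1) + searchPos (k - 1) l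

/-- A last bit that is put in superposition thus selects one of two thresholds. The bit found later
takes the same place and makes one of these thresholds the new offset: the upper one if the answers
agree, the lower one otherwise. -/
theorem searchPos_append (k : ℕ) (l : List Bool) (b : Bool) :
    searchPos k (l ++ [b]) = searchPos k l + if b then 2 ^ (k - l.length) else 1 := by
  induction l generalizing k with
  | nil => simp [searchPos]
  | cons a l ih =>
    simp only [List.cons_append, searchPos, ih, List.length_cons]
    rw [Nat.sub_sub, Nat.add_comm 1 l.length]
    omega

/-- The bits found in the first `r` rounds of the search: each tells whether the two answers given
by `Φ` agree. -/
def searchBits (Φ : List Bool → Bool) : ℕ → List Bool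
  | 0 => []
  | r + 1 => searchBits Φ r ++
      [!(Φ (searchBits Φ r ++ [false]) ^^ Φ (searchBits Φ r ++ [true]))]

theorem length_searchBits (Φ : List Bool → Bool) (r : ℕ) : (searchBits Φ r).length = r := by
  induction r with
  | zero => rfl
  | succ r ih => simp [searchBits, ih]

/-- The parity of the number of bits that are `false`. -/
def xorNot (l : List Bool) : Bool := l.foldr (fun b p => p ^^ !b) false

theorem xorNot_append (l : List Bool) (b : Bool) : xorNot (l ++ [b]) = (xorNot l ^^ !b) := by
  induction l with
  | nil => rfl
  | cons a l ih =>
    have : xorNot (a :: l ++ [b]) = (xorNot (l ++ [b]) ^^ !a) := rfl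
    rw [this, ih, show xorNot (a :: l) = (xorNot l ^^ !a) from rfl]
    cases xorNot l <;> cases a <;> cases b <;> rfl

theorem bodd_sub_of_even {a b : ℕ} (h : b ≤ a) (hb : b.bodd = false) : (a - b).bodd = a.bodd := by
  conv_rhs => rw [← Nat.sub_add_cancel h, Nat.bodd_add, hb, Bool.xor_false]

/-- Each round halves the range in which the difference of `n` and the offset lies. A found bit
`false` means a shift by `1`, a found bit `true` a shift by an even number, so the parity of `n` is
that of the number of bits `false`. -/
theorem xorNot_searchBits {k n : ℕ} (hn : n ≤ 2 ^ (k + 1) - 2) :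
    xorNot (searchBits (fun l => decide (searchPos k l ≤ n)) k) = n.bodd := by
  set Φ : List Bool → Bool := fun l => decide (searchPos k l ≤ n) with hΦ
  -- The invariant of the search. The truncated subtraction absorbs the case where the offset has
  -- passed `n`, and the minimum builds the range bound into the formula, so that neither is carried
  -- as a hypothesis. For `r = k` the bound is `0`.
  have key : ∀ r ≤ k, n.bodd = (xorNot (searchBits Φ r) ^^
      (min (n - searchPos k (searchBits Φ r)) (2 ^ (k - r + 1) - 2)).bodd) := by
    intro r
    induction r with
    | zero =>
      intro _
      simp only [searchBits, searchPos, Nat.sub_zero, min_eq_left hn]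
      simp [xorNot]
    | succ r ih =>
      intro hr
      rw [ih (by omega)]
      set l := searchBits Φ r with hl
      set s := searchPos k l with hs
      have hlen : l.length = r := length_searchBits _ _
      obtain ⟨j, hj⟩ : ∃ j, k - r = j + 1 := ⟨k - r - 1, by omega⟩
      have hp : ∀ b, searchPos k (l ++ [b]) = s + if b then 2 ^ (j + 1) else 1 := by
        intro b
        rw [searchPos_append, hlen, hj]
      have hΦf : Φ (l ++ [false]) = decide (s + 1 ≤ n) := by simp [hΦ, hp]
      have hΦt : Φ (l ++ [true]) = decide (s + 2 ^ (j + 1) ≤ n) := by simp [hΦ, hp]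
      have hbits : searchBits Φ (r + 1) = l ++ [!(Φ (l ++ [false]) ^^ Φ (l ++ [true]))] := rfl
      rw [hbits, xorNot_append, hp, hΦf, hΦt, Bool.xor_assoc, hj, show k - (r + 1) = j by omega]
      congr 1
      have hpow : 2 ^ (j + 1 + 1) = 2 * 2 ^ (j + 1) := by ring
      have hpos : 2 ≤ 2 ^ (j + 1) := by
        calc 2 = 2 ^ 1 := rfl
          _ ≤ 2 ^ (j + 1) := Nat.pow_le_pow_right (by norm_num) (by omega)
      have heven : (2 ^ (j + 1)).bodd = false := by
        rw [pow_succ, Nat.bodd_mul]; simp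
      rw [hpow]
      generalize 2 ^ (j + 1) = e at *
      by_cases h₁ : s + 1 ≤ n
      · by_cases h₂ : s + e ≤ n
        -- Both thresholds are reached: an even number `e` is subtracted.
        · simp only [h₁, h₂, decide_true, Bool.xor_self, Bool.not_false, if_true, Bool.not_true,
            Bool.false_xor]
          rw [show min (n - (s + e)) (e - 2) = min (n - s) (2 * e - 2) - e by omega,
            bodd_sub_of_even (by omega) heven]
        -- Only the lower threshold is reached: the remainder drops by `1`, and the found bit
        -- `false` accounts for the parity.
        · simp only [h₁, h₂, decide_true, decide_false, Bool.xor_false, Bool.not_true,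
            Bool.not_false, Bool.true_xor]
          rw [show min (n - s) (2 * e - 2) = min (n - (s + 1)) (e - 2) + 1 by omega, Nat.bodd_succ]
          simp
      -- No threshold is reached, so the remainder is already `0` and stays `0` when the offset
      -- overshoots `n`.
      · have h₂ : ¬ s + e ≤ n := by omega
        simp only [h₁, h₂, decide_false, Bool.xor_self, Bool.not_false, if_true, Bool.not_true,
          Bool.false_xor]
        congr 1
        omega
  have := key k le_rfl
  rw [this]
  simp

/-! ### Unitarity of machines that permute, mix one cell and move -/

namespace QOTM

variable (M : QOTM)

/-- Exchange of the two bits. -/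
def bitFlip (γ : M.Γ) : M.Γ := Equiv.swap (M.sym (some false)) (M.sym (some true)) γ

/-- `γ` is a bit. -/
def IsBit (γ : M.Γ) : Prop := γ = M.sym (some false) ∨ γ = M.sym (some true)

instance (γ : M.Γ) : Decidable (M.IsBit γ) := inferInstanceAs (Decidable (_ ∨ _))

/-- The diagonal entry of the Hadamard matrix at a bit, before normalization. -/
def bitSign (γ : M.Γ) : ℂ := if γ = M.sym (some true) then -1 else 1

theorem bitFlip_bitFlip (γ : M.Γ) : M.bitFlip (M.bitFlip γ) = γ := Equiv.swap_apply_self _ _ _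

theorem bitFlip_sym (b : Bool) : M.bitFlip (M.sym (some b)) = M.sym (some !b) := by
  cases b
  · exact Equiv.swap_apply_left _ _
  · exact Equiv.swap_apply_right _ _

theorem isBit_sym (b : Bool) : M.IsBit (M.sym (some b)) := by
  cases b
  · exact .inl rfl
  · exact .inr rfl

theorem isBit_iff {γ : M.Γ} : M.IsBit γ ↔ ∃ b, γ = M.sym (some b) := by
  simp [IsBit]

theorem isBit_bitFlip {γ : M.Γ} (h : M.IsBit γ) : M.IsBit (M.bitFlip γ) := by
  obtain ⟨b, rfl⟩ := M.isBit_iff.1 h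
  rw [bitFlip_sym]
  exact M.isBit_sym _

theorem bitSign_sym (b : Bool) : M.bitSign (M.sym (some b)) = if b then -1 else 1 := by
  cases b <;> simp [bitSign]

theorem bitSign_bitFlip {γ : M.Γ} (h : M.IsBit γ) :
    M.bitSign (M.bitFlip γ) = - M.bitSign γ := by
  obtain ⟨b, rfl⟩ := M.isBit_iff.1 h
  rw [bitFlip_sym, bitSign_sym, bitSign_sym]
  cases b <;> simp

/-- `1 / √2`. -/
def invSqrtTwo : ℂ := ((Real.sqrt 2 : ℝ) : ℂ)⁻¹

theorem invSqrtTwo_mul_self : invSqrtTwo * invSqrtTwo = 1 / 2 := by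
  rw [invSqrtTwo, ← mul_inv, ← Complex.ofReal_mul, Real.mul_self_sqrt (by norm_num)]
  norm_num

theorem norm_invSqrtTwo_sq : ‖invSqrtTwo‖ ^ 2 = 1 / 2 := by
  rw [sq, ← norm_mul, invSqrtTwo_mul_self]
  norm_num

theorem isAlgebraic_invSqrtTwo : IsAlgebraic ℚ invSqrtTwo := by
  have h : IsAlgebraic ℚ (invSqrtTwo ^ 2) := by
    rw [sq, invSqrtTwo_mul_self]
    have := isAlgebraic_algebraMap (R := ℚ) (A := ℂ) (1 / 2)
    simpa using this
  exact IsAlgebraic.of_pow (by norm_num) h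

/-- The amplitudes of a step: the local configuration `z` is entered, the bit under the head of the
query tape is subjected to a Hadamard transformation if `mix` says so, and the heads are moved by
`dir`. -/
def outVec (dir : M.Q → M.K → SignType) (mix : M.Q → Bool) (z : M.Q × (M.K → M.Γ)) :
    (M.Q × (M.K → M.Γ) × (M.K → SignType)) →₀ ℂ :=
  if mix z.1 = true ∧ M.IsBit (z.2 M.queryTape) then
    Finsupp.single (z.1, z.2, dir z.1) (M.bitSign (z.2 M.queryTape) * invSqrtTwo) +
      Finsupp.single (z.1, update z.2 M.queryTape (M.bitFlip (z.2 M.queryTape)), dir z.1)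
        invSqrtTwo
  else Finsupp.single (z.1, z.2, dir z.1) 1

/-- A presentation of the transition amplitudes by a permutation of the local configurations,
Hadamard transformations and movements. -/
structure Presentation where
  perm : Equiv.Perm (M.Q × (M.K → M.Γ))
  dir : M.Q → M.K → SignType
  mix : M.Q → Bool
  perm_pre : ∀ s, perm (M.preQuery, s) = (M.postQuery, s)
  dir_post : ∀ k, dir M.postQuery k = 0
  mix_post : mix M.postQuery = false
  δ_eq : ∀ q s a, M.δ q s a = M.outVec dir mix (perm (q, s)) a

variable {M}

theorem wordTape_injective : Injective M.wordTape := by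
  intro u v h
  refine List.ext_getElem? fun n => ?_
  have := M.sym.injective (congrFun h n)
  rwa [if_neg (by omega), if_neg (by omega), Int.toNat_natCast] at this

theorem oracleTape_wordTape (A : Language Bool) (u : List Bool) (b : Bool) :
    M.oracleTape A (M.wordTape (u ++ [b])) = M.wordTape (u ++ [xor (chi A u) b]) := by
  have h : ∃ p : List Bool × Bool, M.wordTape (u ++ [b]) = M.wordTape (p.1 ++ [p.2]) :=
    ⟨(u, b), rfl⟩
  have h' := List.append_inj' (wordTape_injective h.choose_spec) rfl
  have h₁ : h.choose.1 = u := h'.1.symm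
  have h₂ : h.choose.2 = b := (List.singleton_inj.1 h'.2).symm
  rw [oracleTape, dif_pos h, h₁, h₂]

theorem oracleTape_oracleTape (A : Language Bool) (t : ℤ → M.Γ) :
    M.oracleTape A (M.oracleTape A t) = t := by
  by_cases h : ∃ p : List Bool × Bool, t = M.wordTape (p.1 ++ [p.2])
  · obtain ⟨⟨u, b⟩, rfl⟩ := h
    rw [oracleTape_wordTape, oracleTape_wordTape, ← Bool.xor_assoc, Bool.xor_self, Bool.false_xor]
  · have : M.oracleTape A t = t := dif_neg h
    rw [this, this]

/-- The symbols under the heads. -/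
def Cfg.read (c : M.Cfg) : M.K → M.Γ := fun k => c.tape k (c.head k)

/-- Change of state and of the symbols under the heads. -/
def Cfg.write (c : M.Cfg) (z : M.Q × (M.K → M.Γ)) : M.Cfg where
  state := z.1
  head := c.head
  tape := fun k => update (c.tape k) (c.head k) (z.2 k)

theorem Cfg.write_write (c : M.Cfg) (z z' : M.Q × (M.K → M.Γ)) :
    (c.write z).write z' = c.write z' := by
  ext <;> simp [write]

theorem Cfg.read_write (c : M.Cfg) (z : M.Q × (M.K → M.Γ)) : (c.write z).read = z.2 := by
  funext k
  simp [read, write]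

theorem Cfg.write_read (c : M.Cfg) : c.write (c.state, c.read) = c := by
  ext <;> simp [write, read]

/-- The oracle acts on the configurations in the pre-query state. -/
def oracleEquiv (A : Language Bool) : Equiv.Perm M.Cfg :=
  Involutive.toPerm
    (fun c => if c.state = M.preQuery then
      { c with tape := update c.tape M.queryTape (M.oracleTape A (c.tape M.queryTape)) } else c)
    (by
      intro c
      by_cases h : c.state = M.preQuery
      · simp only [h, if_true]
        ext1
        · exact h.symm
        · rfl
        · simp [oracleTape_oracleTape]
      · simp only [h, if_false])

namespace Presentation

variable (P : M.Presentation)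

/-- The permutation of the configurations given by a permutation of local configurations. -/
def localEquiv : Equiv.Perm M.Cfg where
  toFun c := c.write (P.perm (c.state, c.read))
  invFun c := c.write (P.perm.symm (c.state, c.read))
  left_inv c := by
    have h : ((c.write (P.perm (c.state, c.read))).state,
        (c.write (P.perm (c.state, c.read))).read) = P.perm (c.state, c.read) := by
      rw [Cfg.read_write]; rfl
    simp only [h, Equiv.symm_apply_apply, Cfg.write_write, Cfg.write_read]
  right_inv c := by
    have h : ((c.write (P.perm.symm (c.state, c.read))).state,
        (c.write (P.perm.symm (c.state, c.read))).read) = P.perm.symm (c.state, c.read) := by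
      rw [Cfg.read_write]; rfl
    simp only [h, Equiv.apply_symm_apply, Cfg.write_write, Cfg.write_read]

/-- The movement of the heads. -/
def moveEquiv : Equiv.Perm M.Cfg where
  toFun c := { c with head := fun k => c.head k + (P.dir c.state k : ℤ) }
  invFun c := { c with head := fun k => c.head k - (P.dir c.state k : ℤ) }
  left_inv c := by ext <;> simp
  right_inv c := by ext <;> simp

/-- The configuration is subjected to a Hadamard transformation. -/
def Active (c : M.Cfg) : Prop := P.mix c.state = true ∧ M.IsBit (c.read M.queryTape)

instance (c : M.Cfg) : Decidable (P.Active c) := inferInstanceAs (Decidable (_ ∧ _))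

/-- Exchange of the bits under the head of the query tape. -/
def flip (c : M.Cfg) : M.Cfg :=
  if P.Active c then
    c.write (c.state, update c.read M.queryTape (M.bitFlip (c.read M.queryTape)))
  else c

variable {P}

theorem Active.flip_eq {c : M.Cfg} (h : P.Active c) : P.flip c =
    c.write (c.state, update c.read M.queryTape (M.bitFlip (c.read M.queryTape))) := if_pos h

theorem Active.read_flip {c : M.Cfg} (h : P.Active c) :
    (P.flip c).read = update c.read M.queryTape (M.bitFlip (c.read M.queryTape)) := by
  rw [h.flip_eq, Cfg.read_write]

theorem Active.state_flip {c : M.Cfg} (h : P.Active c) : (P.flip c).state = c.state := by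
  rw [h.flip_eq]; rfl

theorem Active.active_flip {c : M.Cfg} (h : P.Active c) : P.Active (P.flip c) := by
  refine ⟨?_, ?_⟩
  · rw [h.state_flip]; exact h.1
  · rw [h.read_flip, update_self]; exact M.isBit_bitFlip h.2

variable (P)

theorem flip_involutive : Involutive P.flip := by
  intro c
  by_cases h : P.Active c
  · rw [h.active_flip.flip_eq, h.read_flip, h.state_flip, h.flip_eq, Cfg.write_write,
      update_self, bitFlip_bitFlip, update_idem, update_eq_self, Cfg.write_read]
  · have : P.flip c = c := if_neg h
    rw [this, this]

theorem active_flip_iff (c : M.Cfg) : P.Active (P.flip c) ↔ P.Active c := by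
  refine ⟨fun h => ?_, fun h => h.active_flip⟩
  have := h.active_flip
  rwa [P.flip_involutive] at this

/-- The diagonal part of the Hadamard transformations. -/
def diagCoeff (c : M.Cfg) : ℂ :=
  if P.Active c then M.bitSign (c.read M.queryTape) * invSqrtTwo else 1

/-- The off-diagonal part of the Hadamard transformations. -/
def flipCoeff (c : M.Cfg) : ℂ := if P.Active c then invSqrtTwo else 0

/-- The Hadamard transformations. -/
def mixMap : Module.End ℂ M.Superposition :=
  Finsupp.linearCombination ℂ fun c =>
    Finsupp.single c (P.diagCoeff c) + Finsupp.single (P.flip c) (P.flipCoeff c)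

theorem mixMap_single (c : M.Cfg) : P.mixMap (Finsupp.single c 1) =
    Finsupp.single c (P.diagCoeff c) + Finsupp.single (P.flip c) (P.flipCoeff c) := by
  simp [mixMap]

/-- Since `flip` is an involution that preserves activity, amplitude flows into `c` from `c` and
`flip c` only. -/
theorem mixMap_apply (ψ : M.Superposition) (c : M.Cfg) :
    P.mixMap ψ c = P.diagCoeff c * ψ c + P.flipCoeff c * ψ (P.flip c) := by
  induction ψ using Finsupp.induction_linear with
  | zero => simp
  | add f g hf hg => simp only [map_add, Finsupp.add_apply, hf, hg]; ring
  | single d a =>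
    rw [show Finsupp.single d a = a • Finsupp.single d (1 : ℂ) by simp, map_smul, mixMap_single]
    simp only [Finsupp.smul_apply, Finsupp.add_apply, smul_eq_mul]
    have hfl : P.flip d = c ↔ d = P.flip c := by
      constructor <;> (rintro rfl; rw [P.flip_involutive])
    have e₁ : Finsupp.single d (P.diagCoeff d) c = P.diagCoeff c * Finsupp.single d (1 : ℂ) c := by
      by_cases h : d = c
      · subst h; simp
      · simp [h]
    have e₂ : Finsupp.single (P.flip d) (P.flipCoeff d) c =
        P.flipCoeff c * Finsupp.single d (1 : ℂ) (P.flip c) := by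
      by_cases h : d = P.flip c
      · subst h
        rw [P.flip_involutive]
        have : P.flipCoeff (P.flip c) = P.flipCoeff c := by
          simp only [flipCoeff, active_flip_iff]
        simp [this]
      · have h' : P.flip d ≠ c := fun e => h (hfl.1 e)
        simp [h, h']
    rw [e₁, e₂]; ring

theorem diagCoeff_flip {c : M.Cfg} (h : P.Active c) :
    P.diagCoeff (P.flip c) = - P.diagCoeff c := by
  rw [diagCoeff, diagCoeff, if_pos h.active_flip, if_pos h, h.read_flip, update_self,
    M.bitSign_bitFlip h.2, neg_mul]

theorem diagCoeff_mul_self {c : M.Cfg} (h : P.Active c) :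
    P.diagCoeff c * P.diagCoeff c = 1 / 2 := by
  rw [diagCoeff, if_pos h, mul_mul_mul_comm, invSqrtTwo_mul_self]
  obtain ⟨b, hb⟩ := M.isBit_iff.1 h.2
  rw [hb, bitSign_sym]
  cases b <;> simp

/-- A Hadamard transformation is its own inverse; this provides the surjectivity of the time
evolution. -/
theorem mixMap_mixMap (ψ : M.Superposition) : P.mixMap (P.mixMap ψ) = ψ := by
  ext c
  rw [mixMap_apply, mixMap_apply, mixMap_apply, P.flip_involutive]
  by_cases h : P.Active c
  · have e : P.flipCoeff (P.flip c) = invSqrtTwo := if_pos h.active_flip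
    have e' : P.flipCoeff c = invSqrtTwo := if_pos h
    rw [P.diagCoeff_flip h, e, e']
    linear_combination ψ c * P.diagCoeff_mul_self h + ψ c * invSqrtTwo_mul_self
  · simp [diagCoeff, flipCoeff, h]

end Presentation

/-- A sum over all configurations, unlike one over the support, can be reindexed by permutations. -/
theorem normSq_eq_tsum (ψ : M.Superposition) : M.normSq ψ = ∑' c, ‖ψ c‖ ^ 2 := by
  rw [tsum_eq_sum (s := ψ.support)]
  · rfl
  · intro c hc
    rw [Finsupp.notMem_support_iff.1 hc]
    simp

theorem summable_normSq (ψ : M.Superposition) : Summable fun c => ‖ψ c‖ ^ 2 := by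
  refine summable_of_ne_finset_zero (s := ψ.support) fun c hc => ?_
  rw [Finsupp.notMem_support_iff.1 hc]
  simp

theorem normSq_mapDomain (e : Equiv.Perm M.Cfg) (ψ : M.Superposition) :
    M.normSq (Finsupp.mapDomain e ψ) = M.normSq ψ := by
  rw [normSq_eq_tsum, normSq_eq_tsum, ← e.tsum_eq]
  simp [Finsupp.mapDomain_apply e.injective]

namespace Presentation

variable (P : M.Presentation)

/-- The configurations `c` and `flip c` are treated together: on an active pair the map is a `2 × 2`
Hadamard matrix, which preserves the norm by the parallelogram law. Summing over all `c` counts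
everything twice. -/
theorem normSq_mixMap (ψ : M.Superposition) : M.normSq (P.mixMap ψ) = M.normSq ψ := by
  have hinv := P.flip_involutive
  have hs : ∀ φ : M.Superposition, Summable fun c => ‖φ (P.flip c)‖ ^ 2 := fun φ =>
    (hinv.toPerm.summable_iff (f := fun c => ‖φ c‖ ^ 2)).2 (summable_normSq φ)
  have h : ∀ φ : M.Superposition,
      ∑' c, (‖φ c‖ ^ 2 + ‖φ (P.flip c)‖ ^ 2) = 2 * M.normSq φ := by
    intro φ
    rw [(summable_normSq φ).tsum_add (hs φ), ← normSq_eq_tsum, two_mul]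
    congr 1
    rw [normSq_eq_tsum]
    exact hinv.toPerm.tsum_eq fun c => ‖φ c‖ ^ 2
  have key : ∀ c, ‖P.mixMap ψ c‖ ^ 2 + ‖P.mixMap ψ (P.flip c)‖ ^ 2 =
      ‖ψ c‖ ^ 2 + ‖ψ (P.flip c)‖ ^ 2 := by
    intro c
    rw [mixMap_apply, mixMap_apply, hinv]
    by_cases hc : P.Active c
    · have e : P.flipCoeff (P.flip c) = invSqrtTwo := if_pos hc.active_flip
      have e' : P.flipCoeff c = invSqrtTwo := if_pos hc
      rw [P.diagCoeff_flip hc, e, e', diagCoeff, if_pos hc]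
      obtain ⟨b, hb⟩ := M.isBit_iff.1 hc.2
      rw [hb, bitSign_sym]
      have hpar := parallelogram_law_with_norm ℝ (ψ c) (ψ (P.flip c))
      have hn := norm_invSqrtTwo_sq
      cases b
      · rw [show (if false = true then (-1 : ℂ) else 1) * invSqrtTwo * ψ c +
            invSqrtTwo * ψ (P.flip c) = invSqrtTwo * (ψ c + ψ (P.flip c)) by simp; ring,
          show -((if false = true then (-1 : ℂ) else 1) * invSqrtTwo) * ψ (P.flip c) +
            invSqrtTwo * ψ c = invSqrtTwo * (ψ c - ψ (P.flip c)) by simp; ring,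
          norm_mul, norm_mul, mul_pow, mul_pow, hn]
        linarith
      · rw [show (if true = true then (-1 : ℂ) else 1) * invSqrtTwo * ψ c +
            invSqrtTwo * ψ (P.flip c) = -(invSqrtTwo * (ψ c - ψ (P.flip c))) by simp; ring,
          show -((if true = true then (-1 : ℂ) else 1) * invSqrtTwo) * ψ (P.flip c) +
            invSqrtTwo * ψ c = invSqrtTwo * (ψ c + ψ (P.flip c)) by simp; ring,
          norm_neg, norm_mul, norm_mul, mul_pow, mul_pow, hn]
        linarith
    · have hf : P.flip c = c := if_neg hc
      rw [hf]
      simp [diagCoeff, flipCoeff, hc]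
  have h₁ := h (P.mixMap ψ)
  have h₂ := h ψ
  simp only [key] at h₁
  linarith

/-- The step from a configuration outside the pre-query state. -/
theorem stepVec_eq (A : Language Bool) {c : M.Cfg} (hc : c.state ≠ M.preQuery) :
    M.stepVec A c =
      Finsupp.mapDomain (M.act c) (M.outVec P.dir P.mix (P.perm (c.state, c.read))) := by
  rw [stepVec, if_neg hc, Finsupp.mapDomain, Finsupp.sum_fintype _ _ (by simp)]
  refine Finset.sum_congr rfl fun a _ => ?_
  rw [P.δ_eq]
  rfl

/-- The basis of unitarity: all four factors are invertible and preserve the norm. In the pre-query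
state the oracle involution does the work and the other factors only change the state to
`postQuery`; in all other states the oracle factor is the identity. -/
theorem evolve_eq (A : Language Bool) (ψ : M.Superposition) :
    M.evolve A ψ = Finsupp.mapDomain P.moveEquiv (P.mixMap (Finsupp.mapDomain P.localEquiv
      (Finsupp.mapDomain (oracleEquiv A) ψ))) := by
  suffices h : M.evolve A = Finsupp.lmapDomain ℂ ℂ P.moveEquiv ∘ₗ P.mixMap ∘ₗ
      Finsupp.lmapDomain ℂ ℂ P.localEquiv ∘ₗ Finsupp.lmapDomain ℂ ℂ (oracleEquiv A) from
    LinearMap.congr_fun h ψ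
  refine Finsupp.lhom_ext' fun c => LinearMap.ext_ring ?_
  simp only [LinearMap.comp_apply, Finsupp.lsingle_apply, Finsupp.lmapDomain_apply,
    Finsupp.mapDomain_single, mixMap_single, Finsupp.mapDomain_add]
  rw [evolve, Finsupp.linearCombination_single, one_smul]
  by_cases hc : c.state = M.preQuery
  · have h₁ : P.localEquiv (oracleEquiv A c) = M.oracleCfg A c := by
      have ho : oracleEquiv A c = Cfg.mk c.state c.head
          (update c.tape M.queryTape (M.oracleTape A (c.tape M.queryTape))) := if_pos hc
      rw [ho]
      simp only [localEquiv, Equiv.coe_fn_mk, hc, P.perm_pre]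
      ext1
      · rfl
      · rfl
      · funext k
        simp [Cfg.write, oracleCfg, Cfg.read]
    have h₂ : ¬ P.Active (M.oracleCfg A c) := by
      rintro ⟨h, -⟩
      rw [show (M.oracleCfg A c).state = M.postQuery from rfl, P.mix_post] at h
      cases h
    have h₃ : P.moveEquiv (M.oracleCfg A c) = M.oracleCfg A c := by
      simp [moveEquiv, oracleCfg, P.dir_post]
    rw [h₁, diagCoeff, flipCoeff, if_neg h₂, if_neg h₂, h₃, stepVec, if_pos hc]
    simp
  · have ho : oracleEquiv A c = c := if_neg hc
    rw [ho, P.stepVec_eq A hc, outVec]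
    have hl : P.localEquiv c = c.write (P.perm (c.state, c.read)) := rfl
    set z := P.perm (c.state, c.read)
    have hact : P.Active (P.localEquiv c) ↔ P.mix z.1 = true ∧ M.IsBit (z.2 M.queryTape) := by
      rw [hl, Active, Cfg.read_write]; rfl
    have hmv : ∀ z' : M.Q × (M.K → M.Γ), P.moveEquiv (c.write z') =
        M.act c (z'.1, z'.2, P.dir z'.1) := fun _ => rfl
    by_cases h : P.Active (P.localEquiv c)
    · rw [if_pos (hact.1 h), diagCoeff, flipCoeff, if_pos h, if_pos h, h.flip_eq, hl,
        Cfg.read_write, Cfg.write_write, hmv, hmv, Finsupp.mapDomain_add,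
        Finsupp.mapDomain_single, Finsupp.mapDomain_single]
      rfl
    · rw [if_neg (fun h' => h (hact.2 h')), diagCoeff, flipCoeff, if_neg h, if_neg h, hl, hmv,
        Finsupp.mapDomain_single]
      simp

theorem wellFormed (P : M.Presentation) : M.WellFormed := by
  intro A
  refine ⟨fun ψ => ?_, fun ψ => ?_⟩
  · rw [P.evolve_eq, normSq_mapDomain, P.normSq_mixMap, normSq_mapDomain, normSq_mapDomain]
  · refine ⟨Finsupp.mapDomain (oracleEquiv A).symm (Finsupp.mapDomain P.localEquiv.symm
      (P.mixMap (Finsupp.mapDomain P.moveEquiv.symm ψ))), ?_⟩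
    rw [P.evolve_eq]
    have h : ∀ (e : Equiv.Perm M.Cfg) (φ : M.Superposition),
        Finsupp.mapDomain e (Finsupp.mapDomain e.symm φ) = φ := fun e φ => by
      rw [← Finsupp.mapDomain_comp, Equiv.self_comp_symm, Finsupp.mapDomain_id]
    rw [h, h, P.mixMap_mixMap, h]

theorem algebraicAmplitudes (P : M.Presentation) : M.AlgebraicAmplitudes := by
  have h0 : IsAlgebraic ℚ (0 : ℂ) := isAlgebraic_zero
  have h1 : IsAlgebraic ℚ (1 : ℂ) := isAlgebraic_one
  have hs : ∀ (x y : M.Q × (M.K → M.Γ) × (M.K → SignType)) (u : ℂ), IsAlgebraic ℚ u →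
      IsAlgebraic ℚ (Finsupp.single x u y) := by
    intro x y u hu
    rw [Finsupp.single_apply]
    split_ifs
    · exact hu
    · exact h0
  intro q s a
  rw [P.δ_eq, outVec]
  split_ifs with h
  · rw [Finsupp.add_apply]
    refine IsAlgebraic.add (hs _ _ _ (IsAlgebraic.mul ?_ isAlgebraic_invSqrtTwo))
      (hs _ _ _ isAlgebraic_invSqrtTwo)
    rw [bitSign]
    split_ifs
    · exact h1.neg
    · exact h1
  · exact hs _ _ _ h1

end Presentation

end QOTM

/-- A functional and injective relation on a finite type extends to a permutation. -/
theorem exists_perm_of_rel {α : Type} [Finite α] (R : α → α → Prop)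
    (hf : ∀ a b b', R a b → R a b' → b = b') (hi : ∀ a a' b, R a b → R a' b → a = a') :
    ∃ e : Equiv.Perm α, ∀ a b, R a b → e a = b := by
  classical
  have := Fintype.ofFinite α
  let f : {a // ∃ b, R a b} → {b // ∃ a, R a b} := fun a =>
    ⟨a.2.choose, a.1, a.2.choose_spec⟩
  have hbij : Bijective f := by
    refine ⟨fun a a' h => Subtype.ext ?_, fun b => ?_⟩
    · have h' : a.2.choose = a'.2.choose := congrArg Subtype.val h
      exact hi _ _ _ a.2.choose_spec (h' ▸ a'.2.choose_spec)
    · obtain ⟨b, a, h⟩ := b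
      refine ⟨⟨a, b, h⟩, Subtype.ext ?_⟩
      exact hf _ _ _ (Exists.choose_spec (⟨b, h⟩ : ∃ b, R a b)) h
  refine ⟨(Equiv.ofBijective f hbij).extendSubtype, fun a b h => ?_⟩
  rw [Equiv.extendSubtype_apply_of_mem _ _ ⟨b, h⟩]
  exact hf _ _ _ (Exists.choose_spec (⟨b, h⟩ : ∃ b, R a b)) h

/-! ### Computation paths, and evolution of basis states up to a phase -/

namespace QOTM

variable {M : QOTM} {A : Language Bool}

theorem evolve_single (c : M.Cfg) (a : ℂ) :
    M.evolve A (Finsupp.single c a) = a • M.stepVec A c := by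
  simp [evolve]

/-- On every computation path of at most `n` steps that starts in `S` there are at most `j` queries
and no configuration in the final state before step `n`, and after `n` steps `S'` is reached. -/
def Leads (A : Language Bool) (n j : ℕ) (S S' : Set M.Cfg) : Prop :=
  ∀ (m : ℕ) (γ : ℕ → M.Cfg), m ≤ n → γ 0 ∈ S →
    (∀ t < m, M.stepVec A (γ t) (γ (t + 1)) ≠ 0) →
    (m = n → γ m ∈ S') ∧ (m < n → (γ m).state ≠ M.final) ∧
      ((Finset.range m).filter fun t => (γ t).state = M.preQuery).card ≤ j

theorem Leads.refl (S : Set M.Cfg) : Leads A 0 0 S S := by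
  intro m γ hm h0 _
  obtain rfl : m = 0 := by omega
  simpa using h0

theorem Leads.trans {n j n' j' : ℕ} {S S' S'' : Set M.Cfg} (h : Leads A n j S S')
    (h' : Leads A n' j' S' S'') : Leads A (n + n') (j + j') S S'' := by
  intro m γ hm h0 hγ
  by_cases hmn : m < n
  · obtain ⟨-, h₂, h₃⟩ := h m γ hmn.le h0 hγ
    exact ⟨by omega, fun _ => h₂ hmn, by omega⟩
  · obtain ⟨d, rfl⟩ := Nat.exists_eq_add_of_le (not_lt.1 hmn)
    obtain ⟨h₁, -, h₃⟩ := h n γ le_rfl h0 fun t ht => hγ t (by omega)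
    obtain ⟨g₁, g₂, g₃⟩ := h' d (fun t => γ (n + t)) (by omega) (h₁ rfl)
      fun t ht => hγ (n + t) (by omega)
    refine ⟨fun e => g₁ (by omega), fun e => g₂ (by omega), ?_⟩
    rw [Finset.range_eq_Ico, ← Finset.Ico_union_Ico_eq_Ico (Nat.zero_le n) (Nat.le_add_right n d),
      Finset.filter_union]
    refine (Finset.card_union_le _ _).trans (Nat.add_le_add (by rwa [← Finset.range_eq_Ico]) ?_)
    refine le_trans (le_of_eq ?_) g₃
    rw [Finset.range_eq_Ico]
    refine (Finset.card_bij (fun t _ => n + t) ?_ ?_ ?_).symm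
    · intro t ht
      simp only [Finset.mem_filter, Finset.mem_Ico] at ht ⊢
      exact ⟨by omega, ht.2⟩
    · intro t _ t' _ e
      omega
    · intro t ht
      simp only [Finset.mem_filter, Finset.mem_Ico] at ht
      refine ⟨t - n, ?_, by omega⟩
      simp only [Finset.mem_filter, Finset.mem_Ico]
      refine ⟨by omega, ?_⟩
      rw [show n + (t - n) = t by omega]
      exact ht.2

theorem Leads.of_stepVec {j : ℕ} {S S' : Set M.Cfg} (hfin : ∀ c ∈ S, c.state ≠ M.final)
    (hpre : j = 0 → ∀ c ∈ S, c.state ≠ M.preQuery)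
    (hstep : ∀ c ∈ S, ∀ c', M.stepVec A c c' ≠ 0 → c' ∈ S') : Leads A 1 j S S' := by
  intro m γ hm h0 hγ
  obtain rfl | rfl : m = 0 ∨ m = 1 := by omega
  · exact ⟨by omega, fun _ => hfin _ h0, by simp⟩
  · refine ⟨fun _ => hstep _ h0 _ (hγ 0 (by omega)), by omega, ?_⟩
    obtain rfl | hj := Nat.eq_zero_or_pos j
    · simp [Finset.filter_singleton, hpre rfl _ h0]
    · exact (Finset.card_filter_le _ _).trans (by rw [Finset.card_range]; exact hj)

/-- The converse may fail by interference, so a property of all paths is stronger than one of all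
supports. Halting and the query bound can therefore both be read off from paths. -/
theorem exists_path {x : List Bool} (t : ℕ) {c : M.Cfg} (hc : c ∈ (M.run A x t).support) :
    ∃ γ : ℕ → M.Cfg, γ 0 = M.init x ∧ (∀ u < t, M.stepVec A (γ u) (γ (u + 1)) ≠ 0) ∧ γ t = c := by
  induction t generalizing c with
  | zero =>
    have : c = M.init x := by
      have h : M.run A x 0 = Finsupp.single (M.init x) 1 := rfl
      rw [h] at hc
      simpa using hc
    exact ⟨fun _ => c, this, by simp, rfl⟩
  | succ t ih =>
    have h : M.run A x (t + 1) = M.evolve A (M.run A x t) := by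
      rw [run, pow_succ', Module.End.mul_apply, run]
    rw [h, evolve, Finsupp.linearCombination_apply, Finsupp.mem_support_iff, Finsupp.sum,
      Finsupp.finsetSum_apply] at hc
    obtain ⟨c', hc', hne⟩ := Finset.exists_ne_zero_of_sum_ne_zero hc
    obtain ⟨γ, h₀, h₁, h₂⟩ := ih hc'
    refine ⟨fun u => if u ≤ t then γ u else c, by simp [h₀], fun u hu => ?_, by simp⟩
    by_cases hut : u = t
    · subst hut
      simp only [le_refl, if_true, show ¬ u + 1 ≤ u by omega, if_false, h₂]
      intro h0
      exact hne (by simp [h0])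
    · simp only [show u ≤ t by omega, show u + 1 ≤ t by omega, if_true]
      exact h₁ u (by omega)

theorem Leads.haltsAt {n j : ℕ} {x : List Bool} {S : Set M.Cfg}
    (h : Leads A n j {M.init x} S) (hS : ∀ c ∈ S, c.state = M.final) : M.HaltsAt A x n := by
  refine ⟨fun c hc => ?_, fun t ht c hc => ?_⟩
  · obtain ⟨γ, h₀, h₁, rfl⟩ := exists_path n hc
    exact hS _ ((h n γ le_rfl h₀ h₁).1 rfl)
  · obtain ⟨γ, h₀, h₁, rfl⟩ := exists_path t hc
    exact (h t γ ht.le h₀ h₁).2.1 ht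

theorem Leads.queriesAtMost {n j : ℕ} {x : List Bool} {S : Set M.Cfg}
    (h : Leads A n j {M.init x} S) : M.QueriesAtMost A x n j :=
  fun γ h₀ h₁ => (h n γ le_rfl h₀ h₁).2.2

/-- After `n` steps the basis state `c` has become `c'`, up to a phase. -/
def Becomes (A : Language Bool) (n : ℕ) (c c' : M.Cfg) : Prop :=
  ∃ a : ℂ, ‖a‖ = 1 ∧ (M.evolve A ^ n) (Finsupp.single c 1) = Finsupp.single c' a

theorem Becomes.refl (c : M.Cfg) : Becomes A 0 c c := ⟨1, by simp, rfl⟩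

theorem Becomes.trans {n n' : ℕ} {c c' c'' : M.Cfg} (h : Becomes A n c c')
    (h' : Becomes A n' c' c'') : Becomes A (n + n') c c'' := by
  obtain ⟨a, ha, h⟩ := h
  obtain ⟨b, hb, h'⟩ := h'
  refine ⟨a * b, by simp [ha, hb], ?_⟩
  rw [Nat.add_comm, pow_add, Module.End.mul_apply, h,
    show Finsupp.single c' a = a • Finsupp.single c' (1 : ℂ) by simp, map_smul, h']
  simp

theorem Becomes.of_stepVec {c c' : M.Cfg} (h : M.stepVec A c = Finsupp.single c' 1) :
    Becomes A 1 c c' := ⟨1, by simp, by simp [evolve_single, h]⟩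

theorem Becomes.acceptProb_eq {n : ℕ} {x : List Bool} {c : M.Cfg} (h : Becomes A n (M.init x) c) :
    M.acceptProb (M.run A x n) = if c.tape M.outputTape 0 = M.sym (some true) then 1 else 0 := by
  obtain ⟨a, ha, h⟩ := h
  rw [run, h, acceptProb, Finsupp.sum_single_index (by simp)]
  simp [ha]

end QOTM

/-- Appending a bit to the word on a tape. -/
theorem update_length_tape {G : Type} (f : Option Bool → G) (v : List Bool) (b : Bool) :
    update (fun z : ℤ => f (if z < 0 then none else v[z.toNat]?)) v.length (f (some b)) =
      fun z => f (if z < 0 then none else (v ++ [b])[z.toNat]?) := by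
  funext z
  by_cases hz : z = v.length
  · subst hz
    rw [update_self, if_neg (by omega)]
    simp
  · rw [update_of_ne hz]
    by_cases h0 : z < 0
    · rw [if_pos h0, if_pos h0]
    · rw [if_neg h0, if_neg h0]
      congr 1
      rcases Nat.lt_or_ge z.toNat v.length with h | h
      · rw [List.getElem?_append_left h]
      · rw [List.getElem?_eq_none h, List.getElem?_eq_none (by simp; omega)]

/-! ### Steps that affect only the query tape and the output tape -/

namespace QOTM

variable {M : QOTM} {A : Language Bool}

theorem wordTape_apply {v : List Bool} {n : ℕ} (h : n < v.length) :
    M.wordTape v n = M.sym (some v[n]) := by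
  simp [wordTape, h]

theorem wordTape_length (v : List Bool) : M.wordTape v v.length = M.sym none := by
  simp [wordTape]

theorem update_wordTape (v : List Bool) {n : ℕ} (h : n < v.length) (b : Bool) :
    update (M.wordTape v) n (M.sym (some b)) = M.wordTape (v.set n b) := by
  funext z
  by_cases hz : z = n
  · subst hz
    simp [wordTape, h]
  · rw [update_of_ne hz, wordTape, wordTape]
    by_cases h0 : z < 0
    · rw [if_pos h0, if_pos h0]
    · rw [if_neg h0, if_neg h0, List.getElem?_set_ne (by omega)]

theorem update_wordTape_length (v : List Bool) (b : Bool) :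
    update (M.wordTape v) v.length (M.sym (some b)) = M.wordTape (v ++ [b]) :=
  update_length_tape M.sym v b

theorem Presentation.stepVec_of_not_mix (P : M.Presentation) {c : M.Cfg}
    (hc : c.state ≠ M.preQuery) {z : M.Q × (M.K → M.Γ)} (hp : P.perm (c.state, c.read) = z)
    (hm : P.mix z.1 = false) :
    M.stepVec A c = Finsupp.single (M.act c (z.1, z.2, P.dir z.1)) 1 := by
  rw [P.stepVec_eq A hc, hp, outVec, if_neg (by simp [hm]), Finsupp.mapDomain_single]

/-- The configuration that arises from `c` by changing the state, the contents and the head position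
of the query tape and the symbol under the head of the output tape. -/
def Cfg.set (c : M.Cfg) (q : M.Q) (τ : ℤ → M.Γ) (i : ℤ) (o : M.Γ) : M.Cfg where
  state := q
  head := update c.head M.queryTape i
  tape := update (update c.tape M.queryTape τ) M.outputTape
    (update (c.tape M.outputTape) (c.head M.outputTape) o)

/-- The symbols under the heads, with those on the query tape and the output tape replaced. -/
def Cfg.loc (c : M.Cfg) (y o : M.Γ) : M.K → M.Γ :=
  update (update c.read M.queryTape y) M.outputTape o

section Set

variable (c : M.Cfg)

theorem Cfg.loc_output (y o : M.Γ) : c.loc y o M.outputTape = o := update_self _ _ _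

theorem Cfg.loc_of_ne {k : M.K} (h : k ≠ M.queryTape) (h' : k ≠ M.outputTape) (y o : M.Γ) :
    c.loc y o k = c.read k := by
  rw [Cfg.loc, update_of_ne h', update_of_ne h]

theorem Cfg.set_tape_output (q : M.Q) (τ : ℤ → M.Γ) (i : ℤ) (o : M.Γ) :
    (c.set q τ i o).tape M.outputTape (c.head M.outputTape) = o := by
  simp [Cfg.set]

theorem Cfg.loc_query (hqo : M.queryTape ≠ M.outputTape) (y o : M.Γ) :
    c.loc y o M.queryTape = y := by
  rw [Cfg.loc, update_of_ne hqo, update_self]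

theorem Cfg.update_loc (hqo : M.queryTape ≠ M.outputTape) (y y' o : M.Γ) :
    update (c.loc y o) M.queryTape y' = c.loc y' o := by
  rw [Cfg.loc, Cfg.loc, update_comm hqo.symm, update_idem]

theorem Cfg.read_set (hqo : M.queryTape ≠ M.outputTape) (q : M.Q)
    (τ : ℤ → M.Γ) (i : ℤ) (o : M.Γ) :
    (c.set q τ i o).read = c.loc (τ i) o := by
  funext k
  by_cases h : k = M.outputTape
  · subst h
    simp [read, Cfg.set, Cfg.loc, hqo.symm]
  · by_cases h' : k = M.queryTape
    · subst h'
      simp [read, Cfg.set, Cfg.loc, hqo]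
    · simp [read, Cfg.set, Cfg.loc, h, h']

theorem act_set (hqo : M.queryTape ≠ M.outputTape) {d : M.K → SignType}
    (hd : ∀ k, k ≠ M.queryTape → d k = 0) (q q' : M.Q)
    (τ : ℤ → M.Γ) (i : ℤ) (y o o' : M.Γ) :
    M.act (c.set q τ i o) (q', c.loc y o', d) =
      c.set q' (update τ i y) (i + (d M.queryTape : ℤ)) o' := by
  ext1
  · rfl
  · funext k
    by_cases h' : k = M.queryTape
    · subst h'
      simp [act, Cfg.set]
    · simp [act, Cfg.set, h', hd]
  · funext k
    by_cases h : k = M.outputTape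
    · subst h
      simp [act, Cfg.set, Cfg.loc, hqo.symm]
    · by_cases h' : k = M.queryTape
      · subst h'
        simp [act, Cfg.set, Cfg.loc, hqo]
      · simp [act, Cfg.set, Cfg.loc, h, h', Cfg.read]

theorem oracleCfg_set (hqo : M.queryTape ≠ M.outputTape) (q : M.Q)
    (τ : ℤ → M.Γ) (i : ℤ) (o : M.Γ) :
    M.oracleCfg A (c.set q τ i o) = c.set M.postQuery (M.oracleTape A τ) i o := by
  ext1
  · rfl
  · rfl
  · change update (c.set q τ i o).tape M.queryTape _ = _
    simp [Cfg.set, update_comm hqo]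

namespace Presentation

variable (P : M.Presentation)

theorem stepVec_set_of_not_mix (hqo : M.queryTape ≠ M.outputTape) {q q' : M.Q}
    (hq : q ≠ M.preQuery) (hd : ∀ k, k ≠ M.queryTape → P.dir q' k = 0) {τ : ℤ → M.Γ} {i : ℤ}
    {y o o' : M.Γ} (hperm : P.perm (q, c.loc (τ i) o) = (q', c.loc y o'))
    (hm : P.mix q' = false) :
    M.stepVec A (c.set q τ i o) =
      Finsupp.single (c.set q' (update τ i y) (i + (P.dir q' M.queryTape : ℤ)) o') 1 := by
  rw [P.stepVec_of_not_mix (c := c.set q τ i o) hq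
    (z := (q', c.loc y o')) (by rw [c.read_set hqo]; exact hperm) hm,
    act_set c hqo hd]

theorem stepVec_set_of_mix (hqo : M.queryTape ≠ M.outputTape) {q q' : M.Q}
    (hq : q ≠ M.preQuery) (hd : ∀ k, k ≠ M.queryTape → P.dir q' k = 0) {τ : ℤ → M.Γ} {i : ℤ}
    {y o o' : M.Γ} (hperm : P.perm (q, c.loc (τ i) o) = (q', c.loc y o'))
    (hm : P.mix q' = true) {b : Bool} (hb : y = M.sym (some b)) :
    M.stepVec A (c.set q τ i o) =
      Finsupp.single (c.set q' (update τ i (M.sym (some b)))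
        (i + (P.dir q' M.queryTape : ℤ)) o') ((if b then -1 else 1) * invSqrtTwo) +
      Finsupp.single (c.set q' (update τ i (M.sym (some !b)))
        (i + (P.dir q' M.queryTape : ℤ)) o') invSqrtTwo := by
  subst hb
  rw [P.stepVec_eq A (c := c.set q τ i o) hq, c.read_set hqo,
    show (c.set q τ i o).state = q from rfl, hperm, outVec]
  simp only [c.loc_query hqo]
  rw [if_pos ⟨hm, M.isBit_sym b⟩, bitSign_sym, bitFlip_sym, c.update_loc hqo,
    Finsupp.mapDomain_add, Finsupp.mapDomain_single, Finsupp.mapDomain_single,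
    act_set c hqo hd, act_set c hqo hd]

end Presentation

end Set

end QOTM

/-! ### The machine that prepares a query word classically and then runs Deutsch's algorithm -/

/-- The states of the quantum part of the computation, with `k` rounds. -/
inductive RoundState (k : ℕ)
  | ready (r : Fin (k + 1))
  | extend (r : Fin k)
  | ask (r : Fin k)
  | pre
  | post
  | undo (r : Fin k)
  | scan (i : Fin (k + 2)) (p : Bool)
  | final
  deriving DecidableEq, Fintype

namespace RoundState

variable {k : ℕ}

/-- The movement of the head of the query tape when the state is entered. -/
def move : RoundState k → SignType
  | ready r => if r = 0 then 0 else 1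
  | extend _ => 1
  | undo _ => -1
  | scan _ _ => -1
  | _ => 0

/-- Entering the state causes a Hadamard transformation. -/
def mixes : RoundState k → Bool
  | ready r => decide (r ≠ 0)
  | extend _ => true
  | ask _ => true
  | undo _ => true
  | _ => false

/-- The transitions of the quantum part, in terms of the symbols on the query tape and on the output
tape: in every round a cell of the query tape is appended, the oracle is called, and the
Hadamard transformations are repeated; at the end the parity of the bits is determined. -/
inductive Trans {Γ : Type} (sym : Option Bool ↪ Γ) (mark : Fin k → Γ) :
    RoundState k × Γ × Γ → RoundState k × Γ × Γ → Prop
  | ready (r : Fin (k + 1)) (r' : Fin k) (h : (r : ℕ) = r') (y o : Γ) :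
    Trans sym mark (ready r, y, o) (extend r', y, o)
  | extend (r : Fin k) (o : Γ) :
    Trans sym mark (extend r, sym none, o) (ask r, sym (some true), o)
  | ask (r : Fin k) (y : Γ) : Trans sym mark (ask r, y, sym none) (pre, y, mark r)
  | pre (y o : Γ) : Trans sym mark (pre, y, o) (post, y, o)
  | post (r : Fin k) (y : Γ) : Trans sym mark (post, y, mark r) (undo r, y, sym none)
  | undo (r : Fin k) (r' : Fin (k + 1)) (h : (r' : ℕ) = r + 1) (y o : Γ) :
    Trans sym mark (undo r, y, o) (ready r', y, o)
  | done (r : Fin (k + 1)) (h : (r : ℕ) = k) (i : Fin (k + 2)) (h' : (i : ℕ) = 0) (y o : Γ) :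
    Trans sym mark (ready r, y, o) (scan i false, y, o)
  | scan (j j' : Fin (k + 2)) (h : (j' : ℕ) = j + 1) (p p' b : Bool) (h'' : p' = (p ^^ !b)) (o : Γ) :
    Trans sym mark (scan j p, sym (some b), o) (scan j' p', sym (some b), o)
  | halt (i : Fin (k + 2)) (h : (i : ℕ) = k + 1) (p : Bool) (y : Γ) :
    Trans sym mark (scan i p, y, sym none) (final, y, sym (some !p))

namespace Trans

variable {Γ : Type} {sym : Option Bool ↪ Γ} {mark : Fin k → Γ} {a a' b b' : RoundState k × Γ × Γ}

theorem functional (hm : Injective mark) (h : Trans sym mark a b) (h' : Trans sym mark a b') :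
    b = b' := by
  have hs := sym.injective
  generalize ha : a = a₀ at h'
  cases h <;> cases h' <;> grind [Injective, Fin.ext_iff]

/-- Each transition leaves enough to undo it. The round number survives the query as `mark r` on the
output tape, because the pre-query and post-query states are shared by all rounds. A scanned bit
stays on the tape, so the old parity can be recovered, and number `0` distinguishes the beginning of
the scan from its continuation. -/
theorem injective (hm : Injective mark) (h : Trans sym mark a b) (h' : Trans sym mark a' b) :
    a = a' := by
  have hs := sym.injective
  generalize hb : b = b₀ at h'
  cases h <;> cases h' <;> grind (splits := 20) [Injective, Fin.ext_iff, cases Bool]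

end Trans

end RoundState

/-- The program of a deterministic multi-tape machine that halts when the next state is `none`. -/
structure TapeProg where
  /-- tapes -/
  T : Type
  /-- states -/
  C : Type
  /-- tape symbols -/
  G : Type
  [finT : Fintype T]
  [decT : DecidableEq T]
  [finC : Fintype C]
  [decC : DecidableEq C]
  [finG : Fintype G]
  sym : Option Bool ↪ G
  start : C
  input : T
  query : T
  input_ne_query : input ≠ query
  next : C → (T → G) → Option C × (T → G) × (T → SignType)

namespace TapeProg

instance (N : TapeProg) : Fintype N.T := N.finT
instance (N : TapeProg) : DecidableEq N.T := N.decT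
instance (N : TapeProg) : Fintype N.C := N.finC
instance (N : TapeProg) : DecidableEq N.C := N.decC
instance (N : TapeProg) : Fintype N.G := N.finG

variable (N : TapeProg) (k : ℕ)

/-- What is recorded of a step in order to make it reversible. -/
abbrev Record : Type := N.C × (N.T → SignType) × (N.T → N.G)

/-- Symbols of the quantum machine: those of the program, records, and numbers of rounds. -/
abbrev Sym : Type := N.G ⊕ N.Record ⊕ Fin k

/-- States of the quantum machine: those of the program, with the last movement of the heads, and
the states of the quantum part. -/
abbrev State : Type := (N.C × (N.T → SignType)) ⊕ RoundState k

/-- Tapes of the quantum machine: those of the program, the history, and the output tape. -/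
abbrev Tape : Type := N.T ⊕ Bool

variable {N k} in
/-- The contents of cells, one on each tape. -/
def cells (w : N.T → N.G) (h o : N.Sym k) : N.Tape → N.Sym k :=
  Sum.elim (fun t => .inl (w t)) fun b => bif b then o else h

/-- The embedding of blank and bits. -/
def symEmb : Option Bool ↪ N.Sym k := N.sym.trans Embedding.inl

/-- The symbol for the number of a round. -/
def mark (r : Fin k) : N.Sym k := .inr (.inr r)

variable {N k} in
/-- The state that is entered after a step of the program. -/
def entered (c : Option N.C) (d : N.T → SignType) : N.State k :=
  c.elim (.inr (.ready 0)) fun c => .inl (c, d)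

/-- The local transitions of the quantum machine. -/
inductive Rule : N.State k × (N.Tape → N.Sym k) → N.State k × (N.Tape → N.Sym k) → Prop
  | work (c : N.C) (d : N.T → SignType) (w : N.T → N.G) (o : N.Sym k) :
    Rule (.inl (c, d), cells w (N.symEmb k none) o)
      (entered (N.next c w).1 (N.next c w).2.2, cells (N.next c w).2.1 (.inr (.inl (c, d, w))) o)
  | round (q q' : RoundState k) (s s' : N.Tape → N.Sym k)
    (h : RoundState.Trans (N.symEmb k) (N.mark k) (q, s (.inl N.query), s (.inr true))
      (q', s' (.inl N.query), s' (.inr true)))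
    (hs : ∀ t, t ≠ .inl N.query → t ≠ .inr true → s' t = s t) :
    Rule (.inr q, s) (.inr q', s')

theorem mark_injective : Injective (N.mark k) := fun r r' h => by simpa [mark] using h

theorem cells_inj {w w' : N.T → N.G} {h h' o o' : N.Sym k} (e : cells w h o = cells w' h' o') :
    w = w' ∧ h = h' ∧ o = o' := by
  refine ⟨funext fun t => ?_, congrFun e (.inr false), congrFun e (.inr true)⟩
  exact Sum.inl_injective (congrFun e (.inl t))

theorem Rule.functional {a b b' : N.State k × (N.Tape → N.Sym k)} (h : N.Rule k a b)
    (h' : N.Rule k a b') : b = b' := by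
  generalize ha : a = a₀ at h'
  cases h with
  | work c d w o =>
    cases h' with
    | work c' d' w' o' =>
      obtain ⟨e, e'⟩ := Prod.mk.inj ha
      cases e
      obtain ⟨rfl, -, rfl⟩ := cells_inj N k e'
      rfl
    | round => cases (Prod.mk.inj ha).1
  | round q q' s s' h hs =>
    cases h' with
    | work => cases (Prod.mk.inj ha).1
    | round q₁ q₁' s₁ s₁' h₁ hs₁ =>
      cases ha
      have e := h.functional (N.mark_injective k) h₁
      simp only [Prod.mk.injEq] at e
      obtain ⟨rfl, e₁, e₂⟩ := e
      congr 1
      funext t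
      by_cases ht : t = .inl N.query
      · rw [ht, e₁]
      · by_cases ht' : t = .inr true
        · rw [ht', e₂]
        · rw [hs t ht ht', hs₁ t ht ht']

theorem not_trans_ready_zero {a : RoundState k × N.Sym k × N.Sym k} {y o : N.Sym k} :
    ¬ RoundState.Trans (N.symEmb k) (N.mark k) a (.ready 0, y, o) := by
  intro h
  cases h with
  | undo r r' h => simp at h

/-- A record on the history tape holds the previous state, movement and symbols. The only state of
the quantum part that the program enters is `ready 0`, and no transition of the quantum part leads
there, so the two kinds of rules do not collide. -/
theorem Rule.injective {a a' b : N.State k × (N.Tape → N.Sym k)} (h : N.Rule k a b)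
    (h' : N.Rule k a' b) : a = a' := by
  have hwr : ∀ (c : Option N.C) d (q' : RoundState k) (a : RoundState k × N.Sym k × N.Sym k) y o,
      entered c d = .inr q' →
      ¬ RoundState.Trans (N.symEmb k) (N.mark k) a (q', y, o) := by
    intro c d q' a y o e
    cases c with
    | none => cases e; exact N.not_trans_ready_zero k
    | some c => cases e
  generalize hb : b = b₀ at h'
  cases h with
  | work c d w o =>
    cases h' with
    | work c' d' w' o' =>
      obtain ⟨-, e', rfl⟩ := cells_inj N k (Prod.mk.inj hb).2
      cases e'
      rfl
    | round q q' s s' h hs => exact absurd h (hwr _ _ _ _ _ _ (Prod.mk.inj hb).1)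
  | round q q' s s' h hs =>
    cases h' with
    | work => exact absurd h (hwr _ _ _ _ _ _ (Prod.mk.inj hb).1.symm)
    | round q₁ q₁' s₁ s₁' h₁ hs₁ =>
      cases hb
      have e := h.injective (N.mark_injective k) h₁
      simp only [Prod.mk.injEq] at e
      obtain ⟨rfl, e₁, e₂⟩ := e
      congr 1
      funext t
      by_cases ht : t = .inl N.query
      · rw [ht, e₁]
      · by_cases ht' : t = .inr true
        · rw [ht', e₂]
        · exact (hs t ht ht').symm.trans (hs₁ t ht ht')

/-- A permutation that extends the local transitions. -/
def perm : Equiv.Perm (N.State k × (N.Tape → N.Sym k)) :=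
  (exists_perm_of_rel (N.Rule k) (fun _ _ _ h => Rule.functional N k h)
    fun _ _ _ h => Rule.injective N k h).choose

theorem perm_eq {a b : N.State k × (N.Tape → N.Sym k)} (h : N.Rule k a b) : N.perm k a = b :=
  (exists_perm_of_rel (N.Rule k) (fun _ _ _ h => Rule.functional N k h)
    fun _ _ _ h => Rule.injective N k h).choose_spec a b h

/-- The movement of the heads when a state is entered. -/
def dir : N.State k → N.Tape → SignType
  | .inl (_, d), .inl t => d t
  | .inl _, .inr b => bif b then 0 else 1
  | .inr q, t => if t = .inl N.query then q.move else 0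

/-- The states that cause a Hadamard transformation when they are entered. -/
def mix : N.State k → Bool := Sum.elim (fun _ => false) RoundState.mixes

/-- The quantum machine without its transition amplitudes. -/
def preMachine : QOTM where
  Q := N.State k
  K := N.Tape
  Γ := N.Sym k
  decΓ := Classical.decEq _
  sym := N.symEmb k
  start := .inl (N.start, 0)
  final := .inr .final
  preQuery := .inr .pre
  postQuery := .inr .post
  pre_ne_post := by simp
  inputTape := .inl N.input
  queryTape := .inl N.query
  outputTape := .inr true
  input_ne_query := by simpa using N.input_ne_query
  δ := 0

/-- The quantum machine: it runs the program, keeping a history, and then the quantum part on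
the query tape. -/
def machine : QOTM :=
  { N.preMachine k with
    δ := fun q s a => (N.preMachine k).outVec (N.dir k) (N.mix k) (N.perm k (q, s)) a }

/-- The presentation of the quantum machine. -/
def presentation : (N.machine k).Presentation where
  perm := N.perm k
  dir := N.dir k
  mix := N.mix k
  perm_pre s := N.perm_eq k (.round _ _ _ _ (.pre _ _) fun _ _ _ => rfl)
  dir_post := fun (t : N.Tape) => by
    change (if t = Sum.inl N.query then RoundState.move .post else 0) = 0
    split_ifs <;> rfl
  mix_post := rfl
  δ_eq _ _ _ := rfl

end TapeProg

/-- The sign `(-1) ^ b`. -/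
def sgn (b : Bool) : ℂ := if b then -1 else 1

/-- Deutsch's algorithm: `a₀` to `a₆` are the basis vectors that occur in it. -/
theorem deutsch {V : Type} [AddCommGroup V] [Module ℂ V] (E : Module.End ℂ V) (f : Bool → Bool)
    (a₀ : V) (a₁ : Bool → V) (a₂ a₃ a₄ a₅ a₆ : Bool → Bool → V)
    (h₀ : E a₀ = QOTM.invSqrtTwo • a₁ false + (sgn true * QOTM.invSqrtTwo) • a₁ true)
    (h₁ : ∀ x, E (a₁ x) =
      QOTM.invSqrtTwo • a₂ x false + (sgn true * QOTM.invSqrtTwo) • a₂ x true)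
    (h₂ : ∀ x y, E (a₂ x y) = a₃ x y) (h₃ : ∀ x y, E (a₃ x y) = a₄ x (f x ^^ y))
    (h₄ : ∀ x y, E (a₄ x y) =
      QOTM.invSqrtTwo • a₅ x false + (sgn y * QOTM.invSqrtTwo) • a₅ x true)
    (h₅ : ∀ x y, E (a₅ x y) =
      QOTM.invSqrtTwo • a₆ false y + (sgn x * QOTM.invSqrtTwo) • a₆ true y) :
    (E ^ 6) a₀ = sgn (f false) • a₆ (!(f false ^^ f true)) true := by
  have hs := QOTM.invSqrtTwo_mul_self
  -- Phase kickback: the target is `(|0⟩ - |1⟩) / √2`, so the query only multiplies by `(-1) ^ f x`,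
  -- and the next Hadamard transformation restores `|1⟩`. The control also starts from `|1⟩`, hence
  -- the negation in the bit found.
  have key : ∀ x, E (E (E (E (a₁ x)))) = sgn (f x) • a₅ x true := by
    intro x
    simp only [h₁, map_add, map_smul, h₂, h₃, h₄]
    cases f x <;> simp only [sgn, Bool.false_xor, Bool.true_xor, Bool.not_false, Bool.not_true,
      Bool.false_eq_true, if_true, if_false] <;>
      match_scalars <;>
      first | ring1 | linear_combination 2 * hs | linear_combination (-2) * hs
  have h6 : (E ^ 6) a₀ = E (E (E (E (E (E a₀))))) := rfl
  rw [h6, h₀]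
  simp only [map_add, map_smul, key, h₅]
  cases f false <;> cases f true <;> simp only [sgn, Bool.false_xor, Bool.true_xor,
    Bool.not_false, Bool.not_true, Bool.false_eq_true, if_true, if_false] <;>
    match_scalars <;> first | ring1 | linear_combination 2 * hs | linear_combination (-2) * hs

/-! ### The quantum part: rounds, final scan and number of queries -/

namespace TapeProg

open QOTM RoundState

variable {N : TapeProg} {k : ℕ} {A : Language Bool} (c : (N.machine k).Cfg)

theorem query_ne_output : (N.machine k).queryTape ≠ (N.machine k).outputTape := Sum.inl_ne_inr

variable (N k) in
/-- The local transitions of the quantum part. -/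
abbrev RTrans (a b : RoundState k × N.Sym k × N.Sym k) : Prop := Trans (N.symEmb k) (N.mark k) a b

/-- The configuration with the word `v` on the query tape. -/
def conf (q : RoundState k) (o : N.Sym k) (v : List Bool) (i : ℤ) : (N.machine k).Cfg :=
  c.set (.inr q) ((N.machine k).wordTape v) i o

theorem perm_loc {q q' : RoundState k} {y o y' o' : N.Sym k}
    (h : N.RTrans k (q, y, o) (q', y', o')) :
    (N.presentation k).perm (.inr q, c.loc y o) = (.inr q', c.loc y' o') := by
  refine N.perm_eq k (.round _ _ _ _ ?_ fun t ht ht' => ?_)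
  · have e : ∀ y o : N.Sym k, c.loc y o (.inl N.query) = y := c.loc_query query_ne_output
    have e' : ∀ y o : N.Sym k, c.loc y o (.inr true) = o := c.loc_output
    rw [e, e', e, e']
    exact h
  · exact (c.loc_of_ne ht ht' _ _).trans (c.loc_of_ne ht ht' _ _).symm

theorem dir_of_ne (q : RoundState k) (t : (N.machine k).K) (h : t ≠ (N.machine k).queryTape) :
    (N.presentation k).dir (.inr q) t = 0 := if_neg h

theorem dir_query (q : RoundState k) :
    (N.presentation k).dir (.inr q) (N.machine k).queryTape = q.move := if_pos rfl

theorem ne_preQuery {q : RoundState k} (h : q ≠ .pre) :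
    (Sum.inr q : N.State k) ≠ (N.machine k).preQuery := fun e => h (Sum.inr_injective e)

section Steps

variable {q q' : RoundState k} {o o' : N.Sym k} (u w : List Bool) (x : Bool)

theorem wordTape_append : (N.machine k).wordTape (u ++ x :: w) u.length = N.symEmb k (some x) := by
  have h : u.length < (u ++ x :: w).length := by simp
  have := wordTape_apply (M := N.machine k) h
  simp only [List.getElem_append_right le_rfl, Nat.sub_self, List.getElem_cons_zero] at this
  exact this

theorem update_wordTape_append (b : Bool) :
    update ((N.machine k).wordTape (u ++ x :: w)) u.length (N.symEmb k (some b)) =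
      (N.machine k).wordTape (u ++ b :: w) := by
  have h : u.length < (u ++ x :: w).length := by simp
  have := update_wordTape (M := N.machine k) (u ++ x :: w) h b
  rw [List.set_append_right _ _ le_rfl, Nat.sub_self, List.set_cons_zero] at this
  exact this

theorem stepVec_keep (hq : q ≠ .pre) (hm : q'.mixes = false)
    (h : N.RTrans k (q, N.symEmb k (some x), o) (q', N.symEmb k (some x), o')) :
    (N.machine k).stepVec A (conf c q o (u ++ x :: w) u.length) =
      Finsupp.single (conf c q' o' (u ++ x :: w) (u.length + (q'.move : ℤ))) 1 := by
  have e := wordTape_append (N := N) (k := k) u w x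
  have := (N.presentation k).stepVec_set_of_not_mix (A := A) c query_ne_output (ne_preQuery hq)
    (dir_of_ne q') (τ := (N.machine k).wordTape (u ++ x :: w)) (i := u.length)
    (y := N.symEmb k (some x)) (by rw [e]; exact perm_loc c h) hm
  rw [dir_query, update_wordTape_append] at this
  exact this

theorem stepVec_mix (hq : q ≠ .pre) (hm : q'.mixes = true)
    (h : N.RTrans k (q, N.symEmb k (some x), o) (q', N.symEmb k (some x), o')) :
    (N.machine k).stepVec A (conf c q o (u ++ x :: w) u.length) =
      Finsupp.single (conf c q' o' (u ++ false :: w) (u.length + (q'.move : ℤ))) invSqrtTwo +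
      Finsupp.single (conf c q' o' (u ++ true :: w) (u.length + (q'.move : ℤ)))
        (sgn x * invSqrtTwo) := by
  have e := wordTape_append (N := N) (k := k) u w x
  have := (N.presentation k).stepVec_set_of_mix (A := A) c query_ne_output (ne_preQuery hq)
    (dir_of_ne q') (τ := (N.machine k).wordTape (u ++ x :: w)) (i := u.length)
    (y := N.symEmb k (some x)) (b := x) (by rw [e]; exact perm_loc c h) hm rfl
  rw [dir_query] at this
  have e' : ∀ b, update ((N.machine k).wordTape (u ++ x :: w)) u.length
      ((N.machine k).sym (some b)) = (N.machine k).wordTape (u ++ b :: w) :=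
    update_wordTape_append u w x
  rw [e', e'] at this
  refine this.trans ?_
  cases x
  · simp [sgn, conf]
  · rw [add_comm]
    simp [sgn, conf]

end Steps

theorem stepVec_extend (r : Fin k) (o : N.Sym k) (u : List Bool) :
    (N.machine k).stepVec A (conf c (.extend r) o u u.length) =
      Finsupp.single (conf c (.ask r) o (u ++ [false]) u.length) invSqrtTwo +
      Finsupp.single (conf c (.ask r) o (u ++ [true]) u.length) (sgn true * invSqrtTwo) := by
  have e : (N.machine k).wordTape u u.length = N.symEmb k none := wordTape_length u
  have := (N.presentation k).stepVec_set_of_mix (A := A) c query_ne_output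
    (ne_preQuery (q := .extend r) (by simp))
    (dir_of_ne (.ask r)) (τ := (N.machine k).wordTape u) (i := u.length)
    (y := N.symEmb k (some true)) (b := true) (o := o)
    (by rw [e]; exact perm_loc c (.extend r o)) rfl rfl
  rw [dir_query, update_wordTape_length, update_wordTape_length, add_comm] at this
  simpa [sgn, conf, RoundState.move] using this

theorem stepVec_pre (o : N.Sym k) (u : List Bool) (b : Bool) (i : ℤ) :
    (N.machine k).stepVec A (conf c .pre o (u ++ [b]) i) =
      Finsupp.single (conf c .post o (u ++ [chi A u ^^ b]) i) 1 := by
  have h : (conf c .pre o (u ++ [b]) i).state = (N.machine k).preQuery := rfl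
  have e := oracleCfg_set (A := A) c query_ne_output (.inr .pre)
    ((N.machine k).wordTape (u ++ [b])) i o
  rw [oracleTape_wordTape] at e
  rw [stepVec, if_pos h]
  exact congrArg (Finsupp.single · 1) e

/-- One round. -/
theorem becomes_round (r : Fin k) (u : List Bool) :
    Becomes A 6 (conf c (.ready r.castSucc) (N.symEmb k none) (u ++ [true]) u.length)
      (conf c (.ready r.succ) (N.symEmb k none)
        (u ++ [!(chi A (u ++ [false]) ^^ chi A (u ++ [true]))] ++ [true]) (u.length + 1 : ℕ)) := by
  have hl : ∀ x, ((u.length : ℤ) + 1) = ((u ++ [x]).length : ℕ) := fun x => by simp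
  have := deutsch ((N.machine k).evolve A) (fun x => chi A (u ++ [x]))
    (Finsupp.single (conf c (.ready r.castSucc) (N.symEmb k none) (u ++ [true]) u.length) 1)
    (fun x => Finsupp.single (conf c (.extend r) (N.symEmb k none) (u ++ [x]) (u.length + 1)) 1)
    (fun x y => Finsupp.single (conf c (.ask r) (N.symEmb k none) (u ++ [x] ++ [y])
      (u.length + 1)) 1)
    (fun x y => Finsupp.single (conf c .pre (N.mark k r) (u ++ [x] ++ [y]) (u.length + 1)) 1)
    (fun x y => Finsupp.single (conf c .post (N.mark k r) (u ++ [x] ++ [y]) (u.length + 1)) 1)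
    (fun x y => Finsupp.single (conf c (.undo r) (N.symEmb k none) (u ++ [x] ++ [y])
      u.length) 1)
    (fun x y => Finsupp.single (conf c (.ready r.succ) (N.symEmb k none) (u ++ [x] ++ [y])
      (u.length + 1)) 1)
    (by
      rw [evolve_single, stepVec_mix c u [] true (q' := .extend r) (by simp) rfl
        (.ready _ _ (by simp) _ _)]
      simp [RoundState.move])
    (by
      intro x
      rw [evolve_single, hl x, stepVec_extend]
      simp)
    (by
      intro x y
      rw [evolve_single, hl x, stepVec_keep c (u ++ [x]) [] y (q' := .pre) (by simp) rfl
        (.ask _ _)]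
      simp [RoundState.move])
    (by
      intro x y
      rw [evolve_single, stepVec_pre]
      simp)
    (by
      intro x y
      rw [evolve_single, hl x, stepVec_mix c (u ++ [x]) [] y (q' := .undo r) (by simp) rfl
        (.post _ _)]
      simp [RoundState.move])
    (by
      intro x y
      rw [evolve_single]
      have := stepVec_mix (A := A) c (q := .undo r) (q' := .ready r.succ)
        (o := N.symEmb k none) u [y] x (by simp)
        (by simp [RoundState.mixes]) (.undo _ _ (by simp) _ _)
      simpa [RoundState.move] using this)
  refine ⟨sgn (chi A (u ++ [false])), ?_, ?_⟩
  · cases chi A (u ++ [false]) <;> simp [sgn]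
  · rw [this]
    simp

/-- Each round ends with `true` in its target cell, and this cell serves as the control of the next
round. The bits found remain in front of it and become part of the next query. -/
theorem becomes_rounds (u : List Bool) (r : Fin (k + 1)) :
    Becomes A (6 * r) (conf c (.ready 0) (N.symEmb k none) (u ++ [true]) u.length)
      (conf c (.ready r) (N.symEmb k none)
        (u ++ searchBits (fun l => chi A (u ++ l)) r ++ [true]) (u.length + r : ℕ)) := by
  induction r using Fin.induction with
  | zero => simpa [searchBits] using Becomes.refl _
  | succ r ih =>
    have := becomes_round (A := A) c r (u ++ searchBits (fun l => chi A (u ++ l)) r)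
    have h := ih.trans (by simpa [length_searchBits] using this)
    simpa [searchBits, mul_add, add_assoc, List.append_assoc] using h

/-- The head moves to the left, so the bits are consumed from the end of `l` and the induction
appends letters there. -/
theorem becomes_scan (u l w : List Bool) (j j' : Fin (k + 2)) (hj : (j' : ℕ) = j + l.length)
    (p : Bool) (o : N.Sym k) :
    Becomes A l.length (conf c (.scan j p) o (u ++ l ++ w) (u.length + l.length - 1))
      (conf c (.scan j' (p ^^ xorNot l)) o (u ++ l ++ w) (u.length - 1)) := by
  induction l using List.reverseRecOn generalizing w j p with
  | nil =>
    obtain rfl : j = j' := Fin.ext (by simpa using hj.symm)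
    simpa [xorNot] using Becomes.refl _
  | append_singleton l b ih =>
    have hlt := j'.2
    simp only [List.length_append, List.length_singleton] at hj
    have h₁ := Becomes.of_stepVec (stepVec_keep (A := A) (N := N) c
      (q := .scan j p) (q' := .scan ⟨j + 1, by omega⟩ (p ^^ !b)) (u ++ l) w b (by simp) rfl
      (.scan j ⟨j + 1, by omega⟩ rfl p _ b rfl o))
    have h₂ := ih (b :: w) ⟨j + 1, by omega⟩ (by simp; omega) (p ^^ !b)
    have hw : u ++ (l ++ [b]) ++ w = u ++ l ++ b :: w := by simp
    have hp : (p ^^ xorNot (l ++ [b])) = ((p ^^ !b) ^^ xorNot l) := by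
      rw [xorNot_append, Bool.xor_assoc, Bool.xor_comm (xorNot l)]
    have hn : (u.length + (l ++ [b]).length - 1 : ℤ) = ((u ++ l).length : ℕ) := by
      push_cast [List.length_append, List.length_singleton]; ring
    have hm : ((u ++ l).length : ℤ) + (RoundState.move (.scan (k := k) ⟨j + 1, by omega⟩
        (p ^^ !b)) : ℤ) = u.length + l.length - 1 := by
      simp [RoundState.move]; ring
    rw [hm] at h₁
    rw [hw, hp, hn, List.length_append, List.length_singleton, Nat.add_comm]
    exact h₁.trans h₂

/-- The configurations with a state and a symbol on the output tape from `S` and with a word of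
length `n` on the query tape. -/
def stage (S : Set (RoundState k × N.Sym k)) (n : ℕ) (i : ℤ) : Set (N.machine k).Cfg :=
  {d | ∃ s ∈ S, ∃ v : List Bool, v.length = n ∧ d = conf c s.1 s.2 v i}

theorem eq_or_eq_of_ne_zero {α : Type} {a b d : α} {x y : ℂ}
    (h : (Finsupp.single a x + Finsupp.single b y) d ≠ 0) : d = a ∨ d = b := by
  by_contra! h'
  exact h (by simp [h'.1.symm, h'.2.symm])

theorem eq_of_ne_zero {α : Type} {a d : α} {x : ℂ} (h : (Finsupp.single a x) d ≠ 0) : d = a := by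
  by_contra h'
  exact h (by simp [Ne.symm h'])

/-- Path version of a step, valid for every bit under the head. A Hadamard transformation can change
this bit but neither the length of the word nor the head position, so sets given by length, state
and head position suffice to count queries on all paths. -/
theorem leads_keep {S S' : Set (RoundState k × N.Sym k)} {n i : ℕ} (hi : i < n) (m : SignType)
    (hS : ∀ s ∈ S, s.1 ≠ .pre ∧ s.1 ≠ .final ∧ ∀ b, ∃ s' ∈ S', s'.1.move = m ∧
      N.RTrans k (s.1, N.symEmb k (some b), s.2) (s'.1, N.symEmb k (some b), s'.2)) :
    Leads A 1 0 (stage c S n i) (stage c S' n (i + (m : ℤ))) := by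
  refine Leads.of_stepVec ?_ ?_ ?_
  · rintro _ ⟨s, hs, v, hv, rfl⟩ h
    exact (hS s hs).2.1 (Sum.inr_injective h)
  · rintro - _ ⟨s, hs, v, hv, rfl⟩ h
    exact (hS s hs).1 (Sum.inr_injective h)
  · rintro _ ⟨s, hs, v, rfl, rfl⟩ d hd
    obtain ⟨u, x, w, rfl, rfl⟩ : ∃ u x w, v = u ++ x :: w ∧ u.length = i :=
      ⟨v.take i, v[i], v.drop (i + 1), by simp, by simp; omega⟩
    obtain ⟨s', hs', rfl, ht⟩ := (hS s hs).2.2 x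
    cases hm : s'.1.mixes with
    | false =>
      rw [stepVec_keep c u w x (hS s hs).1 hm ht] at hd
      exact ⟨s', hs', _, rfl, eq_of_ne_zero hd⟩
    | true =>
      rw [stepVec_mix c u w x (hS s hs).1 hm ht] at hd
      rcases eq_or_eq_of_ne_zero hd with h | h
      · exact ⟨s', hs', _, by simp, h⟩
      · exact ⟨s', hs', _, by simp, h⟩

theorem leads_extend (r : Fin k) (o : N.Sym k) (n : ℕ) :
    Leads A 1 0 (stage c {(.extend r, o)} n n) (stage c {(.ask r, o)} (n + 1) n) := by
  refine Leads.of_stepVec ?_ ?_ ?_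
  · rintro _ ⟨_, rfl, v, hv, rfl⟩ h
    cases Sum.inr_injective h
  · rintro - _ ⟨_, rfl, v, hv, rfl⟩ h
    cases Sum.inr_injective h
  · rintro _ ⟨_, rfl, v, rfl, rfl⟩ d hd
    rw [stepVec_extend] at hd
    rcases eq_or_eq_of_ne_zero hd with h | h
    · exact ⟨_, rfl, _, by simp, h⟩
    · exact ⟨_, rfl, _, by simp, h⟩

theorem leads_pre (o : N.Sym k) (n : ℕ) (i : ℤ) :
    Leads A 1 1 (stage c {(.pre, o)} (n + 1) i) (stage c {(.post, o)} (n + 1) i) := by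
  refine Leads.of_stepVec ?_ ?_ ?_
  · rintro _ ⟨_, rfl, v, hv, rfl⟩ h
    cases Sum.inr_injective h
  · intro h
    cases h
  · rintro _ ⟨_, rfl, v, hv, rfl⟩ d hd
    obtain rfl | ⟨u, b, rfl⟩ := v.eq_nil_or_concat'
    · cases hv
    rw [stepVec_pre] at hd
    exact ⟨_, rfl, _, by simpa using hv, eq_of_ne_zero hd⟩

theorem leads_round (r : Fin k) (n : ℕ) :
    Leads A 6 1 (stage c {(.ready r.castSucc, N.symEmb k none)} (n + 1) n)
      (stage c {(.ready r.succ, N.symEmb k none)} (n + 2) (n + 1 : ℕ)) := by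
  have h₁ : Leads A 1 0 (stage c {(.ready r.castSucc, N.symEmb k none)} (n + 1) n)
      (stage c {(.extend r, N.symEmb k none)} (n + 1) (n + 1 : ℕ)) :=
    leads_keep c (Nat.lt_succ_self n) 1 (by
      rintro _ rfl
      exact ⟨by simp, by simp, fun b => ⟨_, rfl, rfl, .ready _ _ (by simp) _ _⟩⟩)
  have h₂ := leads_extend (A := A) c r (N.symEmb k none) (n + 1)
  have h₃ : Leads A 1 0 (stage c {(.ask r, N.symEmb k none)} (n + 2) (n + 1 : ℕ))
      (stage c {(.pre, N.mark k r)} (n + 2) ((n + 1 : ℕ) + (0 : SignType))) :=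
    leads_keep c (Nat.lt_succ_self _) 0 (by
      rintro _ rfl
      exact ⟨by simp, by simp, fun b => ⟨_, rfl, rfl, .ask _ _⟩⟩)
  have h₄ := leads_pre (A := A) c (N.mark k r) (n + 1) ((n + 1 : ℕ) + (0 : SignType))
  have h₅ : Leads A 1 0 (stage c {(.post, N.mark k r)} (n + 2) (n + 1 : ℕ))
      (stage c {(.undo r, N.symEmb k none)} (n + 2) ((n + 1 : ℕ) + (-1 : SignType))) :=
    leads_keep c (Nat.lt_succ_self _) (-1) (by
      rintro _ rfl
      exact ⟨by simp, by simp, fun b => ⟨_, rfl, rfl, .post _ _⟩⟩)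
  have h₆ : Leads A 1 0 (stage c {(.undo r, N.symEmb k none)} (n + 2) n)
      (stage c {(.ready r.succ, N.symEmb k none)} (n + 2) (n + 1 : ℕ)) :=
    leads_keep c (by omega) 1 (by
      rintro _ rfl
      exact ⟨by simp, by simp, fun b => ⟨_, rfl, by simp [RoundState.move],
        .undo _ _ (by simp) _ _⟩⟩)
  have e : ((n + 1 : ℕ) : ℤ) + ((-1 : SignType) : ℤ) = n := by simp
  have e' : ((n + 1 : ℕ) : ℤ) + ((0 : SignType) : ℤ) = (n + 1 : ℕ) := by simp
  rw [e] at h₅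
  rw [e'] at h₃ h₄
  exact ((((h₁.trans h₂).trans h₃).trans h₄).trans h₅).trans h₆

theorem leads_rounds (n : ℕ) (r : Fin (k + 1)) :
    Leads A (6 * r) r (stage c {(.ready 0, N.symEmb k none)} (n + 1) n)
      (stage c {(.ready r, N.symEmb k none)} (n + r + 1) (n + r : ℕ)) := by
  induction r using Fin.induction with
  | zero => exact Leads.refl _
  | succ r ih => exact ih.trans (leads_round c r (n + r))

variable (N k) in
/-- The scanning states with number `j`. -/
def scanning (j : ℕ) (o : N.Sym k) : Set (RoundState k × N.Sym k) :=
  {s | ∃ (q : Fin (k + 2)) (p : Bool), (q : ℕ) = j ∧ s = (.scan q p, o)}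

theorem leads_scan (m n i j : ℕ) (o : N.Sym k) (hi : i + j ≤ k + 1) (hn : m + i < n) :
    Leads A i 0 (stage c (N.scanning k j o) n (m + i - 1)) (stage c (N.scanning k (j + i) o) n
      (m - 1)) := by
  induction i generalizing j with
  | zero => simpa using Leads.refl _
  | succ i ih =>
    have h := ih (j + 1) (by omega) (by omega)
    have h' : Leads A 1 0 (stage c (N.scanning k j o) n (m + i : ℕ))
        (stage c (N.scanning k (j + 1) o) n ((m + i : ℕ) + (-1 : SignType))) :=
      leads_keep c (by omega) (-1) (by
        rintro _ ⟨q, p, hq, rfl⟩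
        refine ⟨by simp, by simp, fun b => ⟨(.scan ⟨j + 1, by omega⟩ (p ^^ !b), _),
          ⟨_, _, rfl, rfl⟩, rfl, .scan _ _ (by simp [hq]) _ _ _ rfl _⟩⟩)
    have e : (m : ℤ) + ((i + 1 : ℕ) : ℤ) - 1 = (m + i : ℕ) := by push_cast; ring
    have e' : ((m + i : ℕ) : ℤ) + ((-1 : SignType) : ℤ) = m + i - 1 := by simp; ring
    rw [e, Nat.add_comm i 1, ← Nat.add_assoc]
    rw [e'] at h'
    exact h'.trans h

/-- The time consists of `6 * k` steps for the rounds, one to start the scan, `k + 1` to read the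
found bits and `base`, and one to halt. It is the same on all paths. -/
theorem leads_quantum {u : List Bool} (hu : u ≠ []) (base : Bool) :
    Leads A (7 * k + 3) k
      {conf c (.ready 0) (N.symEmb k none) (u ++ [base] ++ [true]) (u ++ [base]).length}
      {d | d.state = (N.machine k).final} := by
  have hpos : 0 < u.length := List.length_pos_iff.2 hu
  have h₁ := leads_rounds (A := A) c (u.length + 1) (Fin.last k)
  rw [Fin.val_last] at h₁
  set n := u.length + 1 + k + 1 with hn
  have h₂ : Leads A 1 0 (stage c {(.ready (Fin.last k), N.symEmb k none)} n (u.length + 1 + k : ℕ))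
      (stage c (N.scanning k 0 (N.symEmb k none)) n ((u.length + 1 + k : ℕ) + (-1 : SignType))) :=
    leads_keep c (by omega) (-1) (by
      rintro _ rfl
      exact ⟨by simp, by simp, fun b => ⟨_, ⟨0, false, rfl, rfl⟩, rfl,
        .done _ (by simp) _ rfl _ _⟩⟩)
  have e₂ : ((u.length + 1 + k : ℕ) : ℤ) + ((-1 : SignType) : ℤ) = u.length + (k + 1 : ℕ) - 1 := by
    simp; ring
  rw [e₂] at h₂
  have h₃ := leads_scan (A := A) c u.length n (k + 1) 0 (N.symEmb k none) (by omega) (by omega)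
  -- The scan ends on the last cell of `u`; as `u` is nonempty, the head is still on the word.
  have h₄ : Leads A 1 0
      (stage c (N.scanning k (k + 1) (N.symEmb k none)) n (u.length - 1 : ℕ))
      (stage c {s | s.1 = .final} n ((u.length - 1 : ℕ) + (0 : SignType))) :=
    leads_keep c (by omega) 0 (by
      rintro _ ⟨q, p, hq, rfl⟩
      exact ⟨by simp, by simp, fun b => ⟨(.final, _), rfl, rfl, .halt _ hq _ _⟩⟩)
  rw [Nat.cast_sub hpos, Nat.cast_one] at h₄
  rw [Nat.zero_add] at h₃
  have h := ((h₁.trans h₂).trans h₃).trans h₄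
  rw [show 6 * k + 1 + (k + 1) + 1 = 7 * k + 3 by ring] at h
  intro m γ hm h0 hγ
  have := h m γ hm ⟨_, rfl, u ++ [base] ++ [true], by simp, by simpa using h0⟩ hγ
  refine ⟨fun e => ?_, this.2⟩
  obtain ⟨s, hs, v, -, hv⟩ := this.1 e
  change (γ m).state = _
  rw [hv]
  exact congrArg Sum.inr hs

theorem becomes_quantum {u : List Bool} (hu : u ≠ []) (base : Bool)
    (hc : c.head (N.machine k).outputTape = 0) :
    ∃ d, Becomes A (7 * k + 3)
      (conf c (.ready 0) (N.symEmb k none) (u ++ [base] ++ [true]) (u ++ [base]).length) d ∧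
      d.tape (N.machine k).outputTape 0 = N.symEmb k (some
        (base ^^ xorNot (searchBits (fun l => chi A (u ++ [base] ++ l)) k))) := by
  have hpos : 0 < u.length := List.length_pos_iff.2 hu
  have h₁ := becomes_rounds (A := A) c (u ++ [base]) (Fin.last k)
  rw [Fin.val_last] at h₁
  set l := searchBits (fun l => chi A (u ++ [base] ++ l)) k with hl
  have hlen : l.length = k := length_searchBits _ _
  have h₂ := Becomes.of_stepVec (stepVec_keep (A := A) (N := N) c
    (q := .ready (Fin.last k)) (q' := .scan 0 false) (o := N.symEmb k none)
    (u ++ [base] ++ l) [] true (by simp) rfl (.done _ (by simp) _ rfl _ _))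
  have e₂ : ((u ++ [base] ++ l).length : ℤ) + (RoundState.move (.scan (k := k) 0 false) : ℤ) =
      u.length + ([base] ++ l).length - 1 := by
    simp [RoundState.move]; ring
  rw [e₂] at h₂
  have h₃ := becomes_scan (A := A) c u ([base] ++ l) [true] 0 (Fin.last (k + 1)) (by simp [hlen])
    false (N.symEmb k none)
  obtain ⟨v, x, rfl⟩ := (u.eq_nil_or_concat').resolve_left hu
  have h₄ := Becomes.of_stepVec (stepVec_keep (A := A) (N := N) c
    (q := .scan (Fin.last (k + 1)) (false ^^ xorNot ([base] ++ l))) (q' := .final)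
    v ([base] ++ l ++ [true]) x (by simp) rfl (.halt _ rfl _ _))
  -- The scan treats `base` like a found bit and so adds its negation; the negation in the halting
  -- transition cancels this.
  have hx : (base ^^ xorNot l) = !(false ^^ xorNot ([base] ++ l)) := by
    rw [show xorNot ([base] ++ l) = (xorNot l ^^ !base) from rfl]
    cases base <;> cases xorNot l <;> rfl
  rw [← hx] at h₄
  refine ⟨conf c .final (N.symEmb k (some (base ^^ xorNot l)))
    (v ++ x :: ([base] ++ l ++ [true])) (v.length + (RoundState.final (k := k)).move), ?_, ?_⟩
  · have e₃ : ((v ++ [x]).length : ℤ) - 1 = v.length := by simp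
    have e₄ : (v ++ [x] ++ [base] ++ l).length = (v ++ [x] ++ [base]).length + k := by
      rw [List.length_append (bs := l), hlen]
    have e₅ : v ++ [x] ++ [base] ++ l ++ [true] = v ++ x :: ([base] ++ l ++ [true]) := by simp
    have e₆ : v ++ [x] ++ ([base] ++ l) ++ [true] = v ++ x :: ([base] ++ l ++ [true]) := by simp
    rw [e₃, e₆] at h₃
    rw [e₄, e₅] at h₂
    rw [e₅] at h₁
    have h := ((h₁.trans h₂).trans h₃).trans h₄
    have en : 6 * k + 1 + ([base] ++ l).length + 1 = 7 * k + 3 := by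
      rw [List.length_append, hlen, List.length_singleton]; ring
    rw [en] at h
    exact h
  · have := c.set_tape_output (.inr .final)
      ((N.machine k).wordTape (v ++ x :: ([base] ++ l ++ [true])))
      (v.length + (RoundState.final (k := k)).move) (N.symEmb k (some (base ^^ xorNot l)))
    rw [hc] at this
    exact this

end TapeProg

/-! ### Simulation of the classical program with a history tape -/

namespace TapeProg

open QOTM

variable (N : TapeProg)

/-- `N.Halts n c H τ H' τ'`: when the program is started in state `c` with heads at `H` and tapes
`τ`, it halts after `n` steps with heads at `H'` and tapes `τ'`; in the last step no head moves. -/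
inductive Halts : ℕ → N.C → (N.T → ℤ) → (N.T → ℤ → N.G) → (N.T → ℤ) → (N.T → ℤ → N.G) → Prop
  | last {c : N.C} {H : N.T → ℤ} {τ : N.T → ℤ → N.G}
    (h : (N.next c fun t => τ t (H t)).1 = none) :
    Halts 1 c H τ H fun t => update (τ t) (H t) ((N.next c fun t => τ t (H t)).2.1 t)
  | step {n : ℕ} {c c' : N.C} {H H₁ : N.T → ℤ} {τ τ₁ : N.T → ℤ → N.G}
    (h : (N.next c fun t => τ t (H t)).1 = some c')
    (h' : Halts n c' (fun t => H t + ((N.next c fun t => τ t (H t)).2.2 t : ℤ))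
      (fun t => update (τ t) (H t) ((N.next c fun t => τ t (H t)).2.1 t)) H₁ τ₁) :
    Halts (n + 1) c H τ H₁ τ₁

/-- The tape with the word `w` in the cells `0, …, |w| - 1` and blanks everywhere else. -/
def wordTape (w : List Bool) : ℤ → N.G :=
  fun z => N.sym (if z < 0 then none else w[z.toNat]?)

/-- The initial tapes. -/
def initTapes (x : List Bool) : N.T → ℤ → N.G :=
  fun t => N.wordTape (if t = N.input then x else [])

variable {N} {k : ℕ} {A : Language Bool}

theorem Halts.step_of {n : ℕ} {c c' : N.C} {H H' : N.T → ℤ} {τ τ' : N.T → ℤ → N.G}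
    {w : N.T → N.G} {d : N.T → SignType}
    (hn : N.next c (fun t => τ t (H t)) = (some c', w, d))
    (h : N.Halts n c' (fun t => H t + (d t : ℤ)) (fun t => update (τ t) (H t) (w t)) H' τ') :
    N.Halts (n + 1) c H τ H' τ' :=
  .step (by rw [hn]) (by rw [hn]; exact h)

theorem Halts.last_of {c : N.C} {H : N.T → ℤ} {τ : N.T → ℤ → N.G} {w : N.T → N.G}
    {d : N.T → SignType} (hn : N.next c (fun t => τ t (H t)) = (none, w, d)) :
    N.Halts 1 c H τ H fun t => update (τ t) (H t) (w t) := by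
  have := Halts.last (N := N) (c := c) (H := H) (τ := τ) (by rw [hn])
  rwa [hn] at this

/-- A configuration of the quantum machine represents heads at `H` and tapes `τ`. -/
structure Represents (d : (N.machine k).Cfg) (H : N.T → ℤ) (τ : N.T → ℤ → N.G) : Prop where
  head : ∀ t : N.T, d.head (.inl t) = H t
  tape : ∀ t : N.T, d.tape (.inl t) = fun z => .inl (τ t z)
  head_out : d.head (.inr true) = 0
  tape_out : d.tape (.inr true) = fun _ => N.symEmb k none

/-- The history tape is blank from its head on. -/
def FreshHistory (d : (N.machine k).Cfg) : Prop :=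
  ∀ z, d.head (.inr false) ≤ z → d.tape (.inr false) z = N.symEmb k none

theorem mix_entered (c : Option N.C) (dir : N.T → SignType) :
    N.mix k (entered c dir) = false := by
  cases c <;> rfl

/-- The configuration after a step of the program. -/
def nextCfg (d : (N.machine k).Cfg) (c : N.C) (dir : N.T → SignType) (w : N.T → N.G) :
    (N.machine k).Cfg :=
  (N.machine k).act d (entered (N.next c w).1 (N.next c w).2.2,
    cells (N.next c w).2.1 (.inr (.inl (c, dir, w))) (N.symEmb k none),
    N.dir k (entered (N.next c w).1 (N.next c w).2.2))

/-- A blank history cell and a blank output cell are what makes `Rule.work` applicable; on other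
local configurations the extended permutation is unspecified. -/
theorem stepVec_work {d : (N.machine k).Cfg} {H : N.T → ℤ} {τ : N.T → ℤ → N.G}
    (hd : Represents d H τ) (hf : FreshHistory d) {c : N.C} {dir : N.T → SignType}
    (hs : d.state = .inl (c, dir)) :
    (N.machine k).stepVec A d = Finsupp.single (nextCfg d c dir fun t => τ t (H t)) 1 := by
  have hr : d.read = cells (fun t => τ t (H t)) (N.symEmb k none) (N.symEmb k none) := by
    funext t
    rcases t with t | t
    · change d.tape (.inl t) (d.head (.inl t)) = _
      rw [hd.tape, hd.head]
      rfl
    · cases t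
      · exact hf _ le_rfl
      · change d.tape (.inr true) _ = _
        rw [hd.tape_out]
        rfl
  have hp : (N.presentation k).perm (d.state, d.read) =
      (entered (N.next c fun t => τ t (H t)).1 (N.next c fun t => τ t (H t)).2.2,
        cells (N.next c fun t => τ t (H t)).2.1 (.inr (.inl (c, dir, fun t => τ t (H t))))
          (N.symEmb k none)) := by
    rw [hs, hr]
    exact N.perm_eq k (.work _ _ _ _)
  have hpre : d.state ≠ (N.machine k).preQuery := by
    rw [hs]
    exact Sum.inl_ne_inr
  exact (N.presentation k).stepVec_of_not_mix hpre hp (mix_entered _ _)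

theorem dir_entered_out (c : Option N.C) (d : N.T → SignType) :
    N.dir k (entered c d) (.inr true) = 0 := by
  cases c <;> rfl

theorem nextCfg_represents {d : (N.machine k).Cfg} {H : N.T → ℤ} {τ : N.T → ℤ → N.G}
    (hd : Represents d H τ) (c : N.C) (dir : N.T → SignType) (w : N.T → N.G)
    (H' : N.T → ℤ) (hH : ∀ t, H' t = H t +
      (N.dir k (entered (N.next c w).1 (N.next c w).2.2) (.inl t) : ℤ)) :
    Represents (nextCfg d c dir w) H' fun t => update (τ t) (H t) ((N.next c w).2.1 t) where
  head t := by
    rw [hH, ← hd.head]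
    rfl
  tape t := by
    change update (d.tape (.inl t)) (d.head (.inl t)) (.inl ((N.next c w).2.1 t)) = _
    rw [hd.tape, hd.head]
    funext z
    by_cases hz : z = H t
    · subst hz
      exact (update_self _ _ _).trans (congrArg Sum.inl (update_self (H t) _ (τ t)).symm)
    · exact (update_of_ne hz _ _).trans (congrArg Sum.inl (update_of_ne hz _ (τ t)).symm)
  head_out := by
    change d.head (.inr true) +
      ((N.dir k (entered (N.next c w).1 (N.next c w).2.2) (.inr true) : SignType) : ℤ) = 0
    rw [dir_entered_out, hd.head_out]
    rfl
  tape_out := by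
    change update (d.tape (.inr true)) (d.head (.inr true)) (N.symEmb k none) = _
    rw [hd.tape_out]
    exact update_eq_self_iff.2 rfl

/-- Valid only while the program continues: after its last step the history head remains on the
record just written. -/
theorem nextCfg_freshHistory {d : (N.machine k).Cfg} (hf : FreshHistory d) {c c' : N.C}
    (dir : N.T → SignType) {w : N.T → N.G} (h : (N.next c w).1 = some c') :
    FreshHistory (nextCfg d c dir w) := by
  intro z hz
  have e : (nextCfg d c dir w).head (.inr false) = d.head (.inr false) + 1 := by
    change d.head (.inr false) +
      ((N.dir k (entered (N.next c w).1 (N.next c w).2.2) (.inr false) : SignType) : ℤ) = _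
    rw [h]
    rfl
  rw [e] at hz
  change update (d.tape (.inr false)) (d.head (.inr false)) _ z = _
  rw [update_of_ne (by omega)]
  exact hf z (by omega)

theorem leads_work {d d' : (N.machine k).Cfg} {c : N.C} {dir : N.T → SignType}
    (hs : d.state = .inl (c, dir)) (h : (N.machine k).stepVec A d = Finsupp.single d' 1) :
    Leads A 1 0 {d} {d'} := by
  refine Leads.of_stepVec ?_ ?_ ?_
  · rintro _ rfl
    rw [hs]
    exact Sum.inl_ne_inr
  · rintro - _ rfl
    rw [hs]
    exact Sum.inl_ne_inr
  · rintro _ rfl d'' hd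
    rw [h] at hd
    exact eq_of_ne_zero hd

/-- The quantum machine simulates the program. -/
theorem Halts.simulate {n : ℕ} {c : N.C} {H H' : N.T → ℤ} {τ τ' : N.T → ℤ → N.G}
    (h : N.Halts n c H τ H' τ') {d : (N.machine k).Cfg} (hd : Represents d H τ)
    (hf : FreshHistory d) {dir : N.T → SignType} (hs : d.state = .inl (c, dir)) :
    ∃ d', Represents d' H' τ' ∧ d'.state = .inr (.ready 0) ∧ Leads A n 0 {d} {d'} ∧
      Becomes A n d d' := by
  induction h generalizing d dir with
  | @last c H τ h =>
    have hv := stepVec_work (A := A) hd hf hs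
    refine ⟨nextCfg d c dir fun t => τ t (H t), ?_, ?_, leads_work hs hv, Becomes.of_stepVec hv⟩
    · refine nextCfg_represents hd _ _ _ _ fun t => ?_
      rw [h]
      change H t = H t + (((if (Sum.inl t : N.Tape) = .inl N.query then
        RoundState.move (k := k) (.ready 0) else 0) : SignType) : ℤ)
      split_ifs <;> simp [RoundState.move]
    · change entered (N.next c _).1 _ = _
      rw [h]
      rfl
  | @step n c c' H H' τ τ' h h' ih =>
    have hv := stepVec_work (A := A) hd hf hs
    have hr : Represents (nextCfg d c dir fun t => τ t (H t)) _ _ :=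
      nextCfg_represents hd c dir (fun t => τ t (H t))
        (fun t => H t + ((N.next c fun t => τ t (H t)).2.2 t : ℤ)) (fun t => by
        rw [h]; rfl)
    have hs' : (nextCfg d c dir fun t => τ t (H t)).state =
        .inl (c', (N.next c fun t => τ t (H t)).2.2) := by
      change entered (N.next c _).1 _ = _
      rw [h]
      rfl
    obtain ⟨d', h₁, h₂, h₃, h₄⟩ := ih hr (nextCfg_freshHistory hf dir h) hs'
    refine ⟨d', h₁, h₂, ?_, ?_⟩
    · rw [Nat.add_comm]
      exact (leads_work hs hv).trans h₃
    · rw [Nat.add_comm]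
      exact (Becomes.of_stepVec hv).trans h₄

theorem represents_init (x : List Bool) :
    Represents ((N.machine k).init x) (fun _ => 0) (N.initTapes x) where
  head _ := rfl
  tape t := by
    have h : (if (Sum.inl t : N.Tape) = .inl N.input then x else []) =
        if t = N.input then x else [] := by
      by_cases h : t = N.input
      · simp [h]
      · simp [h]
    change (N.machine k).wordTape (if (Sum.inl t : N.Tape) = .inl N.input then x else []) = _
    rw [h]
    rfl
  head_out := rfl
  tape_out := by
    change (N.machine k).wordTape (if (Sum.inr true : N.Tape) = .inl N.input then x else []) = _
    rw [if_neg Sum.inr_ne_inl]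
    funext z
    simp [QOTM.wordTape]
    rfl

theorem freshHistory_init (x : List Bool) : FreshHistory ((N.machine k).init x) := by
  intro z _
  change (N.machine k).wordTape (if (Sum.inr false : N.Tape) = .inl N.input then x else []) z = _
  rw [if_neg Sum.inr_ne_inl]
  simp [QOTM.wordTape]
  rfl

/-- The quantum part is analysed relative to a background configuration; this allows `d` to be its
own background, whatever the other tapes contain. -/
theorem Represents.eq_conf {d : (N.machine k).Cfg} {H : N.T → ℤ} {τ : N.T → ℤ → N.G}
    (hd : Represents d H τ) {q : RoundState k} (hs : d.state = .inr q) {v : List Bool}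
    (hv : τ N.query = N.wordTape v) :
    d = conf d q (N.symEmb k none) v (H N.query) := by
  ext1
  · exact hs
  · change d.head = update d.head (N.machine k).queryTape _
    rw [← hd.head]
    exact (update_eq_self _ _).symm
  · change d.tape = update (update d.tape (N.machine k).queryTape _) (N.machine k).outputTape
      (update (d.tape (.inr true)) _ _)
    have h₁ : (N.machine k).wordTape v = d.tape (N.machine k).queryTape := by
      refine Eq.trans ?_ (hd.tape N.query).symm
      rw [hv]
      rfl
    have h₂ : update (d.tape (.inr true)) (d.head (N.machine k).outputTape) (N.symEmb k none) =
        d.tape (N.machine k).outputTape := by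
      refine update_eq_self_iff.2 ?_
      rw [hd.tape_out]
    rw [h₁, h₂, update_eq_self, update_eq_self]

/-- The quantum machine as a whole. -/
theorem Halts.machine_correct {n : ℕ} {x u : List Bool} {base : Bool} {H : N.T → ℤ}
    {τ : N.T → ℤ → N.G} (h : N.Halts n N.start (fun _ => 0) (N.initTapes x) H τ) (hu : u ≠ [])
    (hτ : τ N.query = N.wordTape (u ++ [base] ++ [true]))
    (hH : H N.query = (u ++ [base]).length) :
    (N.machine k).HaltsAt A x (n + (7 * k + 3)) ∧
    (N.machine k).QueriesAtMost A x (n + (7 * k + 3)) k ∧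
    (N.machine k).acceptProb ((N.machine k).run A x (n + (7 * k + 3))) =
      if (base ^^ xorNot (searchBits (fun l => chi A (u ++ [base] ++ l)) k)) = true
        then 1 else 0 := by
  obtain ⟨d, h₁, h₂, h₃, h₄⟩ := h.simulate (k := k) (A := A) (represents_init x) (freshHistory_init x)
    (dir := 0) rfl
  have hd := h₁.eq_conf h₂ hτ
  rw [hH] at hd
  have h₅ := leads_quantum (A := A) d hu base
  obtain ⟨d', h₆, h₇⟩ := becomes_quantum (A := A) d hu base h₁.head_out
  rw [← hd] at h₅ h₆
  have h₈ := h₃.trans h₅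
  rw [Nat.zero_add] at h₈
  refine ⟨h₈.haltsAt fun _ h => h, h₈.queriesAtMost, ?_⟩
  rw [(h₄.trans h₆).acceptProb_eq]
  have e : ∀ b, N.symEmb k (some b) = (N.machine k).sym (some true) ↔ b = true := fun b =>
    (N.symEmb k).injective.eq_iff.trans Option.some_inj
  refine if_congr ?_ rfl rfl
  rw [h₇]
  exact e _

end TapeProg

/-! ### From flow charts to programs for tapes -/

section StackTape

variable {K : Type} {Γ : K → Type}

open Classical in
/-- The symbol of stack `k` that is written in a cell. -/
def cellTop (k : K) (g : Option (Σ k, Γ k)) : Option (Γ k) :=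
  g.bind fun a => if h : a.1 = k then some (h ▸ a.2) else none

theorem cellTop_map (k : K) (o : Option (Γ k)) : cellTop k (o.map (Sigma.mk k)) = o := by
  cases o <;> simp [cellTop]

/-- The stack `l` written on a tape, with the top in cell `h`. -/
def stackTape (k : K) (l : List (Γ k)) (h : ℤ) : ℤ → Option (Σ k, Γ k) :=
  fun z => if z < h then none else l[(z - h).toNat]?.map (Sigma.mk k)

theorem stackTape_self (k : K) (l : List (Γ k)) (h : ℤ) :
    stackTape k l h h = l.head?.map (Sigma.mk k) := by
  simp [stackTape, List.head?_eq_getElem?]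

theorem update_stackTape_none (k : K) (l : List (Γ k)) (h : ℤ) :
    update (stackTape k l h) h none = stackTape k l.tail (h + 1) := by
  funext z
  by_cases hz : z = h
  · subst hz
    simp [stackTape]
  · rw [update_of_ne hz, stackTape, stackTape]
    by_cases h' : z < h
    · rw [if_pos h', if_pos (by omega)]
    · rw [if_neg h', if_neg (by omega), List.getElem?_tail,
        show (z - (h + 1)).toNat + 1 = (z - h).toNat by omega]

/-- Stacks grow to the left, so that an input word starting in cell `0` is already a stack with its
top there. -/
theorem update_stackTape_some (k : K) (l : List (Γ k)) (h : ℤ) (a : Γ k) :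
    update (stackTape k l h) (h + -1) (some ⟨k, a⟩) = stackTape k (a :: l) (h + -1) := by
  funext z
  by_cases hz : z = h + -1
  · subst hz
    simp [stackTape]
  · rw [update_of_ne hz, stackTape, stackTape]
    by_cases h' : z < h
    · rw [if_pos h', if_pos (by omega)]
    · rw [if_neg h', if_neg (by omega),
        show (z - (h + -1)).toNat = (z - h).toNat + 1 by omega, List.getElem?_cons_succ]

end StackTape

namespace Frag

variable {K : Type} [DecidableEq K] [Finite K] {Γ : K → Type} [∀ k, Finite (Γ k)] {k₀ k₁ : K}
  (F : Frag Γ Unit Unit) (e₀ : Γ k₀ ≃ Bool) (e₁ : Γ k₁ ≃ Bool)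

/-- The states of the simulation: besides those of the flow chart, there are states in which a
symbol is about to be pushed. -/
abbrev TapeState : Type := (F.Q ⊕ Unit) ⊕ (Σ k, Γ k) × (F.Q ⊕ Unit)

/-- Each stack is kept on a tape; at the exit the stack `k₁` is copied to the additional tape
`none`. -/
def tapeNext : F.TapeState → (Option K → Option (Σ k, Γ k)) →
    Option F.TapeState × (Option K → Option (Σ k, Γ k)) × (Option K → SignType)
  | .inl (.inl q), w => match F.prog q with
    | .jump z => (some (.inl z), w, fun _ => 0)
    | .push k a z => (some (.inr (⟨k, a⟩, z)), w, update (fun _ => 0) (some k) (-1))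
    | .peek k f => (some (.inl (f (cellTop k (w (some k))))), w, fun _ => 0)
    | .pop k f => (some (.inl (f (cellTop k (w (some k))))), update w (some k) none,
        update (fun _ => 0) (some k) 1)
  | .inl (.inr _), w => match cellTop k₁ (w (some k₁)) with
    | some a => (some (.inl (.inr ())),
        update (update w (some k₁) none) none (some ⟨k₀, e₀.symm (e₁ a)⟩),
        update (update (fun _ => 0) (some k₁) 1) none 1)
    | none => (none, update w none (some ⟨k₀, e₀.symm true⟩), fun _ => 0)
  | .inr (⟨k, a⟩, z), w => (some (.inl z), update w (some k) (some ⟨k, a⟩), fun _ => 0)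

/-- The program for tapes that simulates a flow chart. -/
def tapeProg : TapeProg where
  T := Option K
  C := F.TapeState
  G := Option (Σ k, Γ k)
  finT := Fintype.ofFinite _
  decT := inferInstance
  finC := by have := F.fin; exact Fintype.ofFinite _
  decC := Classical.decEq _
  finG := Fintype.ofFinite _
  sym := ⟨Option.map fun b => ⟨k₀, e₀.symm b⟩, Option.map_injective fun b b' h => by simpa using h⟩
  start := .inl (F.entry ())
  input := some k₀
  query := none
  input_ne_query := by simp
  next := F.tapeNext e₀ e₁

/-- The tapes `τ` with heads at `H` hold the stacks `s`, and the additional tape is blank. -/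
structure HoldsStore (s : Store Γ) (H : Option K → ℤ) (τ : Option K → ℤ → Option (Σ k, Γ k)) :
    Prop where
  stack : ∀ k, τ (some k) = stackTape k (s k) (H (some k))
  head_none : H none = 0
  tape_none : τ none = fun _ => none

variable {F e₀ e₁}

theorem halts_step {n : ℕ} {c c' : F.TapeState} {H H₁ H' : Option K → ℤ}
    {τ τ₁ τ' : Option K → ℤ → Option (Σ k, Γ k)} (w : Option K → Option (Σ k, Γ k))
    (d : Option K → SignType) (hn : F.tapeNext e₀ e₁ c (fun t => τ t (H t)) = (some c', w, d))
    (hH : ∀ t, H₁ t = H t + (d t : ℤ)) (hτ : ∀ t, τ₁ t = update (τ t) (H t) (w t))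
    (h : (F.tapeProg e₀ e₁).Halts n c' H₁ τ₁ H' τ') :
    (F.tapeProg e₀ e₁).Halts (n + 1) c H τ H' τ' := by
  obtain rfl : H₁ = fun t => H t + (d t : ℤ) := funext hH
  obtain rfl : τ₁ = fun t => update (τ t) (H t) (w t) := funext hτ
  exact TapeProg.Halts.step_of (N := F.tapeProg e₀ e₁) hn h

theorem halts_last {c : F.TapeState} {H : Option K → ℤ} {τ : Option K → ℤ → Option (Σ k, Γ k)}
    (w : Option K → Option (Σ k, Γ k)) (d : Option K → SignType)
    (hn : F.tapeNext e₀ e₁ c (fun t => τ t (H t)) = (none, w, d)) :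
    (F.tapeProg e₀ e₁).Halts 1 c H τ H fun t => update (τ t) (H t) (w t) :=
  TapeProg.Halts.last_of (N := F.tapeProg e₀ e₁) hn

/-- The bits are recoded by `e₀.symm ∘ e₁`, since the letters of the input stack play the role of
bits on all tapes. The head stays on the closing `true`, to which the first round of Deutsch's
algorithm applies its first Hadamard transformation. -/
theorem halts_copy (l : List (Γ k₁)) (v : List Bool) {H : Option K → ℤ}
    {τ : Option K → ℤ → Option (Σ k, Γ k)} (hl : τ (some k₁) = stackTape k₁ l (H (some k₁)))
    (hv : τ none = (F.tapeProg e₀ e₁).wordTape v) (hH : H none = v.length) :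
    ∃ H' τ', (F.tapeProg e₀ e₁).Halts (l.length + 1) (.inl (.inr ())) H τ H' τ' ∧
      τ' none = (F.tapeProg e₀ e₁).wordTape (v ++ l.map e₁ ++ [true]) ∧
      H' none = (v ++ l.map e₁).length := by
  have happ : ∀ (v : List Bool) (H : Option K → ℤ) (τ : Option K → ℤ → Option (Σ k, Γ k)),
      τ none = (F.tapeProg e₀ e₁).wordTape v → H none = v.length → ∀ b, update (τ none) (H none) (some ⟨k₀, e₀.symm b⟩) =
      (F.tapeProg e₀ e₁).wordTape (v ++ [b]) := fun v H τ hv hH b => by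
    rw [hv, hH]
    exact update_length_tape (F.tapeProg e₀ e₁).sym v b
  induction l generalizing v H τ with
  | nil =>
    let w : Option K → Option (Σ k, Γ k) :=
      update (fun t => τ t (H t)) none (some ⟨k₀, e₀.symm true⟩)
    let τ₁ : Option K → ℤ → Option (Σ k, Γ k) := fun t => update (τ t) (H t) (w t)
    have htop : cellTop k₁ (τ (some k₁) (H (some k₁))) = none := by
      rw [hl, stackTape_self, cellTop_map, List.head?_nil]
    refine ⟨H, τ₁, halts_last w (fun _ => 0) ?_, ?_, ?_⟩
    · simp only [tapeNext, htop, w]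
    · rw [List.map_nil, List.append_nil, ← happ v H τ hv hH]
      simp only [τ₁, w, update_self]
      rfl
    · simpa using hH
  | cons a l ih =>
    let w : Option K → Option (Σ k, Γ k) :=
      update (update (fun t => τ t (H t)) (some k₁) none) none (some ⟨k₀, e₀.symm (e₁ a)⟩)
    let d : Option K → SignType := update (update (fun _ => 0) (some k₁) 1) none 1
    let H₁ : Option K → ℤ := fun t => H t + (d t : ℤ)
    let τ₁ : Option K → ℤ → Option (Σ k, Γ k) := fun t => update (τ t) (H t) (w t)
    have htop : cellTop k₁ (τ (some k₁) (H (some k₁))) = some a := by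
      rw [hl, stackTape_self, cellTop_map, List.head?_cons]
    have h₁ : H₁ (some k₁) = H (some k₁) + 1 := by simp [H₁, d]
    have h₂ : H₁ none = (v ++ [e₁ a]).length := by simp [H₁, d, hH]
    have h₃ : τ₁ (some k₁) = stackTape k₁ l (H₁ (some k₁)) := by
      rw [h₁, ← List.tail_cons (a := a) (as := l), ← update_stackTape_none, ← hl]
      simp [τ₁, w]
    have h₄ : τ₁ none = (F.tapeProg e₀ e₁).wordTape (v ++ [e₁ a]) := by
      rw [← happ v H τ hv hH]
      simp only [τ₁, w, update_self]
    obtain ⟨H', τ', h₅, h₆, h₇⟩ := ih (v ++ [e₁ a]) h₃ h₄ h₂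
    refine ⟨H', τ', halts_step (c' := .inl (.inr ())) w d ?_ (fun _ => rfl) (fun _ => rfl) h₅,
      ?_, ?_⟩
    · simp only [tapeNext, htop, w, d]
    · simpa using h₆
    · simpa using h₇

/-- A step writes before it moves, so a push takes two steps: move to the left, then write. Stated
with a continuation, because copying the output follows the exit of the flow chart. -/
theorem HoldsStore.halts {z : F.Q ⊕ Unit} {s s' : Store Γ} {t : ℕ}
    (h : F.RunsFrom z s () s' t) {H : Option K → ℤ} {τ : Option K → ℤ → Option (Σ k, Γ k)}
    (hs : HoldsStore s H τ) :
    ∃ j ≤ 2 * t, ∃ H₁ τ₁, HoldsStore s' H₁ τ₁ ∧ ∀ n H' τ',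
      (F.tapeProg e₀ e₁).Halts n (.inl (.inr ())) H₁ τ₁ H' τ' →
      (F.tapeProg e₀ e₁).Halts (n + j) (.inl z) H τ H' τ' := by
  induction t generalizing z s H τ with
  | zero =>
    cases h
    exact ⟨0, le_rfl, H, τ, hs, fun _ _ _ h => h⟩
  | succ t ih =>
    cases z with
    | inr y =>
      have h' : F.step^[t + 1] (.inr y, s) = (.inr (), s') := h
      rw [iterate_step_exit] at h'
      cases h'
      exact ⟨0, by omega, H, τ, hs, fun _ _ _ h => h⟩
    | inl q =>
      have h' : F.RunsFrom ((F.prog q).exec s).1 ((F.prog q).exec s).2 () s' t := h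
      have htop : ∀ k, cellTop k (τ (some k) (H (some k))) = (s k).head? := fun k => by
        rw [hs.stack, stackTape_self, cellTop_map]
      cases hq : F.prog q with
      | jump z =>
        rw [hq] at h'
        obtain ⟨j, hj, H₁, τ₁, h₁, h₂⟩ := ih h' hs
        refine ⟨j + 1, by omega, H₁, τ₁, h₁, fun n H' τ' hh => ?_⟩
        refine halts_step (c' := .inl z) (fun t => τ t (H t)) (fun _ => 0) ?_ (by simp) (by simp)
          (h₂ n H' τ' hh)
        simp only [tapeNext, hq]
      | peek k f =>
        rw [hq] at h'
        obtain ⟨j, hj, H₁, τ₁, h₁, h₂⟩ := ih h' hs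
        refine ⟨j + 1, by omega, H₁, τ₁, h₁, fun n H' τ' hh => ?_⟩
        refine halts_step (c' := .inl (f (s k).head?)) (fun t => τ t (H t)) (fun _ => 0) ?_
          (by simp) (by simp) (h₂ n H' τ' hh)
        simp only [tapeNext, hq, htop]
      | pop k f =>
        rw [hq] at h'
        have hs' : HoldsStore (update s k (s k).tail)
            (fun t => H t + (update (fun _ => 0) (some k) 1 : Option K → SignType) t)
            (fun t => update (τ t) (H t) (update (fun t => τ t (H t)) (some k) none t)) := by
          refine ⟨fun k' => ?_, ?_, ?_⟩
          · by_cases hk : k' = k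
            · subst hk
              simp [hs.stack, update_stackTape_none]
            · simp [hk, hs.stack]
          · simpa using hs.head_none
          · simpa using hs.tape_none
        obtain ⟨j, hj, H₁, τ₁, h₁, h₂⟩ := ih h' hs'
        refine ⟨j + 1, by omega, H₁, τ₁, h₁, fun n H' τ' hh => ?_⟩
        refine halts_step (c' := .inl (f (s k).head?)) _ _ ?_ (fun _ => rfl) (fun _ => rfl)
          (h₂ n H' τ' hh)
        simp only [tapeNext, hq, htop]
      | push k a z =>
        rw [hq] at h'
        have hs' : HoldsStore (update s k (a :: s k))
            (fun t => H t + (update (fun _ => 0) (some k) (-1) : Option K → SignType) t)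
            (fun t => update (τ t) (H t + (update (fun _ => 0) (some k) (-1) : Option K → SignType) t)
              (update (fun t => τ t (H t + (update (fun _ => 0) (some k) (-1) :
                Option K → SignType) t)) (some k) (some ⟨k, a⟩) t)) := by
          refine ⟨fun k' => ?_, ?_, ?_⟩
          · by_cases hk : k' = k
            · subst hk
              simpa [hs.stack] using update_stackTape_some k' (s k') (H (some k')) a
            · simp [hk, hs.stack]
          · simpa using hs.head_none
          · simpa using hs.tape_none
        obtain ⟨j, hj, H₁, τ₁, h₁, h₂⟩ := ih h' hs'
        refine ⟨j + 2, by omega, H₁, τ₁, h₁, fun n H' τ' hh => ?_⟩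
        refine halts_step (c' := .inr (⟨k, a⟩, z)) (fun t => τ t (H t))
          (update (fun _ => 0) (some k) (-1)) ?_ (fun _ => rfl) (τ₁ := τ) (by simp) ?_
        · simp only [tapeNext, hq]
        · exact halts_step (n := n + j) (c' := .inl z) _ (fun _ => 0) rfl (by simp)
            (fun _ => rfl) (h₂ n H' τ' hh)

end Frag

/-- A function that is computable in polynomial time is computed by a program for tapes. -/
theorem FragPoly.exists_tapeProg {g : List Bool → List Bool} (h : FragPoly id g) :
    ∃ (N : TapeProg) (p : Polynomial ℕ), ∀ x, ∃ n ≤ p.eval x.length, ∃ H τ,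
      N.Halts n N.start (fun _ => 0) (N.initTapes x) H τ ∧
      τ N.query = N.wordTape (g x ++ [true]) ∧ H N.query = (g x).length := by
  obtain ⟨K, _, _, Γ, _, k₀, k₁, e₀, e₁, F, p, hF⟩ := h
  -- Simulation costs `2 * p`, copying costs the output length, which is at most `|x| + p`, and one
  -- step is needed to halt.
  refine ⟨F.tapeProg e₀ e₁, 3 * p + Polynomial.X + 1, fun x => ?_⟩
  have hx := hF x
  have hs : Frag.HoldsStore (Store.single k₀ ((id x).map e₀.symm)) (fun _ => 0)
      ((F.tapeProg e₀ e₁).initTapes x) := by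
    have ht : ∀ (t : Option K) (z : ℤ), (F.tapeProg e₀ e₁).initTapes x t z =
        Option.map (fun b => (⟨k₀, e₀.symm b⟩ : Σ k, Γ k))
          (if z < 0 then none else (if t = some k₀ then x else [])[z.toNat]?) := fun _ _ => rfl
    refine ⟨fun k => funext fun z => ?_, rfl, funext fun z => ?_⟩
    · rw [ht, stackTape, Int.sub_zero]
      by_cases hz : z < 0
      · rw [if_pos hz, if_pos hz]
        rfl
      · rw [if_neg hz, if_neg hz]
        by_cases hk : k = k₀
        · subst hk
          rw [if_pos rfl, Store.single_self]
          simp [Function.comp_def]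
          rfl
        · rw [if_neg (by simpa using hk), Store.single_of_ne hk]
          rfl
    · rw [ht, if_neg (show ¬ (none : Option K) = some k₀ by simp), List.getElem?_nil, ite_self]
      rfl
  obtain ⟨j, hj, H₁, τ₁, h₁, h₂⟩ := hs.halts (e₀ := e₀) (e₁ := e₁) hx
  have hlen := hx.length_le_single
  obtain ⟨H', τ', h₃, h₄, h₅⟩ := Frag.halts_copy (F := F) (e₀ := e₀) (e₁ := e₁) (v := [])
    (l := (g x).map e₁.symm) (H := H₁) (τ := τ₁) (by rw [h₁.stack, Store.single_self])
    (by rw [h₁.tape_none]; funext z; simp [TapeProg.wordTape]; rfl) (by simpa using h₁.head_none)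
  refine ⟨_, ?_, H', τ', h₂ _ _ _ h₃, ?_, ?_⟩
  · simp only [List.length_map, id] at hlen hj ⊢
    simp only [Polynomial.eval_add, Polynomial.eval_mul, Polynomial.eval_X, Polynomial.eval_one,
      Polynomial.eval_ofNat]
    omega
  · refine h₄.trans ?_
    simp
  · refine h₅.trans ?_
    simp

/-- Deutsch's algorithm, iterated: from a word `g x ++ [base x]` that is computable in polynomial
time, `k` queries determine the bits `searchBits`. -/
theorem FragPoly.mem_EQP {g : List Bool → List Bool} {base : List Bool → Bool}
    (h : FragPoly id fun x => g x ++ [base x]) (hg : ∀ x, g x ≠ []) {k : ℕ} {B L : Language Bool}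
    (hL : ∀ x, x ∈ L ↔
      (base x ^^ xorNot (searchBits (fun l => chi B (g x ++ [base x] ++ l)) k)) = true) :
    L ∈ EQP B k := by
  obtain ⟨N, p, hN⟩ := h.exists_tapeProg
  refine ⟨N.machine k, (N.presentation k).wellFormed, (N.presentation k).algebraicAmplitudes,
    p + Polynomial.C (7 * k + 3), fun x => ?_⟩
  obtain ⟨n, hn, H, τ, h₁, h₂, h₃⟩ := hN x
  obtain ⟨h₄, h₅, h₆⟩ := h₁.machine_correct (k := k) (A := B) (hg x) h₂ h₃
  refine ⟨n + (7 * k + 3), by simpa using hn, h₄, h₅, fun hx => ?_, fun hx => ?_⟩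
  · rw [h₆, if_pos ((hL x).1 hx)]
  · rw [h₆, if_neg fun h' => hx ((hL x).2 h')]

/-! ### Assembly of the theorem -/

theorem getD_map_toList {α : Type} [Fintype α] [DecidableEq α] (f : α → Bool) (w : List Bool)
    (a : α) : ((Finset.univ : Finset α).toList.map f ++ w).getD
      ((Finset.univ : Finset α).toList.idxOf a) false = f a := by
  have ha : a ∈ (Finset.univ : Finset α).toList := by simp
  have hlt := List.idxOf_lt_length_of_mem ha
  rw [List.getD_eq_getElem?_getD, List.getElem?_append_left (by simpa using hlt),
    List.getElem?_map, List.getElem?_eq_getElem hlt, List.getElem_idxOf]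
  rfl

/-- Needed because the oracle is controlled only on words with a bounded number of search bits. -/
theorem searchBits_congr {Φ Ψ : List Bool → Bool} {r : ℕ}
    (h : ∀ l : List Bool, l.length ≤ r → Φ l = Ψ l) : searchBits Φ r = searchBits Ψ r := by
  induction r with
  | zero => rfl
  | succ r ih =>
    rw [searchBits, searchBits, ih fun l hl => h l (by omega),
      h _ (by simp [length_searchBits]), h _ (by simp [length_searchBits])]

theorem take_ofFn_getD {α β : Type} (f : α → β) (d : α) (l : List α) {m : ℕ} (h : l.length ≤ m) :
    (List.ofFn fun i : Fin m => f (l.getD i d)).take l.length = l.map f := by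
  refine List.ext_getElem (by simpa using h) fun i h₁ h₂ => ?_
  have hi : i < l.length := by simpa using h₂
  simp [hi]

theorem PParNP_subset_EQPNP (k : ℕ) : PParNP (2 ^ (k + 1) - 2) ⊆ EQPNP k := by
  rintro L ⟨A, hA, queries, decision, hq, hd, hlen, hL⟩
  set m := 2 ^ (k + 1) - 2 with hm
  let vs := (Finset.univ : Finset (Fin m → Bool)).toList
  have hvs : 0 < vs.length := List.length_pos_of_mem (a := ⊥) (by simp [vs])
  -- What follows the list of queries is the truth table of `D`, one bit for `D ⊥` and at most `k`
  -- search bits. The oracle looks `D` up in the table and skips `vs.length + 1` bits to reach the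
  -- search bits.
  obtain ⟨B, hB, hBA⟩ := exists_oracle hA m (vs.length + 1 + k)
    (fun v r => decide (searchPos k (r.drop (vs.length + 1)) ≤
      mindChanges (fun u => r.getD (vs.idxOf u) false) v))
    (by
      intro v v' r hv h
      rw [decide_eq_true_eq] at h ⊢
      exact h.trans (mindChanges_mono _ hv))
  have htt : ∀ x, truthTable decision m x (queries x).length =
      vs.map fun u => decision (x, (List.ofFn u).take (queries x).length) := fun x => by
    simp [truthTable, bitVectors, vs]
  refine ⟨B, hB, FragPoly.mem_EQP (fragPoly_queryWord hq hd m) (fun x => ?_) fun x => ?_⟩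
  · rw [htt, ne_eq, List.append_eq_nil_iff, List.map_eq_nil_iff]
    exact fun h => hvs.ne' (List.length_eq_zero_iff.2 h.2)
  · set D : (Fin m → Bool) → Bool := fun u => decision (x, (List.ofFn u).take (queries x).length)
      with hD
    -- If there are fewer than `m` queries, the remaining coordinates hold the answer to `[]`; they
    -- are harmless, as `D` cuts its argument to the actual number of queries.
    set v : Fin m → Bool := fun i => chi A ((queries x).getD i []) with hv
    have hbase : decision (x, (List.replicate m false).take (queries x).length) = D ⊥ := by
      rw [hD, ← List.ofFn_const]
      rfl
    have hDv : D v = decision (x, (queries x).map (chi A)) := by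
      simp only [hD, hv, take_ofFn_getD (chi A) [] (queries x) (hlen x)]
    have hΦ : ∀ l : List Bool, l.length ≤ k →
        chi B (listCode (queries x) ++ truthTable decision m x (queries x).length ++ [D ⊥] ++ l) =
          decide (searchPos k l ≤ mindChanges D v) := by
      intro l hl
      have hDr : (fun u => (vs.map D ++ ([D ⊥] ++ l)).getD (vs.idxOf u) false) = D :=
        funext fun u => getD_map_toList D _ u
      rw [htt, List.append_assoc, List.append_assoc, hBA _ _ (by simp; omega), hDr,
        ← List.append_assoc, List.drop_left' (by simp)]
    rw [hbase, searchBits_congr hΦ, xorNot_searchBits (mindChanges_le D v),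
      ← eq_xor_mindChanges, hDv, hL]

end BoundedQueries

end

theorem theorem3 (k : ℕ) :
    BoundedQueries.PParNP (2 ^ (k + 1) - 2) ⊆ BoundedQueries.EQPNP k :=
  BoundedQueries.PParNP_subset_EQPNP k
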